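/- **Setting.** Fix countably infinite, pairwise disjoint sets of concept names $\mathsf{N_C}$, role names $\mathsf{N_R}$, individual names and concrete property names $\mathsf{N_F}$. Interpretations have a nonempty domain $\Delta$; a concrete property $f$ is interpreted as a subset of $\Delta\times\mathbb N$, and $\exists f.[\ell,u]$ (with $\ell,u\in\mathbb N$) denotes the set of $d\in\Delta$ such that $(d,i)\in f^{\mathcal I}$ for some $i\in[\ell,u]$. $\mathcal{KB}\models\alpha$ means that every interpretation satisfying $\mathcal{KB}$ satisfies $\alpha$, and $\Sigma(X)$ is the set of non-logical symbols occurring in $X$. A *$\mathcal{PL}$ knowledge base* is a finite set of axioms $\mathsf{func}(R)$ ($R$ a role name or a concrete property), $\mathsf{range}(S,A)$ ($S$ a role), $A\sqsubseteq B$, $\mathsf{disj}(A,B)$ ($A,B$ concept names). *Simple $\mathcal{PL}$ concepts* are given by $C::=A\mid\bot\mid\exists f.[\ell,u]\mid\exists R.C\mid C\sqcap C$ with $A\in\mathsf{N_C}$, $R\in\mathsf{N_R}$, $f\in\mathsf{N_F}$. A *$\mathcal{PL}$ subsumption query* is $C\sqsubseteq D$, where $C,D$ are finite nonempty unions of simple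 $\mathcal{PL}$ concepts. A *$\mathcal{PL}$ subsumption instance with oracle* is a triple $\langle\mathcal K,\mathcal O,q\rangle$ where $\mathcal K$ is a $\mathcal{PL}$ knowledge base, $\mathcal O$ is a Horn-$\mathcal{SRIQ}$ knowledge base, $q$ is a $\mathcal{PL}$ subsumption query, and $(\Sigma(\mathcal K)\cup\Sigma(q))\cap\Sigma(\mathcal O)\subseteq\mathsf{N_C}$. For $c\in\mathbb N$, $\mathcal{PLSO}_c$ is the set of those instances $\langle\mathcal K,\mathcal O,C\sqsubseteq D\rangle$ for which every simple disjunct of $C$ contains at most $c$ interval constraints $\exists f.[\ell,u]$. Let $\mathcal O^+_{\mathcal K}$ be $\mathcal O$ together with all axioms of the forms $A\sqsubseteq B$ and $\mathsf{disj}(A,B)$ of $\mathcal K$, and let $pos(\mathcal O^+_{\mathcal K})$ be the set of all inclusions $A_1\sqcap\dots\sqcap A_m\sqsubseteq A_{m+1}\sqcup\dots\sqcup A_n$ entailed by $\mathcal O^+_{\mathcal K}$, with $0\le m\le n$ and $A_1,\dots,A_n$ concept names in $\Sigma(\mathcal O^+_{\mathcal K})$ (the empty intersection is $\top$, the empty union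 is $\bot$). **Theorem.** For every $c\in\mathbb N$, deciding whether $\mathcal K\cup\mathcal O\models q$ for instances $\langle\mathcal K,\mathcal O,q\rangle$ in $\mathcal{PLSO}_c$ is in $\mathsf P$ relative to an oracle for $pos(\mathcal O^+_{\mathcal K})$. Precisely: there are a deterministic oracle Turing machine $M$ and a polynomial $p$ (depending only on $c$) such that, for every $\langle\mathcal K,\mathcal O,q\rangle\in\mathcal{PLSO}_c$, the machine $M$ with oracle $pos(\mathcal O^+_{\mathcal K})$, given a standard encoding $w$ of $\mathcal K$ and $q$ as input (numbers in binary; $\mathcal O$ itself is accessible only through the oracle, and each oracle query counts as one step), halts after at most $p(|w|)$ steps, and it accepts if and only if $\mathcal K\cup\mathcal O\models q$. -/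

import Mathlib

namespace PLSO

/-! ## Description logic: syntax

The countably infinite sets of concept names, role names, individual names and concrete property
names are four disjoint copies of `ℕ`. -/

/-- Role expressions: role names and their inverses. -/
inductive Role
  | name (r : ℕ)
  | inv (r : ℕ)

/-- The inverse of a role expression. -/
def Role.inverse : Role → Role
  | .name r => .inv r
  | .inv r => .name r

/-- Compound concepts: all constructors of `SRIQ`, plus interval constraints `∃ f.[l,u]`. -/
inductive Concept
  | top
  | bot
  | atom (A : ℕ)
  | inter (C D : Concept)
  | union (C D : Concept)
  | compl (C : Concept)
  | ex (R : Role) (C : Concept)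
  | all (R : Role) (C : Concept)
  | atLeast (n : ℕ) (S : Role) (C : Concept)
  | atMost (n : ℕ) (S : Role) (C : Concept)
  | self (S : Role)
  | interval (f l u : ℕ)

/-- Axioms. `ria [R₁, …, Rₙ] R` is the complex role inclusion `R₁ ∘ … ∘ Rₙ ⊑ R`. -/
inductive Axm
  | gci (C D : Concept)
  | roleDisj (S₁ S₂ : Role)
  | ria (w : List Role) (R : Role)
  | conceptAssertion (C : Concept) (a : ℕ)
  | roleAssertion (R : Role) (a b : ℕ)
  | conceptDisj (C D : Concept)
  | funcRole (R : Role)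
  | funcProp (f : ℕ)
  | range (R : Role) (C : Concept)

/-- Knowledge bases: finite sets of axioms, presented as lists. -/
abbrev KB := List Axm

/-! ## Semantics -/

/-- An interpretation with domain `Δ`; the concrete domain is `ℕ`. -/
structure Interp (Δ : Type) where
  conc : ℕ → Set Δ
  role : ℕ → Δ → Δ → Prop
  ind : ℕ → Δ
  prop : ℕ → Δ → ℕ → Prop

variable {Δ : Type}

/-- The extension of a role expression. -/
def Interp.roleExt (I : Interp Δ) : Role → Δ → Δ → Prop
  | .name r => fun x y => I.role r x y
  | .inv r => fun x y => I.role r y x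

/-- The extension of a concept. -/
def Interp.ext (I : Interp Δ) : Concept → Set Δ
  | .top => Set.univ
  | .bot => ∅
  | .atom A => I.conc A
  | .inter C D => I.ext C ∩ I.ext D
  | .union C D => I.ext C ∪ I.ext D
  | .compl C => (I.ext C)ᶜ
  | .ex R C => {x | ∃ y, I.roleExt R x y ∧ y ∈ I.ext C}
  | .all R C => {x | ∀ y, I.roleExt R x y → y ∈ I.ext C}
  | .atLeast n S C => {x | (n : ℕ∞) ≤ {y | I.roleExt S x y ∧ y ∈ I.ext C}.encard}
  | .atMost n S C => {x | {y | I.roleExt S x y ∧ y ∈ I.ext C}.encard ≤ (n : ℕ∞)}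
  | .self S => {x | I.roleExt S x x}
  | .interval f l u => {x | ∃ i, l ≤ i ∧ i ≤ u ∧ I.prop f x i}

/-- The composition of a list of roles. -/
def Interp.chainExt (I : Interp Δ) : List Role → Δ → Δ → Prop
  | [] => fun x y => x = y
  | R :: w => fun x y => ∃ z, I.roleExt R x z ∧ I.chainExt w z y

/-- `I` satisfies an axiom. -/
def Interp.Sat (I : Interp Δ) : Axm → Prop
  | .gci C D => I.ext C ⊆ I.ext D
  | .roleDisj S₁ S₂ => ∀ x y, ¬ (I.roleExt S₁ x y ∧ I.roleExt S₂ x y)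
  | .ria w R => ∀ x y, I.chainExt w x y → I.roleExt R x y
  | .conceptAssertion C a => I.ind a ∈ I.ext C
  | .roleAssertion R a b => I.roleExt R (I.ind a) (I.ind b)
  | .conceptDisj C D => I.ext C ∩ I.ext D = ∅
  | .funcRole R => ∀ x y z, I.roleExt R x y → I.roleExt R x z → y = z
  | .funcProp f => ∀ x i j, I.prop f x i → I.prop f x j → i = j
  | .range R C => ∀ x y, I.roleExt R x y → y ∈ I.ext C

/-- `O ⊨ α`: every interpretation (over a nonempty domain) that satisfies all axioms of `O`
satisfies `α`. -/
def Entails (O : KB) (α : Axm) : Prop :=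
  ∀ (Δ : Type) [Nonempty Δ] (I : Interp Δ), (∀ β ∈ O, I.Sat β) → I.Sat α

/-! ## Signatures -/

/-- Non-logical symbols. -/
inductive Symb
  | concept (A : ℕ)
  | role (r : ℕ)
  | ind (a : ℕ)
  | prop (f : ℕ)

/-- The set `N_C` of concept names. -/
def conceptNames : Set Symb := Set.range Symb.concept

def Role.sig : Role → Set Symb
  | .name r => {.role r}
  | .inv r => {.role r}

def Concept.sig : Concept → Set Symb
  | .top => ∅
  | .bot => ∅
  | .atom A => {.concept A}
  | .inter C D => C.sig ∪ D.sig
  | .union C D => C.sig ∪ D.sig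
  | .compl C => C.sig
  | .ex R C => R.sig ∪ C.sig
  | .all R C => R.sig ∪ C.sig
  | .atLeast _ S C => S.sig ∪ C.sig
  | .atMost _ S C => S.sig ∪ C.sig
  | .self S => S.sig
  | .interval f _ _ => {.prop f}

def Axm.sig : Axm → Set Symb
  | .gci C D => C.sig ∪ D.sig
  | .roleDisj S₁ S₂ => S₁.sig ∪ S₂.sig
  | .ria w R => (⋃ S ∈ w, S.sig) ∪ R.sig
  | .conceptAssertion C a => C.sig ∪ {.ind a}
  | .roleAssertion R a b => R.sig ∪ {.ind a, .ind b}
  | .conceptDisj C D => C.sig ∪ D.sig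
  | .funcRole R => R.sig
  | .funcProp f => {.prop f}
  | .range R C => R.sig ∪ C.sig

/-- The signature of a knowledge base. -/
def sig (O : KB) : Set Symb := ⋃ α ∈ O, α.sig

/-! ## Horn-`SRIQ` knowledge bases -/

/-- Regularity of the complex role inclusions of `O`. -/
def Regular (O : KB) : Prop :=
  ∃ lt : Role → Role → Prop,
    (∀ R, ¬ lt R R) ∧ (∀ R S T, lt R S → lt S T → lt R T) ∧
    (∀ S R, lt S R ↔ lt S.inverse R) ∧
    ∀ w R, Axm.ria w R ∈ O → w ≠ [] ∧ (∃ r, R = .name r) ∧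
      (w = [R, R] ∨ w = [R.inverse] ∨ (∀ S ∈ w, lt S R) ∨
        (∃ v, w = R :: v ∧ ∀ S ∈ v, lt S R) ∨ (∃ v, w = v ++ [R] ∧ ∀ S ∈ v, lt S R))

/-- The roles that are not simple: those implied by some composition of at least two roles. -/
inductive NonSimple (O : KB) : Role → Prop
  | comp {w : List Role} {R : Role} : Axm.ria w R ∈ O → 2 ≤ w.length → NonSimple O R
  | sub {S R : Role} : Axm.ria [S] R ∈ O → NonSimple O S → NonSimple O R
  | inverse {R : Role} : NonSimple O R → NonSimple O R.inverse

/-- `SRIQ` concepts: no interval constraints, and the roles in number restrictions and in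
`∃ S.Self` are simple. -/
def Concept.IsSRIQ (O : KB) : Concept → Prop
  | .top => True
  | .bot => True
  | .atom _ => True
  | .inter C D => C.IsSRIQ O ∧ D.IsSRIQ O
  | .union C D => C.IsSRIQ O ∧ D.IsSRIQ O
  | .compl C => C.IsSRIQ O
  | .ex _ C => C.IsSRIQ O
  | .all _ C => C.IsSRIQ O
  | .atLeast _ S C => ¬ NonSimple O S ∧ C.IsSRIQ O
  | .atMost _ S C => ¬ NonSimple O S ∧ C.IsSRIQ O
  | .self S => ¬ NonSimple O S
  | .interval _ _ _ => False

mutual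

/-- Concepts without negative literals: allowed on the left of a Horn inclusion. -/
def Concept.IsBody : Concept → Prop
  | .top => True
  | .bot => True
  | .atom _ => True
  | .inter C D => C.IsBody ∧ D.IsBody
  | .union C D => C.IsBody ∧ D.IsBody
  | .compl C => C.IsNeg
  | .ex _ C => C.IsBody
  | .all _ _ => False
  | .atLeast n _ C => n ≤ 1 ∧ C.IsBody
  | .atMost _ _ _ => False
  | .self _ => True
  | .interval _ _ _ => False

/-- Concepts without positive literals. -/
def Concept.IsNeg : Concept → Prop
  | .top => True
  | .bot => True
  | .atom _ => False
  | .inter C D => C.IsNeg ∧ D.IsNeg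
  | .union C D => C.IsNeg ∧ D.IsNeg
  | .compl C => C.IsBody
  | .ex _ _ => False
  | .all _ C => C.IsNeg
  | .atLeast _ _ _ => False
  | .atMost n _ C => n = 0 ∧ C.IsBody
  | .self _ => False
  | .interval _ _ _ => False

end

/-- Concepts with at most one positive literal per clause: allowed on the right of a Horn
inclusion. -/
def Concept.IsHead : Concept → Prop
  | .top => True
  | .bot => True
  | .atom _ => True
  | .inter C D => C.IsHead ∧ D.IsHead
  | .union C D => (C.IsNeg ∧ D.IsHead) ∨ (C.IsHead ∧ D.IsNeg)
  | .compl C => C.IsBody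
  | .ex _ C => C.IsHead
  | .all _ C => C.IsHead
  | .atLeast _ _ C => C.IsHead
  | .atMost n _ C => n ≤ 1 ∧ C.IsBody
  | .self _ => True
  | .interval _ _ _ => False

/-- The axioms admitted in a Horn-`SRIQ` knowledge base `O`. -/
def Axm.IsHornSRIQ (O : KB) : Axm → Prop
  | .gci C D => C.IsSRIQ O ∧ D.IsSRIQ O ∧ C.IsBody ∧ D.IsHead
  | .roleDisj S₁ S₂ => ¬ NonSimple O S₁ ∧ ¬ NonSimple O S₂
  | .ria _ _ => True
  | .conceptAssertion C _ => C.IsSRIQ O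
  | .roleAssertion _ _ _ => True
  | .conceptDisj _ _ => False
  | .funcRole _ => False
  | .funcProp _ => False
  | .range _ _ => False

/-- Horn-`SRIQ` knowledge bases. -/
def IsHornSRIQ (O : KB) : Prop := Regular O ∧ ∀ α ∈ O, α.IsHornSRIQ O

/-! ## The policy logic `PL` -/

/-- The axioms of `PL` knowledge bases. -/
inductive PLAxiom
  | funcRole (r : ℕ)
  | funcProp (f : ℕ)
  | range (S : Role) (A : ℕ)
  | incl (A B : ℕ)
  | disj (A B : ℕ)

def PLAxiom.toAxm : PLAxiom → Axm
  | .funcRole r => .funcRole (.name r)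
  | .funcProp f => .funcProp f
  | .range S A => .range S (.atom A)
  | .incl A B => .gci (.atom A) (.atom B)
  | .disj A B => .conceptDisj (.atom A) (.atom B)

/-- Simple `PL` concepts. -/
inductive SimplePL
  | atom (A : ℕ)
  | bot
  | interval (f l u : ℕ)
  | ex (r : ℕ) (C : SimplePL)
  | inter (C D : SimplePL)

def SimplePL.toConcept : SimplePL → Concept
  | .atom A => .atom A
  | .bot => .bot
  | .interval f l u => .interval f l u
  | .ex r C => .ex (.name r) C.toConcept
  | .inter C D => .inter C.toConcept D.toConcept

/-- The number of (occurrences of) interval constraints. -/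
def SimplePL.numIntervals : SimplePL → ℕ
  | .atom _ => 0
  | .bot => 0
  | .interval _ _ _ => 1
  | .ex _ C => C.numIntervals
  | .inter C D => C.numIntervals + D.numIntervals

/-- Full `PL` concepts: finite nonempty unions of simple `PL` concepts. -/
structure FullPL where
  disjuncts : List SimplePL
  ne : disjuncts ≠ []

/-- `C₁ ⊓ … ⊓ Cₙ`, which is `⊤` for `n = 0`. -/
def interList (l : List Concept) : Concept := l.foldr .inter .top

/-- `C₁ ⊔ … ⊔ Cₙ`, which is `⊥` for `n = 0`. -/
def unionList (l : List Concept) : Concept := l.foldr .union .bot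

def FullPL.toConcept (C : FullPL) : Concept := unionList (C.disjuncts.map SimplePL.toConcept)

/-! ## Subsumption instances with oracle -/

/-- Triples `⟨K, O, C ⊑ D⟩`. -/
structure Triple where
  K : List PLAxiom
  O : KB
  lhs : FullPL
  rhs : FullPL

/-- The main knowledge base. -/
def Triple.mainKB (π : Triple) : KB := π.K.map PLAxiom.toAxm

/-- The query `C ⊑ D`. -/
def Triple.query (π : Triple) : Axm := .gci π.lhs.toConcept π.rhs.toConcept

/-- The `PL` subsumption instances with oracle. -/
def IsPLSO (π : Triple) : Prop :=
  IsHornSRIQ π.O ∧ (sig π.mainKB ∪ π.query.sig) ∩ sig π.O ⊆ conceptNames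

/-- The instances in which every disjunct of `C` has at most `c` interval constraints. -/
def PLSOBounded (c : ℕ) : Set Triple :=
  {π | IsPLSO π ∧ ∀ C ∈ π.lhs.disjuncts, C.numIntervals ≤ c}

/-- The axioms `A ⊑ B` and `disj(A,B)`, which are moved from the main knowledge base to the
oracle. -/
def PLAxiom.isShifted : PLAxiom → Bool
  | .funcRole _ => false
  | .funcProp _ => false
  | .range _ _ => false
  | .incl _ _ => true
  | .disj _ _ => true

/-- The knowledge base `O⁺_K`: `O` together with all axioms of `K` that are neither range nor
functionality axioms. -/
def Triple.oPlus (π : Triple) : KB :=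
  π.O ++ (π.K.filter PLAxiom.isShifted).map PLAxiom.toAxm

/-- Oracle queries `A₁ ⊓ … ⊓ Aₘ ⊑ Aₘ₊₁ ⊔ … ⊔ Aₙ` (empty intersection `⊤`, empty union `⊥`). -/
structure OracleQuery where
  left : List ℕ
  right : List ℕ

def OracleQuery.toAxm (q : OracleQuery) : Axm :=
  .gci (interList (q.left.map .atom)) (unionList (q.right.map .atom))

/-- `pos(O)`: the queries over the concept names of `sig O` that are entailed by `O`. -/
def pos (O : KB) : Set OracleQuery :=
  {q | (∀ A ∈ q.left ++ q.right, Symb.concept A ∈ sig O) ∧ Entails O q.toAxm}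

/-! ## Encodings

Objects are written as lists of natural numbers in prefix notation, and a list of natural numbers
is written in binary, each number followed by a comma. -/

/-- The alphabet. -/
abbrev Sym := Computability.Γ'

/-- A list of natural numbers as a string. -/
def encodeNats (l : List ℕ) : List Sym :=
  l.flatMap fun n => (Computability.encodeNat n).map .bit ++ [.comma]

/-- A list: `1` before each item, `0` at the end. -/
def listCode {α : Type} (code : α → List ℕ) (l : List α) : List ℕ :=
  l.flatMap (fun x => 1 :: code x) ++ [0]

def Role.code : Role → List ℕ
  | .name r => [0, r]
  | .inv r => [1, r]

def PLAxiom.code : PLAxiom → List ℕ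
  | .funcRole r => [0, r]
  | .funcProp f => [1, f]
  | .range S A => 2 :: S.code ++ [A]
  | .incl A B => [3, A, B]
  | .disj A B => [4, A, B]

def SimplePL.code : SimplePL → List ℕ
  | .atom A => [0, A]
  | .bot => [1]
  | .interval f l u => [2, f, l, u]
  | .ex r C => 3 :: r :: C.code
  | .inter C D => 4 :: C.code ++ D.code

/-- The input string of an instance: the main knowledge base `K` and the query `C ⊑ D`. The external
ontology `O` is not part of the input; it can be accessed through the oracle only. -/
def Triple.input (π : Triple) : List Sym :=
  encodeNats (listCode PLAxiom.code π.K ++ listCode SimplePL.code π.lhs.disjuncts ++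
    listCode SimplePL.code π.rhs.disjuncts)

def OracleQuery.encode (q : OracleQuery) : List Sym :=
  encodeNats (listCode (fun A => [A]) q.left ++ listCode (fun A => [A]) q.right)

/-! ## Oracle Turing machines -/

/-- A deterministic multi-stack Turing machine (in the sense of `Turing.TM2`) with finitely many
stacks, labels and internal states, that moreover has an oracle stack and three
labels `ask`, `yes` and `no`. -/
structure OracleTM where
  (K Λ σ : Type)
  [decEqK : DecidableEq K]
  [finK : Fintype K]
  [finLabel : Fintype Λ]
  [finState : Fintype σ]
  inputStack : K
  oracleStack : K
  start : Λ
  initState : σ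
  ask : Λ
  yes : Λ
  no : Λ
  prog : Λ → Turing.TM2.Stmt (fun _ : K => Sym) Λ σ
  accept : σ → Prop

attribute [instance] OracleTM.decEqK

/-- Configurations: current label (`none` after halting), internal state, stack contents. -/
abbrev OracleTM.Cfg (M : OracleTM) : Type := Turing.TM2.Cfg (fun _ : M.K => Sym) M.Λ M.σ

open Classical in
/-- One step with oracle set `X`. At label `ask`, the machine moves to `yes` or `no` according to
whether the content of the oracle stack, read from the top, belongs to `X`; at any other label, the
program is executed; a halted machine stays as it is. -/
noncomputable def OracleTM.step (M : OracleTM) (X : Set (List Sym)) (s : M.Cfg) : M.Cfg :=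
  match s.l with
  | none => s
  | some l =>
    if l = M.ask then
      { l := some (if s.stk M.oracleStack ∈ X then M.yes else M.no), var := s.var, stk := s.stk }
    else Turing.TM2.stepAux (M.prog l) s.var s.stk

/-- The initial configuration: `w` on the input stack, first symbol on top; all other stacks are
empty. -/
def OracleTM.init (M : OracleTM) (w : List Sym) : M.Cfg where
  l := some M.start
  var := M.initState
  stk := fun k => if k = M.inputStack then w else []

/-- With oracle `X`, on input `w`, the machine halts after at most `t` steps, and it accepts if and
only if `P` holds. -/
def OracleTM.DecidesInTime (M : OracleTM) (X : Set (List Sym)) (w : List Sym) (t : ℕ) (P : Prop) :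
    Prop :=
  ∃ n ≤ t, ((M.step X)^[n] (M.init w)).l = none ∧
    (M.accept ((M.step X)^[n] (M.init w)).var ↔ P)

end PLSO

namespace PLSO

-- Treat each disjunct `C` of the left side separately. If `C` holds at an element `x` of a model,
-- then unravelling `C` along the model gives a finite tree: each `∃ R` adds an edge to a new node,
-- except that a functional `R` reuses an existing successor, and each interval constraint adds one
-- value at its node. The tree maps homomorphically to the model. Values may be rounded down to the
-- nearest of finitely many points, namely `0`, the lower bounds in the query and `u + 1` for the
-- upper bounds `u` on the right side. Rounding keeps the constraints of `C` true and makes no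
-- constraint on the right side true that was false before. So it suffices to inspect the trees
-- whose values form a tuple of points. There are `|P| ^ c` tuples of length `c`, which is
-- polynomial because `c` is fixed.
--
-- The procedure builds each such tree and discards it if it violates an interval or the
-- functionality of a property, or if the oracle refutes the names at some node (those from the
-- facts and from range axioms). In every remaining tree, some disjunct of the right side must hold
-- at the root, where a name holds at a node if it labels the node or the oracle derives it from the
-- labels. The oracle rejects queries that contain foreign names, so labels are first filtered by
-- the query `A ⊑ A`, which tests membership in the signature.
--
-- If the procedure accepts, the query is entailed (`entails_of_decideToks`): the tree that is read
-- off a model with rounding (`exists_foldl_buildStep`) survives, and whatever holds at its root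
-- holds at `x`. Conversely, a surviving tree in which the right side fails yields a countermodel
-- (`not_entails_of_valid`). This is where the Horn condition enters: terminological Horn axioms are
-- preserved by direct products (`Interp.pi_sat`), so for each node some model has an element whose
-- names are exactly those derived from the node's labels (`exists_exact_type`). The disjoint union
-- of these models and of one full model of `O⁺`, which carries the individuals, is a model of `O`
-- (`Interp.IsUnion.sat`). The tree is laid over the chosen elements. It can interpret the roles and
-- properties of `K` and of the query freely, because `O` shares only concept names with them.
--
-- For the time bound, data are binary trees written in prefix code on a stack. Functions computed
-- by structured stack programs in polynomial time (`PT`) are closed under composition, pairing,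
-- case distinction, oracle calls, and folds whose intermediate results stay polynomially large
-- (`PT.foldl`). The parser, the tree construction and the evaluation of concepts are such folds.
-- `Prog.toTM_run` compiles programs into oracle machines.

/-! ## Structured stack programs -/

/-- The stacks of a program: the main stack `S`, auxiliary stacks `A`, `B`, a counter `N`, and the
oracle stack `O`. -/
inductive Stk
  | S | A | B | N | O
  deriving DecidableEq

instance : Fintype Stk := ⟨{.S, .A, .B, .N, .O}, fun k => by cases k <;> decide⟩

/-- The register, which holds the symbol read last (`none` if the stack was empty). -/
abbrev Reg := Option Sym

/-- Structured programs over the five stacks. -/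
inductive Prog
  | skip
  | pop (k : Stk) (f : Reg → Reg → Reg)
  | peek (k : Stk)
  | push (k : Stk) (f : Reg → Sym)
  | ask
  | seq (p q : Prog)
  | ite (t : Reg → Bool) (p q : Prog)
  | loop (t : Reg → Bool) (p : Prog)

/-- Stack contents. -/
abbrev Stacks := Stk → List Sym

open Classical in
/-- `Run X p s s' n`: with oracle `X`, program `p` leads from `s` to `s'` in `n` steps. -/
inductive Run (X : Set (List Sym)) : Prog → Reg × Stacks → Reg × Stacks → ℕ → Prop
  | skip (s) : Run X .skip s s 1
  | pop (k f v K) :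
      Run X (.pop k f) (v, K) (f v (K k).head?, Function.update K k (K k).tail) 1
  | peek (k v K) : Run X (.peek k) (v, K) ((K k).head?, K) 1
  | push (k f v K) : Run X (.push k f) (v, K) (v, Function.update K k (f v :: K k)) 1
  | ask (v K) : Run X .ask (v, K) (some (.bit (decide (K .O ∈ X))), K) 3
  | seq {p q s s' s'' n m} : Run X p s s' n → Run X q s' s'' m → Run X (.seq p q) s s'' (n + m)
  | iteT {t p q s s' n} : t s.1 = true → Run X p s s' n → Run X (.ite t p q) s s' (n + 1)
  | iteF {t p q s s' n} : t s.1 = false → Run X q s s' n → Run X (.ite t p q) s s' (n + 1)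
  | loopF {t p s} : t s.1 = false → Run X (.loop t p) s s 1
  | loopT {t p s s' s'' n m} : t s.1 = true → Run X p s s' n → Run X (.loop t p) s' s'' m →
      Run X (.loop t p) s s'' (m + n + 1)

/-- The control points of a program. -/
def Prog.Lab : Prog → Type
  | .skip => Unit
  | .pop _ _ => Unit
  | .peek _ => Unit
  | .push _ _ => Unit
  | .ask => Unit
  | .seq p q => p.Lab ⊕ q.Lab
  | .ite _ p q => Option (p.Lab ⊕ q.Lab)
  | .loop _ p => Option p.Lab

/-- The entry point of a program. -/
def Prog.entry : (p : Prog) → p.Lab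
  | .skip => ()
  | .pop _ _ => ()
  | .peek _ => ()
  | .push _ _ => ()
  | .ask => ()
  | .seq p _ => .inl p.entry
  | .ite _ _ _ => none
  | .loop _ _ => none

/-- The set of control points is finite. -/
@[reducible]
def Prog.labFintype : (p : Prog) → Fintype p.Lab
  | .skip => inferInstanceAs (Fintype Unit)
  | .pop _ _ => inferInstanceAs (Fintype Unit)
  | .peek _ => inferInstanceAs (Fintype Unit)
  | .push _ _ => inferInstanceAs (Fintype Unit)
  | .ask => inferInstanceAs (Fintype Unit)
  | .seq p q =>
    let _ := p.labFintype
    let _ := q.labFintype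
    inferInstanceAs (Fintype (p.Lab ⊕ q.Lab))
  | .ite _ p q =>
    let _ := p.labFintype
    let _ := q.labFintype
    inferInstanceAs (Fintype (Option (p.Lab ⊕ q.Lab)))
  | .loop _ p =>
    let _ := p.labFintype
    inferInstanceAs (Fintype (Option p.Lab))

/-- Machine statements over labels `L`; the internal state consists of the register and of the
label at which the computation continues after an oracle query. -/
abbrev MStmt (L : Type) := Turing.TM2.Stmt (fun _ : Stk => Sym) L (Reg × L)

/-- The machine statement at a control point of a program whose control points are embedded into
the labels by `emb`, and which is followed by label `next`. -/
def Prog.code {L : Type} (ask : L) : (p : Prog) → (emb : p.Lab → L) → (next : L) → p.Lab → MStmt L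
  | .skip, _, next, _ => .goto fun _ => next
  | .pop k f, _, next, _ => .pop k (fun s x => (f s.1 x, s.2)) (.goto fun _ => next)
  | .peek k, _, next, _ => .peek k (fun s x => (x, s.2)) (.goto fun _ => next)
  | .push k f, _, next, _ => .push k (fun s => f s.1) (.goto fun _ => next)
  | .ask, _, next, _ => .load (fun s => (s.1, next)) (.goto fun _ => ask)
  | .seq p q, emb, _, .inl l => p.code ask (fun x => emb (.inl x)) (emb (.inr q.entry)) l
  | .seq _ q, emb, next, .inr l => q.code ask (fun x => emb (.inr x)) next l
  | .ite t p q, emb, _, none =>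
      .branch (fun s => t s.1) (.goto fun _ => emb (some (.inl p.entry)))
        (.goto fun _ => emb (some (.inr q.entry)))
  | .ite _ p _, emb, next, some (.inl l) => p.code ask (fun x => emb (some (.inl x))) next l
  | .ite _ _ q, emb, next, some (.inr l) => q.code ask (fun x => emb (some (.inr x))) next l
  | .loop t p, emb, next, none =>
      .branch (fun s => t s.1) (.goto fun _ => emb (some p.entry)) (.goto fun _ => next)
  | .loop _ p, emb, _, some l => p.code ask (fun x => emb (some x)) (emb none) l

/-- Labels of the machine of a program: its control points, and labels for `ask`, `yes`, `no` and
for halting. -/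
abbrev Prog.MLab (p : Prog) : Type := p.Lab ⊕ Fin 4

/-- The oracle machine of a program, with its input on stack `A`. -/
def Prog.toTM (p : Prog) : OracleTM :=
  { K := Stk
    Λ := p.MLab
    σ := Reg × p.MLab
    finLabel := by
      have := p.labFintype
      exact inferInstanceAs (Fintype (p.Lab ⊕ Fin 4))
    finState := by
      have := p.labFintype
      have : Fintype Sym := inferInstanceAs (Fintype Computability.Γ')
      exact inferInstanceAs (Fintype (Option Sym × (p.Lab ⊕ Fin 4)))
    inputStack := .A
    oracleStack := .O
    start := .inl p.entry
    initState := (none, .inr 3)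
    ask := .inr 0
    yes := .inr 1
    no := .inr 2
    prog := fun l => match l with
      | .inl l => p.code (.inr 0) Sum.inl (.inr 3) l
      | .inr 1 => .load (fun s => (some (.bit true), s.2)) (.goto fun s => s.2)
      | .inr 2 => .load (fun s => (some (.bit false), s.2)) (.goto fun s => s.2)
      | .inr _ => .halt
    accept := fun s => s.1 = some (.bit true) }

theorem OracleTM.step_of_ne (M : OracleTM) (X : Set (List Sym)) {l : M.Λ} (h : l ≠ M.ask)
    (v : M.σ) (K : M.K → List Sym) :
    M.step X ⟨some l, v, K⟩ = Turing.TM2.stepAux (M.prog l) v K := by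
  simp [OracleTM.step, h]

open Classical in
theorem OracleTM.step_ask (M : OracleTM) (X : Set (List Sym)) (v : M.σ) (K : M.K → List Sym) :
    M.step X ⟨some M.ask, v, K⟩ = ⟨some (if K M.oracleStack ∈ X then M.yes else M.no), v, K⟩ := by
  simp [OracleTM.step]

/-- Configurations of the machine of a program. -/
abbrev Prog.MCfg (P : Prog) : Type := Turing.TM2.Cfg (fun _ : Stk => Sym) P.MLab (Reg × P.MLab)

/-- The step function of the machine of a program. -/
noncomputable def Prog.mstep (P : Prog) (X : Set (List Sym)) : P.MCfg → P.MCfg := P.toTM.step X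

theorem Prog.mstep_inl (P : Prog) (X : Set (List Sym)) (l : P.Lab) (s : Reg × P.MLab)
    (K : Stacks) :
    P.mstep X ⟨some (Sum.inl l), s, K⟩
      = Turing.TM2.stepAux (P.code (.inr 0) Sum.inl (.inr 3) l) s K := by
  have : (Sum.inl l : P.toTM.Λ) ≠ P.toTM.ask := by intro h; cases h
  exact P.toTM.step_of_ne X this s K

open Classical in
-- The internal state stores the label to return to, so one triple of labels `ask`, `yes`, `no`
-- serves every oracle call in the program. The label `yes` or `no` writes the answer into the
-- register and jumps back.
theorem Prog.mstep_ask (P : Prog) (X : Set (List Sym)) (s : Reg × P.MLab) (K : Stacks) :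
    (P.mstep X)^[2] ⟨some (Sum.inr 0), s, K⟩
      = ⟨some s.2, (some (.bit (decide (K .O ∈ X))), s.2), K⟩ := by
  have h0 : P.mstep X ⟨some (Sum.inr 0), s, K⟩
      = ⟨some (if K .O ∈ X then Sum.inr 1 else Sum.inr 2), s, K⟩ := P.toTM.step_ask X s K
  have h1 : (Sum.inr 1 : P.toTM.Λ) ≠ P.toTM.ask := by
    intro h; exact absurd (Sum.inr.inj h) (by decide)
  have h2 : (Sum.inr 2 : P.toTM.Λ) ≠ P.toTM.ask := by
    intro h; exact absurd (Sum.inr.inj h) (by decide)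
  rw [Function.iterate_succ_apply, Function.iterate_one, h0]
  by_cases hX : K .O ∈ X
  · rw [if_pos hX, decide_eq_true hX]
    exact P.toTM.step_of_ne X h1 s K
  · rw [if_neg hX, decide_eq_false hX]
    exact P.toTM.step_of_ne X h2 s K

/-- Runs of programs are runs of their machines. -/
theorem Prog.toTM_run (P : Prog) (X : Set (List Sym)) {p : Prog} {s s' : Reg × Stacks} {n : ℕ}
    (h : Run X p s s' n) :
    ∀ (emb : p.Lab → P.Lab) (next : P.MLab),
      (∀ l, P.code (.inr 0) Sum.inl (.inr 3) (emb l)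
        = p.code (.inr 0) (fun x => Sum.inl (emb x)) next l) →
      ∀ r : P.MLab, ∃ r' : P.MLab,
        (P.mstep X)^[n] ⟨some (Sum.inl (emb p.entry)), (s.1, r), s.2⟩
          = ⟨some next, (s'.1, r'), s'.2⟩ := by
  -- The hypothesis on `emb` says that `p` occurs in `P` as a subprogram with continuation `next`,
  -- and it passes to the parts of `p`. The stored return label `r` is arbitrary, because oracle
  -- calls overwrite it.
  induction h with
  | skip s =>
    intro emb next hc r
    refine ⟨r, ?_⟩
    rw [Function.iterate_one, P.mstep_inl, hc]; rfl
  | pop k f v K =>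
    intro emb next hc r
    refine ⟨r, ?_⟩
    rw [Function.iterate_one, P.mstep_inl, hc]; rfl
  | peek k v K =>
    intro emb next hc r
    refine ⟨r, ?_⟩
    rw [Function.iterate_one, P.mstep_inl, hc]; rfl
  | push k f v K =>
    intro emb next hc r
    refine ⟨r, ?_⟩
    rw [Function.iterate_one, P.mstep_inl, hc]; rfl
  | ask v K =>
    intro emb next hc r
    refine ⟨next, ?_⟩
    rw [show (3 : ℕ) = 2 + 1 from rfl, Function.iterate_succ_apply, P.mstep_inl, hc]
    exact P.mstep_ask X (v, next) K
  | @seq p q s s' s'' n m _ _ ih1 ih2 =>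
    intro emb next hc r
    obtain ⟨r1, h1⟩ := ih1 (fun x => emb (.inl x)) (.inl (emb (.inr q.entry)))
      (fun l => hc (.inl l)) r
    obtain ⟨r2, h2⟩ := ih2 (fun x => emb (.inr x)) next (fun l => hc (.inr l)) r1
    refine ⟨r2, ?_⟩
    rw [Nat.add_comm, Function.iterate_add_apply]
    exact (congrArg _ h1).trans h2
  | @iteT t p q s s' n ht _ ih =>
    intro emb next hc r
    obtain ⟨r1, h1⟩ := ih (fun x => emb (some (.inl x))) next (fun l => hc (some (.inl l))) r
    refine ⟨r1, ?_⟩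
    rw [Function.iterate_succ_apply, P.mstep_inl, hc]
    refine Eq.trans (congrArg _ ?_) h1
    simp only [Prog.code, Prog.entry, Turing.TM2.stepAux, ht, cond_true]
  | @iteF t p q s s' n ht _ ih =>
    intro emb next hc r
    obtain ⟨r1, h1⟩ := ih (fun x => emb (some (.inr x))) next (fun l => hc (some (.inr l))) r
    refine ⟨r1, ?_⟩
    rw [Function.iterate_succ_apply, P.mstep_inl, hc]
    refine Eq.trans (congrArg _ ?_) h1
    simp only [Prog.code, Prog.entry, Turing.TM2.stepAux, ht, cond_false]
  | @loopF t p s ht =>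
    intro emb next hc r
    refine ⟨r, ?_⟩
    rw [Function.iterate_one, P.mstep_inl, hc]
    simp only [Prog.code, Prog.entry, Turing.TM2.stepAux, ht, cond_false]
  | @loopT t p s s' s'' n m ht _ _ ih1 ih2 =>
    intro emb next hc r
    obtain ⟨r1, h1⟩ := ih1 (fun x => emb (some x)) (.inl (emb none)) (fun l => hc (some l)) r
    obtain ⟨r2, h2⟩ := ih2 emb next hc r1
    refine ⟨r2, ?_⟩
    rw [Function.iterate_succ_apply, P.mstep_inl, hc, Function.iterate_add_apply]
    refine Eq.trans (congrArg _ (Eq.trans (congrArg _ ?_) h1)) h2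
    simp only [Prog.code, Prog.entry, Turing.TM2.stepAux, ht, cond_true]

/-- A program that leads from the input on stack `A` to the register content `true` or `false` is
an oracle machine that decides. -/
theorem Prog.toTM_decides (P : Prog) {X : Set (List Sym)} {w : List Sym} {K : Stacks} {b : Bool}
    {n t : ℕ} {Q : Prop}
    (h : Run X P (none, fun k => if k = .A then w else []) (some (.bit b), K) n)
    (hn : n + 1 ≤ t) (hQ : b = true ↔ Q) : P.toTM.DecidesInTime X w t Q := by
  obtain ⟨r, hr⟩ := P.toTM_run X h id (.inr 3) (fun _ => rfl) (.inr 3)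
  have h3 : (Sum.inr 3 : P.toTM.Λ) ≠ P.toTM.ask := by
    intro h; exact absurd (Sum.inr.inj h) (by decide)
  have hs : P.mstep X ⟨some (Sum.inr 3), (some (.bit b), r), K⟩
      = ⟨none, (some (.bit b), r), K⟩ := P.toTM.step_of_ne X h3 (some (.bit b), r) K
  -- The additional step executes `halt` at `.inr 3`, the label behind the program.
  have hf : (P.toTM.step X)^[n + 1] (P.toTM.init w) = ⟨none, (some (.bit b), r), K⟩ := by
    rw [Function.iterate_succ_apply']
    exact (congrArg (P.mstep X) hr).trans hs
  refine ⟨n + 1, hn, by rw [hf], ?_⟩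
  rw [hf, ← hQ]
  change some (Computability.Γ'.bit b) = some (.bit true) ↔ _
  simp

open Computability (Γ')

/-! ## Trees on stacks -/

/-- Binary trees, the data of programs. -/
inductive T
  | leaf (a : Option (Option Bool))
  | node (x y : T)

/-- The symbol of a leaf. -/
def leafSym : Option (Option Bool) → Sym
  | none => .blank
  | some none => .comma
  | some (some b) => .bit b

/-- The prefix code of a tree. -/
def T.code : T → List Sym
  | .leaf a => [leafSym a]
  | .node x y => .bra :: (x.code ++ y.code)

/-- The length of the code of a tree. -/
def T.size : T → ℕ
  | .leaf _ => 1
  | .node x y => 1 + x.size + y.size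

theorem T.length_code (x : T) : x.code.length = x.size := by
  induction x with
  | leaf a => rfl
  | node x y hx hy => simp [T.code, T.size, hx, hy]; omega

theorem T.size_pos (x : T) : 0 < x.size := by
  cases x <;> simp only [T.size] <;> omega

theorem leafSym_ne_bra (a : Option (Option Bool)) : leafSym a ≠ .bra := by
  rcases a with _ | _ | b <;> simp [leafSym]

theorem leafSym_injective : Function.Injective leafSym := by
  rintro (_ | _ | b) (_ | _ | b') h <;> simp_all [leafSym]

/-- Prefix code is self-delimiting: the first symbol tells leaves from nodes. The remainders `r`,
`r'` are what the induction needs at the second subtree. -/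
theorem T.code_append_injective (x : T) : ∀ (y : T) (r r' : List Sym),
    x.code ++ r = y.code ++ r' → x = y ∧ r = r' := by
  induction x with
  | leaf a =>
    rintro (b | ⟨y, y'⟩) r r' h
    · simp only [T.code, List.cons_append, List.nil_append, List.cons.injEq] at h
      exact ⟨by rw [leafSym_injective h.1], h.2⟩
    · simp only [T.code, List.cons_append, List.nil_append, List.cons.injEq] at h
      exact absurd h.1 (leafSym_ne_bra a)
  | node x x' hx hx' =>
    rintro (b | ⟨y, y'⟩) r r' h
    · simp only [T.code, List.cons_append, List.nil_append, List.cons.injEq] at h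
      exact absurd h.1.symm (leafSym_ne_bra b)
    · simp only [T.code, List.cons_append, List.append_assoc, List.cons.injEq, true_and] at h
      obtain ⟨h1, h2⟩ := hx _ _ _ h
      obtain ⟨h3, h4⟩ := hx' _ _ _ h2
      exact ⟨by rw [h1, h3], h4⟩

theorem T.code_injective {x y : T} (h : x.code = y.code) : x = y :=
  (T.code_append_injective x y [] [] (by simpa using h)).1

/-- The tree of a truth value. -/
def T.ofBool (b : Bool) : T := .leaf (some (some b))

/-- Stack contents, listed. -/
def st (s a b n o : List Sym) : Stacks
  | .S => s
  | .A => a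
  | .B => b
  | .N => n
  | .O => o

section st
variable (s a b n o x : List Sym)
@[simp] theorem st_S : st s a b n o .S = s := rfl
@[simp] theorem st_A : st s a b n o .A = a := rfl
@[simp] theorem st_B : st s a b n o .B = b := rfl
@[simp] theorem st_N : st s a b n o .N = n := rfl
@[simp] theorem st_O : st s a b n o .O = o := rfl
@[simp] theorem update_st_S : Function.update (st s a b n o) .S x = st x a b n o := by
  funext k; cases k <;> rfl
@[simp] theorem update_st_A : Function.update (st s a b n o) .A x = st s x b n o := by
  funext k; cases k <;> rfl
@[simp] theorem update_st_B : Function.update (st s a b n o) .B x = st s a x n o := by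
  funext k; cases k <;> rfl
@[simp] theorem update_st_N : Function.update (st s a b n o) .N x = st s a b x o := by
  funext k; cases k <;> rfl
@[simp] theorem update_st_O : Function.update (st s a b n o) .O x = st s a b n x := by
  funext k; cases k <;> rfl
end st

/-! ## Execution with time bounds -/

/-- From register content `v` and stacks `K`, program `p` leads to stacks `K'` in at most `n`
steps. -/
def ExecFrom (X : Set (List Sym)) (p : Prog) (v : Reg) (K K' : Stacks) (n : ℕ) : Prop :=
  ∃ v', ∃ m ≤ n, Run X p (v, K) (v', K') m

/-- From stacks `K`, with any register content, program `p` leads to stacks `K'` in at most `n`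
steps. -/
def Exec (X : Set (List Sym)) (p : Prog) (K K' : Stacks) (n : ℕ) : Prop :=
  ∀ v, ExecFrom X p v K K' n

variable {X : Set (List Sym)}

theorem ExecFrom.mono {p v K K' n m} (h : ExecFrom X p v K K' n) (hn : n ≤ m) :
    ExecFrom X p v K K' m := by
  obtain ⟨v', k, hk, h⟩ := h
  exact ⟨v', k, hk.trans hn, h⟩

theorem Exec.mono {p K K' n m} (h : Exec X p K K' n) (hn : n ≤ m) : Exec X p K K' m :=
  fun v => (h v).mono hn

theorem ExecFrom.seq {p q v K K' K'' n m} (h : ExecFrom X p v K K' n) (h' : Exec X q K' K'' m) :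
    ExecFrom X (.seq p q) v K K'' (n + m) := by
  obtain ⟨v', k, hk, h⟩ := h
  obtain ⟨v'', k', hk', h'⟩ := h' v'
  exact ⟨v'', k + k', Nat.add_le_add hk hk', h.seq h'⟩

theorem Exec.seq {p q K K' K'' n m} (h : Exec X p K K' n) (h' : Exec X q K' K'' m) :
    Exec X (.seq p q) K K'' (n + m) := fun v => (h v).seq h'

theorem Exec.skip (K) : Exec X .skip K K 1 := fun v => ⟨v, 1, le_rfl, .skip _⟩

theorem Exec.push (k : Stk) (x : Sym) (K) :
    Exec X (.push k fun _ => x) K (Function.update K k (x :: K k)) 1 :=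
  fun v => ⟨v, 1, le_rfl, .push _ _ _ _⟩

theorem Exec.pop (k : Stk) (f) (K) : Exec X (.pop k f) K (Function.update K k (K k).tail) 1 :=
  fun v => ⟨f v (K k).head?, 1, le_rfl, .pop _ _ _ _⟩

/-- Branching on the top symbol of a stack. -/
def ifTop (k : Stk) (t : Reg → Bool) (p q : Prog) : Prog := .seq (.peek k) (.ite t p q)

theorem Exec.ifTop_true {k t p q K K' n} (h : t (K k).head? = true) (hp : Exec X p K K' n) :
    Exec X (ifTop k t p q) K K' (n + 2) := by
  intro v
  obtain ⟨v', m, hm, hr⟩ := hp (K k).head?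
  exact ⟨v', 1 + (m + 1), by omega, (Run.peek k v K).seq (.iteT h hr)⟩

theorem Exec.ifTop_false {k t p q K K' n} (h : t (K k).head? = false) (hq : Exec X q K K' n) :
    Exec X (ifTop k t p q) K K' (n + 2) := by
  intro v
  obtain ⟨v', m, hm, hr⟩ := hq (K k).head?
  exact ⟨v', 1 + (m + 1), by omega, (Run.peek k v K).seq (.iteF h hr)⟩

/-- Pop a symbol into the register. -/
def popR (k : Stk) : Prog := .pop k fun _ x => x

/-- Push the register. -/
def pushR (k : Stk) : Prog := .push k fun v => v.getD .blank

/-- Empty stack `src`, with an execution of `q` for every symbol. -/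
def drain (src : Stk) (q : Prog) : Prog :=
  .seq (popR src) (.loop Option.isSome (.seq q (popR src)))

/-- By `hF`, the effect of the body commutes with changes of the stack that is being emptied, so the
total effect is a fold over its initial content. A symbol costs `c` steps, one pop and one loop
test; the last pop finds the stack empty. -/
theorem Exec.drain {src : Stk} {q : Prog} {c : ℕ} {F : Stacks → Sym → Stacks}
    (hF : ∀ K x l, F (Function.update K src l) x = Function.update (F K x) src l)
    (hq : ∀ K x, ExecFrom X q (some x) K (F K x) c) (l : List Sym) :
    ∀ K, K src = l →
      Exec X (drain src q) K (l.foldl F (Function.update K src [])) ((c + 2) * l.length + 2) := by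
  induction l with
  | nil =>
    intro K hK v
    have h := Run.pop (X := X) src (fun _ x => x) v K
    rw [hK] at h
    exact ⟨_, 1 + 1, le_rfl, h.seq (.loopF rfl)⟩
  | cons x l ih =>
    intro K hK v
    have h := Run.pop (X := X) src (fun _ x => x) v K
    rw [hK] at h
    obtain ⟨v1, m1, hm1, h1⟩ := hq (Function.update K src l) x
    rw [hF] at h1
    obtain ⟨v2, m2, hm2, h2⟩ := ih (Function.update (F K x) src l) (by simp) v1
    -- The run for the remaining symbols begins with the pop that ends the current pass of the loop.
    -- It is cut behind this pop and regrouped.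
    obtain ⟨n1, n2, hn, hp, hl⟩ : ∃ n1 n2, n1 + n2 = m2 ∧ ∃ s, Run X (popR src)
        (v1, Function.update (F K x) src l) s n1 ∧
        Run X (.loop Option.isSome (.seq q (popR src))) s (v2, _) n2 := by
      cases h2 with
      | seq ha hb => exact ⟨_, _, rfl, _, ha, hb⟩
    obtain ⟨hp, hl⟩ := hl
    refine ⟨v2, 1 + (n2 + (m1 + n1) + 1), ?_, h.seq (.loopT rfl (h1.seq hp) ?_)⟩
    · rw [List.length_cons]
      have : (c + 2) * (l.length + 1) = (c + 2) * l.length + c + 2 := by ring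
      omega
    · simpa [hF] using hl

/-- Move stack `src` to stack `dst` (in reverse order). -/
def move (src dst : Stk) : Prog := drain src (pushR dst)

/-- Move stack `src` to two stacks. -/
def move2 (src d₁ d₂ : Stk) : Prog := drain src (.seq (pushR d₁) (pushR d₂))

/-- Empty a stack. -/
def clear (src : Stk) : Prog := drain src .skip

theorem foldl_push (dst : Stk) (l : List Sym) : ∀ K : Stacks,
    l.foldl (fun K x => Function.update K dst (x :: K dst)) K
      = Function.update K dst (l.reverse ++ K dst) := by
  induction l with
  | nil => intro K; simp
  | cons x l ih => intro K; rw [List.foldl_cons, ih]; simp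

theorem Exec.move {src dst : Stk} (h : src ≠ dst) (K : Stacks) :
    Exec X (move src dst) K
      (Function.update (Function.update K src []) dst ((K src).reverse ++ K dst))
      (3 * (K src).length + 2) := by
  have := Exec.drain (X := X) (src := src) (q := pushR dst) (c := 1)
    (F := fun K x => Function.update K dst (x :: K dst))
    (fun K x l => by
      rw [Function.update_of_ne h.symm, Function.update_comm h])
    (fun K x => ⟨some x, 1, le_rfl, .push _ _ _ _⟩) (K src) K rfl
  rw [foldl_push] at this
  rwa [Function.update_of_ne h.symm] at this

theorem foldl_push2 {d₁ d₂ : Stk} (hd : d₁ ≠ d₂) (l : List Sym) : ∀ K : Stacks,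
    l.foldl (fun K x => Function.update (Function.update K d₁ (x :: K d₁)) d₂ (x :: K d₂)) K
      = Function.update (Function.update K d₁ (l.reverse ++ K d₁)) d₂ (l.reverse ++ K d₂) := by
  induction l with
  | nil => intro K; simp
  | cons x l ih =>
    intro K
    rw [List.foldl_cons, ih]
    funext k
    simp only [Function.update_apply]
    split_ifs <;> simp_all

theorem Exec.move2 {src d₁ d₂ : Stk} (h₁ : src ≠ d₁) (h₂ : src ≠ d₂) (hd : d₁ ≠ d₂) (K : Stacks) :
    Exec X (move2 src d₁ d₂) K
      (Function.update (Function.update (Function.update K src []) d₁ ((K src).reverse ++ K d₁))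
        d₂ ((K src).reverse ++ K d₂)) (4 * (K src).length + 2) := by
  have := Exec.drain (X := X) (src := src) (q := .seq (pushR d₁) (pushR d₂)) (c := 2)
    (F := fun K x => Function.update (Function.update K d₁ (x :: K d₁)) d₂ (x :: K d₂))
    (fun K x l => by
      funext k
      simp only [Function.update_apply]
      split_ifs <;> simp_all)
    (fun K x => by
      refine ⟨some x, 1 + 1, le_rfl, (Run.push _ _ _ _).seq ?_⟩
      have := Run.push (X := X) d₂ (fun v => v.getD .blank) (some x)
        (Function.update K d₁ (x :: K d₁))
      rwa [Function.update_of_ne hd.symm] at this) (K src) K rfl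
  rw [foldl_push2 hd] at this
  rwa [Function.update_of_ne h₁.symm, Function.update_of_ne h₂.symm] at this

theorem Exec.clear (src : Stk) (K : Stacks) :
    Exec X (clear src) K (Function.update K src []) (3 * (K src).length + 2) := by
  have := Exec.drain (X := X) (src := src) (q := .skip) (c := 1) (F := fun K _ => K)
    (fun K x l => rfl) (fun K x => ⟨some x, 1, le_rfl, .skip _⟩) (K src) K rfl
  have h : ∀ (l : List Sym) (K : Stacks), l.foldl (fun K _ => K) K = K := by
    intro l; induction l with
    | nil => intro K; rfl
    | cons x l ih => intro K; exact ih K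
  rwa [h] at this

/-- The body of the loop in `take`. -/
def takeBody (dst : Stk) : Prog :=
  .seq (popR .S) (.seq (pushR dst)
    (.seq (.ite (fun v => v = some .bra) (.push .N fun _ => .blank) (popR .N)) (.peek .N)))

/-- Move the tree on top of `S` to stack `dst` (in reverse order); the length of stack `N` is the
number of the trees still to be read. -/
def take (dst : Stk) : Prog :=
  .seq (.push .N fun _ => .blank) (.seq (.peek .N) (.loop Option.isSome (takeBody dst)))

theorem takeBody_bra {dst : Stk} (hS : dst ≠ .S) (hN : dst ≠ .N) (v : Reg) (K : Stacks)
    (r : List Sym) (hK : K .S = .bra :: r) :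
    Run X (takeBody dst) (v, K) (some .blank, Function.update (Function.update
      (Function.update K .S r) dst (.bra :: K dst)) .N (.blank :: K .N)) 5 := by
  have h1 := Run.pop (X := X) .S (fun _ x => x) v K
  rw [hK] at h1
  have h2 := Run.push (X := X) dst (fun v => v.getD .blank) (some .bra) (Function.update K .S r)
  rw [Function.update_of_ne hS] at h2
  have h3 := Run.push (X := X) .N (fun _ => .blank) (some .bra)
    (Function.update (Function.update K .S r) dst (.bra :: K dst))
  rw [Function.update_of_ne hN.symm, Function.update_of_ne (by decide)] at h3
  have h4 := Run.peek (X := X) .N (some .bra) (Function.update (Function.update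
      (Function.update K .S r) dst (.bra :: K dst)) .N (.blank :: K .N))
  rw [Function.update_self] at h4
  have h5 := h1.seq (h2.seq ((Run.iteT (t := fun v : Reg => v = some .bra) (q := popR .N)
    (by simp) h3).seq h4))
  exact h5

theorem takeBody_leaf {dst : Stk} (hS : dst ≠ .S) (hN : dst ≠ .N) (v : Reg) (K : Stacks)
    (x : Sym) (hx : x ≠ .bra) (r ns : List Sym) (hK : K .S = x :: r) (hn : K .N = .blank :: ns) :
    Run X (takeBody dst) (v, K) (ns.head?, Function.update (Function.update
      (Function.update K .S r) dst (x :: K dst)) .N ns) 5 := by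
  have h1 := Run.pop (X := X) .S (fun _ x => x) v K
  rw [hK] at h1
  have h2 := Run.push (X := X) dst (fun v => v.getD .blank) (some x) (Function.update K .S r)
  rw [Function.update_of_ne hS] at h2
  have h3 := Run.pop (X := X) .N (fun _ x => x) (some x)
    (Function.update (Function.update K .S r) dst (x :: K dst))
  rw [Function.update_of_ne hN.symm, Function.update_of_ne (by decide), hn] at h3
  have h4 := Run.peek (X := X) .N (some .blank) (Function.update (Function.update
      (Function.update K .S r) dst (x :: K dst)) .N ns)
  rw [Function.update_self] at h4
  have h5 := h1.seq (h2.seq ((Run.iteF (t := fun v : Reg => v = some .bra)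
    (p := .push .N fun _ => .blank) (by simp [hx]) h3).seq h4))
  exact h5

/-- The loop does not stop between the two subtrees of a node, so the induction is in continuation
form: a run that starts behind the tree is extended backwards. On `N`, a node replaces one pending
tree by two, and a leaf removes one. A symbol costs five steps in the body and one test. -/
theorem take_loop {dst : Stk} (hS : dst ≠ .S) (hN : dst ≠ .N) (x : T) :
    ∀ (K : Stacks) (v : Reg) (r ns : List Sym) (s : Reg × Stacks) (n : ℕ), v.isSome = true →
      K .S = x.code ++ r → K .N = .blank :: ns →
      Run X (.loop Option.isSome (takeBody dst)) (ns.head?, Function.update (Function.update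
        (Function.update K .S r) dst (x.code.reverse ++ K dst)) .N ns) s n →
      Run X (.loop Option.isSome (takeBody dst)) (v, K) s (n + 6 * x.size) := by
  induction x with
  | leaf a =>
    intro K v r ns s n hv hK hn h
    exact .loopT hv (takeBody_leaf hS hN v K _ (leafSym_ne_bra a) r ns hK hn) h
  | node x y hx hy =>
    intro K v r ns s n hv hK hn h
    have hK' : K .S = .bra :: (x.code ++ (y.code ++ r)) := by rw [hK]; simp [T.code]
    have h1 := takeBody_bra (X := X) hS hN v K _ hK'
    have e : n + 6 * (T.node x y).size = n + 6 * y.size + 6 * x.size + 5 + 1 := by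
      simp only [T.size]; ring
    rw [e]
    refine .loopT hv h1 (hx _ _ (y.code ++ r) (.blank :: ns) _ _ rfl ?_ ?_
      (hy _ _ r ns _ _ rfl ?_ ?_ ?_))
    · simp [Function.update_of_ne hS.symm]
    · simp [hn]
    · simp [Function.update_of_ne hS.symm]
    · simp
    · convert h using 2
      congr 1
      funext k
      simp only [Function.update_apply]
      split_ifs <;> simp_all [T.code]

theorem Exec.take {dst : Stk} (hS : dst ≠ .S) (hN : dst ≠ .N) (x : T) (K : Stacks) (r : List Sym)
    (hK : K .S = x.code ++ r) (hn : K .N = []) :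
    Exec X (take dst) K
      (Function.update (Function.update K .S r) dst (x.code.reverse ++ K dst))
      (6 * x.size + 3) := by
  intro v
  have h1 := Run.push (X := X) .N (fun _ => .blank) v K
  have h2 := Run.peek (X := X) .N v (Function.update K .N (.blank :: K .N))
  rw [Function.update_self] at h2
  refine ⟨none, 1 + (1 + (1 + 6 * x.size)), by omega, h1.seq (h2.seq
    (take_loop hS hN x _ _ r [] _ _ rfl (by simp [hK]) (by simp [hn]) ?_))⟩
  convert Run.loopF (X := X) (t := Option.isSome) (p := takeBody dst)
    (s := (none, (Function.update (Function.update K .S r) dst (x.code.reverse ++ K dst)))) rfl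
    using 2
  congr 1
  funext k
  simp only [Function.update_apply]
  split_ifs <;> simp_all

section take
variable (x : T) (s a b o : List Sym)

theorem Exec.takeA : Exec X (PLSO.take .A) (st (x.code ++ s) a b [] o)
    (st s (x.code.reverse ++ a) b [] o) (6 * x.size + 3) := by
  simpa using Exec.take (X := X) (dst := .A) (by decide) (by decide) x
    (st (x.code ++ s) a b [] o) s rfl rfl

theorem Exec.takeB : Exec X (PLSO.take .B) (st (x.code ++ s) a b [] o)
    (st s a (x.code.reverse ++ b) [] o) (6 * x.size + 3) := by
  simpa using Exec.take (X := X) (dst := .B) (by decide) (by decide) x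
    (st (x.code ++ s) a b [] o) s rfl rfl

theorem Exec.takeO : Exec X (PLSO.take .O) (st (x.code ++ s) a b [] o)
    (st s a b [] (x.code.reverse ++ o)) (6 * x.size + 3) := by
  simpa using Exec.take (X := X) (dst := .O) (by decide) (by decide) x
    (st (x.code ++ s) a b [] o) s rfl rfl

end take

section moves
variable (s a b o : List Sym)

theorem Exec.moveAS : Exec X (PLSO.move .A .S) (st s a b [] o) (st (a.reverse ++ s) [] b [] o)
    (3 * a.length + 2) := by
  simpa using Exec.move (X := X) (src := .A) (dst := .S) (by decide) (st s a b [] o)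

theorem Exec.moveBS : Exec X (PLSO.move .B .S) (st s a b [] o) (st (b.reverse ++ s) a [] [] o)
    (3 * b.length + 2) := by
  simpa using Exec.move (X := X) (src := .B) (dst := .S) (by decide) (st s a b [] o)

theorem Exec.moveOS : Exec X (PLSO.move .O .S) (st s a b [] o) (st (o.reverse ++ s) a b [] [])
    (3 * o.length + 2) := by
  simpa using Exec.move (X := X) (src := .O) (dst := .S) (by decide) (st s a b [] o)

theorem Exec.moveBA : Exec X (PLSO.move .B .A) (st s a b [] o) (st s (b.reverse ++ a) [] [] o)
    (3 * b.length + 2) := by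
  simpa using Exec.move (X := X) (src := .B) (dst := .A) (by decide) (st s a b [] o)

end moves

/-! ## Programs on the topmost tree -/

/-- The program replaces tree `x` on top of the main stack by tree `y` in at most `n` steps. -/
def Computes (X : Set (List Sym)) (p : Prog) (x y : T) (n : ℕ) : Prop :=
  ∀ s, Exec X p (st (x.code ++ s) [] [] [] []) (st (y.code ++ s) [] [] [] []) n

theorem Computes.mono {p x y n m} (h : Computes X p x y n) (hn : n ≤ m) : Computes X p x y m :=
  fun s => (h s).mono hn

theorem Computes.seq {p q x y z n m} (h : Computes X p x y n) (h' : Computes X q y z m) :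
    Computes X (.seq p q) x z (n + m) := fun s => (h s).seq (h' s)

/-- Duplicate the topmost tree. -/
def dupP : Prog := .seq (take .A) (.seq (move2 .A .S .B) (.seq (move .B .A) (move .A .S)))

theorem Exec.dupP (x : T) (s : List Sym) :
    Exec X dupP (st (x.code ++ s) [] [] [] []) (st (x.code ++ (x.code ++ s)) [] [] [] [])
      (16 * x.size + 9) := by
  have h1 := Exec.takeA (X := X) x s [] [] []
  have h2 := Exec.move2 (X := X) (src := .A) (d₁ := .S) (d₂ := .B) (by decide) (by decide)
    (by decide) (st s (x.code.reverse ++ []) [] [] [])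
  simp only [update_st_A, update_st_S, update_st_B, st_A, st_S, st_B, List.append_nil,
    List.reverse_reverse, List.length_reverse, T.length_code] at h1 h2
  have h3 := Exec.moveBA (X := X) (x.code ++ s) [] x.code []
  have h4 := Exec.moveAS (X := X) (x.code ++ s) x.code.reverse [] []
  simp only [List.append_nil, List.reverse_reverse, List.length_reverse, T.length_code] at h3 h4
  exact (h1.seq (h2.seq (h3.seq h4))).mono (by omega)

/-- Exchange the two topmost trees. -/
def swapP : Prog := .seq (take .A) (.seq (take .B) (.seq (move .A .S) (move .B .S)))

theorem Exec.swapP (x y : T) (s : List Sym) :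
    Exec X swapP (st (x.code ++ (y.code ++ s)) [] [] [] [])
      (st (y.code ++ (x.code ++ s)) [] [] [] []) (9 * x.size + 9 * y.size + 10) := by
  have h1 := Exec.takeA (X := X) x (y.code ++ s) [] [] []
  have h2 := Exec.takeB (X := X) y s x.code.reverse [] []
  have h3 := Exec.moveAS (X := X) s x.code.reverse y.code.reverse []
  have h4 := Exec.moveBS (X := X) (x.code ++ s) [] y.code.reverse []
  simp only [List.append_nil, List.reverse_reverse, List.length_reverse, T.length_code]
    at h1 h2 h3 h4
  exact (h1.seq (h2.seq (h3.seq h4))).mono (by omega)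

/-- Delete the topmost tree. -/
def dropP : Prog := .seq (take .A) (clear .A)

theorem Exec.dropP (x : T) (s : List Sym) :
    Exec X dropP (st (x.code ++ s) [] [] [] []) (st s [] [] [] []) (9 * x.size + 5) := by
  have h1 := Exec.takeA (X := X) x s [] [] []
  have h2 := Exec.clear (X := X) .A (st s x.code.reverse [] [] [])
  simp only [List.append_nil, List.length_reverse, T.length_code, update_st_A, st_A] at h1 h2
  exact (h1.seq h2).mono (by omega)

/-- Is the topmost symbol that of a node? -/
def isBra (v : Reg) : Bool := v = some .bra

/-- Execute a program if the topmost tree is a node, after removing the symbol of the node. -/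
def onNode (p : Prog) : Prog := ifTop .S isBra (.seq (popR .S) p) .skip

theorem Exec.onNode {p : Prog} {x y : T} {s : List Sym} {K n}
    (h : Exec X p (st (x.code ++ (y.code ++ s)) [] [] [] []) K n) :
    Exec X (onNode p) (st ((T.node x y).code ++ s) [] [] [] []) K (n + 3) := by
  have h1 := Exec.pop (X := X) .S (fun _ x => x) (st ((T.node x y).code ++ s) [] [] [] [])
  simp only [T.code, List.cons_append, st_S, List.tail_cons, update_st_S, List.append_assoc] at h1
  have e : (T.node x y).code ++ s = .bra :: (x.code ++ (y.code ++ s)) := by simp [T.code]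
  rw [e]
  exact (Exec.ifTop_true (n := 1 + n) (by simp [isBra]) (h1.seq h)).mono (by omega)

/-- A constant. -/
def leafP (a : Option (Option Bool)) : Prog := .seq dropP (.push .S fun _ => leafSym a)

theorem Computes.leaf (a : Option (Option Bool)) (x : T) :
    Computes X (leafP a) x (.leaf a) (9 * x.size + 6) := by
  intro s
  have h := Exec.push (X := X) .S (leafSym a) (st s [] [] [] [])
  rw [update_st_S] at h
  exact (Exec.dropP x s).seq h

/-- The first component of a node. -/
def fstP : Prog := onNode (.seq swapP dropP)

theorem Computes.fst (x y : T) :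
    Computes X fstP (.node x y) x (18 * x.size + 18 * y.size + 20) := by
  intro s
  exact (Exec.onNode ((Exec.swapP x y s).seq (Exec.dropP y (x.code ++ s)))).mono (by omega)

/-- The second component of a node. -/
def sndP : Prog := onNode dropP

theorem Computes.snd (x y : T) : Computes X sndP (.node x y) y (9 * x.size + 8) := by
  intro s
  exact (Exec.onNode (Exec.dropP x (y.code ++ s))).mono (by omega)

theorem Computes.snd_leaf (a : Option (Option Bool)) :
    Computes X sndP (.leaf a) (.leaf a) 3 := by
  intro s
  refine (Exec.ifTop_false ?_ (Exec.skip _)).mono (by omega)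
  simp [isBra, T.code, leafSym_ne_bra]

/-- Pairing. -/
def pairP (p q : Prog) : Prog :=
  .seq dupP (.seq p (.seq swapP (.seq q (.seq swapP (.push .S fun _ => .bra)))))

theorem Computes.pair {p q : Prog} {x y z : T} {n m : ℕ} (h : Computes X p x y n)
    (h' : Computes X q x z m) :
    Computes X (pairP p q) x (.node y z) (n + m + 25 * x.size + 18 * y.size + 9 * z.size + 30) := by
  intro s
  have h6 := Exec.push (X := X) .S .bra (st (y.code ++ (z.code ++ s)) [] [] [] [])
  rw [update_st_S] at h6
  have := (Exec.dupP (X := X) x s).seq ((h (x.code ++ s)).seq ((Exec.swapP y x s).seq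
    ((h' (y.code ++ s)).seq ((Exec.swapP z y s).seq h6))))
  simp only [T.code, List.cons_append, List.append_assoc]
  exact this.mono (by omega)

/-- Case distinction. -/
def iteP (c p q : Prog) : Prog :=
  .seq dupP (.seq c (ifTop .S (fun v => v = some (.bit true)) (.seq dropP p) (.seq dropP q)))

theorem Computes.ite {c p q : Prog} {x y : T} {b : Bool} {n m : ℕ}
    (h : Computes X c x (.ofBool b) n) (hp : b = true → Computes X p x y m)
    (hq : b = false → Computes X q x y m) :
    Computes X (iteP c p q) x y (n + m + 16 * x.size + 30) := by
  intro s
  have h1 := (Exec.dupP (X := X) x s)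
  have h2 := h (x.code ++ s)
  have h3 := Exec.dropP (X := X) (.ofBool b) (x.code ++ s)
  have hs : (T.ofBool b).size = 1 := rfl
  cases b with
  | true =>
    have h4 := h3.seq (hp rfl s)
    refine (h1.seq (h2.seq (Exec.ifTop_true ?_ h4))).mono (by omega)
    simp [T.ofBool, T.code, leafSym]
  | false =>
    have h4 := h3.seq (hq rfl s)
    refine (h1.seq (h2.seq (Exec.ifTop_false ?_ h4))).mono (by omega)
    simp [T.ofBool, T.code, leafSym]

/-- Compare the register with the top of stack `B`; on a mismatch, push a mark on `N`. -/
def cmpBody : Prog :=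
  .seq (.pop .B fun v w => if v = w then v else none)
    (.ite Option.isSome .skip (.push .N fun _ => .blank))

/-- The effect of `cmpBody`. -/
def cmpStep (K : Stacks) (x : Sym) : Stacks :=
  if (K .B).head? = some x then Function.update K .B (K .B).tail
  else Function.update (Function.update K .B (K .B).tail) .N (.blank :: K .N)

/-- Marks on `N` are never removed, and an exhausted `B` counts as a mismatch. Symbols left on `B`
go unnoticed, hence a prefix and not an equality. -/
theorem foldl_cmpStep (l : List Sym) : ∀ (s b n o : List Sym), ∃ n' : List Sym,
    l.foldl cmpStep (st s [] b n o) = st s [] (b.drop l.length) n' o ∧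
    n'.length ≤ n.length + l.length ∧ (n' = [] ↔ n = [] ∧ l <+: b) := by
  induction l with
  | nil => intro s b n o; exact ⟨n, by simp⟩
  | cons x l ih =>
    intro s b n o
    by_cases hb : b.head? = some x
    · obtain ⟨b', rfl⟩ : ∃ b', b = x :: b' := by
        cases b with
        | nil => simp at hb
        | cons y b' => simp at hb; exact ⟨b', by rw [hb]⟩
      obtain ⟨n', h1, h2, h3⟩ := ih s b' n o
      refine ⟨n', ?_, ?_, ?_⟩
      · simpa [cmpStep] using h1
      · simp only [List.length_cons]; omega
      · rw [h3, List.cons_prefix_cons]; simp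
    · obtain ⟨n', h1, h2, h3⟩ := ih s b.tail (.blank :: n) o
      refine ⟨n', ?_, ?_, ?_⟩
      · have : cmpStep (st s [] b n o) x = st s [] b.tail (.blank :: n) o := by
          simp [cmpStep, hb]
        rw [List.foldl_cons, this, h1]
        simp
      · simp only [List.length_cons] at h2 ⊢; omega
      · rw [h3]
        constructor
        · rintro ⟨h, -⟩; cases h
        · rintro ⟨-, ⟨t, rfl⟩⟩
          simp at hb

/-- Are the components of a node equal? -/
def eqP : Prog := onNode (.seq (take .A) (.seq (take .B) (.seq (drain .A cmpBody)
  (.seq (ifTop .B Option.isSome (.push .N fun _ => .blank) .skip) (.seq (clear .B)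
    (.seq (ifTop .N Option.isSome (.push .S fun _ => .bit false) (.push .S fun _ => .bit true))
      (clear .N)))))))

open Classical in
theorem Computes.eq (x y : T) :
    Computes X eqP (.node x y) (.ofBool (decide (x = y))) (20 * x.size + 20 * y.size + 40) := by
  intro s
  have h1 := Exec.takeA (X := X) x (y.code ++ s) [] [] []
  have h2 := Exec.takeB (X := X) y s x.code.reverse [] []
  have h3 := Exec.drain (X := X) (src := .A) (q := cmpBody) (F := cmpStep) (c := 3)
    (fun K z l => by
      simp only [cmpStep, Function.update_of_ne (show Stk.B ≠ .A by decide),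
        Function.update_of_ne (show Stk.N ≠ .A by decide)]
      split_ifs <;> (funext k; simp only [Function.update_apply]; split_ifs <;> simp_all))
    (fun K z => by
      have e1 := Run.pop (X := X) .B (fun v w => if v = w then v else none) (some z) K
      by_cases hz : (K .B).head? = some z
      · have e2 := e1.seq (.iteT (t := Option.isSome) (q := .push .N fun _ => .blank)
          (by simp [hz]) (.skip _))
        rw [cmpStep, if_pos hz]
        exact ⟨_, _, by norm_num, e2⟩
      · have e3 := Run.push (X := X) .N (fun _ => .blank) none
          (Function.update K .B (K .B).tail)
        rw [Function.update_of_ne (by decide)] at e3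
        rw [if_neg (Ne.symm hz)] at e1
        rw [cmpStep, if_neg hz]
        exact ⟨_, _, by norm_num, e1.seq (.iteF (t := Option.isSome) (p := .skip) rfl e3)⟩)
    x.code.reverse (st s x.code.reverse y.code.reverse [] []) rfl
  obtain ⟨n', e1, e2, e3⟩ := foldl_cmpStep x.code.reverse s y.code.reverse [] []
  rw [update_st_A, e1] at h3
  simp only [List.append_nil, List.length_reverse, T.length_code] at h1 h2 h3 e1 e2
  set b' := y.code.reverse.drop x.size with hb'
  -- Symbols left on `B` show that the prefix is proper, which is recorded by one more mark.
  obtain ⟨n2, h4, hn2, e4⟩ : ∃ n2, Exec X (ifTop .B Option.isSome (.push .N fun _ => .blank) .skip)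
      (st s [] b' n' []) (st s [] b' n2 []) 3 ∧ n2.length ≤ n'.length + 1 ∧
        (n2 = [] ↔ n' = [] ∧ b' = []) := by
    cases hb : b' with
    | nil => exact ⟨n', Exec.ifTop_false rfl (Exec.skip _), by simp, by simp⟩
    | cons z b'' =>
      refine ⟨.blank :: n', ?_, by simp, by simp⟩
      have := Exec.push (X := X) .N .blank (st s [] (z :: b'') n' [])
      rw [update_st_N] at this
      exact Exec.ifTop_true rfl this
  have h5 := Exec.clear (X := X) .B (st s [] b' n2 [])
  have hlen : b'.length ≤ y.size := by
    rw [hb', List.length_drop, List.length_reverse, T.length_code]; omega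
  have hxy : n2 = [] ↔ x = y := by
    rw [e4, e3]
    constructor
    · rintro ⟨⟨-, t, ht⟩, hd⟩
      rw [hb', ← ht, List.drop_left' (by rw [List.length_reverse, T.length_code])] at hd
      rw [hd, List.append_nil] at ht
      exact T.code_injective (List.reverse_injective ht)
    · rintro rfl
      refine ⟨⟨rfl, List.prefix_rfl⟩, ?_⟩
      rw [hb', List.drop_eq_nil_iff, List.length_reverse, T.length_code]
  have h6 : Exec X (ifTop .N Option.isSome (.push .S fun _ => .bit false)
      (.push .S fun _ => .bit true)) (st s [] [] n2 [])
      (st ((T.ofBool (decide (x = y))).code ++ s) [] [] n2 []) 3 := by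
    cases hn : n2 with
    | nil =>
      have := Exec.push (X := X) .S (.bit true) (st s [] [] [] [])
      rw [update_st_S] at this
      rw [decide_eq_true (hxy.1 hn)]
      exact Exec.ifTop_false rfl this
    | cons z n3 =>
      have := Exec.push (X := X) .S (.bit false) (st s [] [] (z :: n3) [])
      rw [update_st_S] at this
      rw [decide_eq_false (fun h => by simp [hxy.2 h] at hn)]
      exact Exec.ifTop_true rfl this
  have h7 := Exec.clear (X := X) .N (st ((T.ofBool (decide (x = y))).code ++ s) [] [] n2 [])
  simp only [update_st_B, update_st_N, st_B, st_N] at h5 h7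
  simp only [List.length_nil] at e2
  exact (Exec.onNode (h1.seq (h2.seq (h3.seq (h4.seq (h5.seq (h6.seq h7))))))).mono (by omega)

/-- The symbols of the alphabet of queries. -/
def isLetter : Sym → Bool
  | .bit _ => true
  | .comma => true
  | _ => false

/-- The string of bits and commas at the leaves of a tree. -/
def T.frontier (x : T) : List Sym := x.code.filter isLetter

/-- Ask the oracle for the frontier of the topmost tree. -/
def askP : Prog := .seq (take .A)
  (.seq (drain .A (.ite (fun v => isLetter (v.getD .blank)) (pushR .O) .skip))
    (.seq (.seq .ask (pushR .S)) (clear .O)))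

open Classical in
-- Brackets and blanks only carry the tree structure and are dropped. Draining the reversed code
-- restores the order of the letters on the oracle stack.
theorem Computes.ask (x : T) :
    Computes X askP x (.ofBool (decide (x.frontier ∈ X))) (14 * x.size + 20) := by
  intro s
  have h1 := Exec.takeA (X := X) x s [] [] []
  have h2 := Exec.drain (X := X) (src := .A)
    (q := .ite (fun v => isLetter (v.getD .blank)) (pushR .O) .skip)
    (F := fun K z => if isLetter z then Function.update K .O (z :: K .O) else K) (c := 2)
    (fun K z l => by
      by_cases hz : isLetter z
      · simp only [hz, if_true]
        rw [Function.update_of_ne (by decide), Function.update_comm (by decide)]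
      · simp [hz])
    (fun K z => by
      by_cases hz : isLetter z
      · have := Run.iteT (X := X) (t := fun v : Reg => isLetter (v.getD .blank)) (q := .skip)
          (s := (some z, K)) hz (Run.push .O (fun v => v.getD .blank) (some z) K)
        simp only [hz, if_true]
        exact ⟨_, _, le_rfl, this⟩
      · have := Run.iteF (X := X) (t := fun v : Reg => isLetter (v.getD .blank)) (p := pushR .O)
          (s := (some z, K)) (by simpa using hz) (Run.skip (some z, K))
        simp only [hz]
        exact ⟨_, _, le_rfl, this⟩)
    x.code.reverse (st s x.code.reverse [] [] []) rfl
  have hf : ∀ (l o : List Sym), l.foldl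
      (fun (K : Stacks) z => if isLetter z then Function.update K .O (z :: K .O) else K)
      (st s [] [] [] o) = st s [] [] [] ((l.filter isLetter).reverse ++ o) := by
    intro l
    induction l with
    | nil => intro o; simp
    | cons z l ih =>
      intro o
      by_cases hz : isLetter z
      · simp [hz, ih]
      · simp [hz, ih]
  rw [update_st_A, hf, List.append_nil, List.filter_reverse, List.reverse_reverse] at h2
  have h3 : Exec X (.seq .ask (pushR .S)) (st s [] [] [] x.frontier)
      (st ((T.ofBool (decide (x.frontier ∈ X))).code ++ s) [] [] [] x.frontier) 4 := by
    intro v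
    have e1 := Run.ask (X := X) v (st s [] [] [] x.frontier)
    have e2 := Run.push (X := X) .S (fun v => v.getD .blank)
      (some (.bit (decide (x.frontier ∈ X)))) (st s [] [] [] x.frontier)
    rw [update_st_S] at e2
    exact ⟨_, _, le_rfl, e1.seq e2⟩
  have h4 := Exec.clear (X := X) .O
    (st ((T.ofBool (decide (x.frontier ∈ X))).code ++ s) [] [] [] x.frontier)
  have hl : x.frontier.length ≤ x.size := by
    rw [← T.length_code]; exact List.length_filter_le _ _
  simp only [List.append_nil, List.length_reverse, T.length_code, update_st_O, st_O] at h1 h2 h4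
  exact (h1.seq (h2.seq (h3.seq h4))).mono (by omega)

/-- The tree of a list. -/
def T.list (l : List T) : T := l.foldr .node (.leaf none)

/-- The body of the loop in `foldP`. -/
def foldBody (p : Prog) : Prog :=
  .seq (take .A) (.seq (take .B) (.seq (take .O) (.seq (move .B .S) (.seq (move .O .S)
    (.seq (move .A .S) (.seq (.push .S fun _ => .bra) (.seq p swapP)))))))

theorem Exec.foldBody {p : Prog} {h t a a' : T} {n : ℕ} (hp : Computes X p (.node h a) a' n)
    (s : List Sym) :
    Exec X (foldBody p) (st (h.code ++ (t.code ++ (a.code ++ s))) [] [] [] [])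
      (st (t.code ++ (a'.code ++ s)) [] [] [] [])
      (n + 9 * h.size + 18 * t.size + 9 * a.size + 9 * a'.size + 26) := by
  have h1 := Exec.takeA (X := X) h (t.code ++ (a.code ++ s)) [] [] []
  have h2 := Exec.takeB (X := X) t (a.code ++ s) h.code.reverse [] []
  have h3 := Exec.takeO (X := X) a s h.code.reverse t.code.reverse []
  have h4 := Exec.moveBS (X := X) s h.code.reverse t.code.reverse a.code.reverse
  have h5 := Exec.moveOS (X := X) (t.code ++ s) h.code.reverse [] a.code.reverse
  have h6 := Exec.moveAS (X := X) (a.code ++ (t.code ++ s)) h.code.reverse [] []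
  have h7 := Exec.push (X := X) .S .bra (st (h.code ++ (a.code ++ (t.code ++ s))) [] [] [] [])
  have h8 := hp (t.code ++ s)
  have h9 := Exec.swapP (X := X) a' t s
  simp only [List.append_nil, List.reverse_reverse, List.length_reverse, T.length_code,
    update_st_S, st_S] at h1 h2 h3 h4 h5 h6 h7
  simp only [T.code, List.cons_append, List.append_assoc] at h8
  exact (h1.seq (h2.seq (h3.seq (h4.seq (h5.seq (h6.seq (h7.seq (h8.seq h9)))))))).mono (by omega)

/-- Fold over a list, the first component of a node, starting from the second component. -/
def foldP (p : Prog) : Prog :=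
  onNode (.seq (popR .S) (.loop isBra (.seq (foldBody p) (popR .S))))

/-- The symbol popped in front of each pass is `bra` for a further item and `blank` at the end of
the list; popping the latter also removes the list from the stack. The hypotheses concern only
accumulators that actually arise, so that size bounds on these can be used. -/
theorem fold_loop {β γ : Type} (eb : β → T) (ec : γ → T) {p : Prog} {F : β → γ → β} {n M : ℕ}
    (l : List γ) : ∀ (a : β) (s : List Sym),
    (∀ l₁ h l₂, l = l₁ ++ h :: l₂ →
      Computes X p (.node (ec h) (eb (l₁.foldl F a))) (eb (F (l₁.foldl F a) h)) n) →
    (∀ l₁, l₁ <+: l → (eb (l₁.foldl F a)).size ≤ M) →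
    Exec X (.seq (popR .S) (.loop isBra (.seq (foldBody p) (popR .S))))
      (st ((T.list (l.map ec)).code ++ ((eb a).code ++ s)) [] [] [] [])
      (st ((eb (l.foldl F a)).code ++ s) [] [] [] [])
      (l.length * (n + 18 * (T.list (l.map ec)).size + 18 * M + 30) + 2) := by
  induction l with
  | nil =>
    intro a s _ _ v
    have h1 := Run.pop (X := X) .S (fun _ x => x) v
      (st ((T.list []).code ++ ((eb a).code ++ s)) [] [] [] [])
    simp only [T.list, List.foldr_nil, T.code, leafSym, List.cons_append, List.nil_append, st_S,
      List.tail_cons, List.head?_cons, update_st_S] at h1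
    exact ⟨_, 1 + 1, by simp, h1.seq (.loopF rfl)⟩
  | cons h l ih =>
    intro a s hp hM v
    have h1 := Run.pop (X := X) .S (fun _ x => x) v
      (st ((T.list ((h :: l).map ec)).code ++ ((eb a).code ++ s)) [] [] [] [])
    have e : (T.list ((h :: l).map ec)).code ++ ((eb a).code ++ s)
      = .bra :: ((ec h).code ++ ((T.list (l.map ec)).code ++ ((eb a).code ++ s))) := by
      simp [T.list, T.code]
    rw [e] at h1 ⊢
    simp only [st_S, List.tail_cons, List.head?_cons, update_st_S] at h1
    obtain ⟨v2, m2, hm2, h2⟩ := Exec.foldBody (X := X) (t := T.list (l.map ec))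
      (hp [] h l rfl) s (some .bra)
    obtain ⟨v3, m3, hm3, h3⟩ := ih (F a h) s
      (fun l₁ h' l₂ hl => hp (h :: l₁) h' l₂ (by rw [hl]; rfl))
      (fun l₁ hl => hM (h :: l₁) (by simpa using hl)) v2
    have s1 := hM [] (List.nil_prefix)
    have s2 := hM [h] (by simp)
    have s3 : (T.list ((h :: l).map ec)).size = 1 + (ec h).size + (T.list (l.map ec)).size := rfl
    simp only [List.foldl_nil, List.foldl_cons] at hm2 h2 h3 s1 s2
    cases h3 with
    | @seq _ _ _ _ _ n1 n2 ha hb =>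
      refine ⟨v3, 1 + (n2 + (m2 + n1) + 1), ?_, h1.seq (.loopT rfl (h2.seq ha) hb)⟩
      rw [List.length_cons, Nat.add_mul]
      have : l.length * (n + 18 * (T.list (l.map ec)).size + 18 * M + 30)
        ≤ l.length * (n + 18 * (T.list ((h :: l).map ec)).size + 18 * M + 30) := by
        apply Nat.mul_le_mul_left; omega
      omega

theorem Computes.fold {β γ : Type} (eb : β → T) (ec : γ → T) {p : Prog} {F : β → γ → β} {n M : ℕ}
    (l : List γ) (a : β)
    (hp : ∀ l₁ h l₂, l = l₁ ++ h :: l₂ →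
      Computes X p (.node (ec h) (eb (l₁.foldl F a))) (eb (F (l₁.foldl F a) h)) n)
    (hM : ∀ l₁, l₁ <+: l → (eb (l₁.foldl F a)).size ≤ M) :
    Computes X (foldP p) (.node (T.list (l.map ec)) (eb a)) (eb (l.foldl F a))
      (l.length * (n + 18 * (T.list (l.map ec)).size + 18 * M + 30) + 5) := by
  intro s
  exact (Exec.onNode (fold_loop eb ec l a s hp hM))

theorem Run.length_le {p : Prog} {s s' : Reg × Stacks} {n : ℕ} (h : Run X p s s' n) (k : Stk) :
    (s'.2 k).length ≤ (s.2 k).length + n := by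
  induction h with
  | skip | ask | loopF | peek => simp
  | pop j f v K =>
    simp only [Function.update_apply]
    split_ifs with h
    · subst h; simp; omega
    · omega
  | push j f v K =>
    simp only [Function.update_apply]
    split_ifs with h
    · subst h; simp
    · omega
  | seq | iteT | iteF | loopT => omega

/-- A step pushes at most one symbol, so a time bound is also a bound on the output. -/
theorem Computes.size_le {p : Prog} {x y : T} {n : ℕ} (h : Computes X p x y n) :
    y.size ≤ x.size + n := by
  obtain ⟨v, m, hm, hr⟩ := h [] none
  have := hr.length_le .S
  simp only [st_S, List.append_nil, T.length_code] at this
  omega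

/-! ## Encodings of types as trees -/

/-- Types whose elements are represented by trees. -/
class Enc (α : Type) where
  enc : α → T
  inj : Function.Injective enc

/-- The size of the representation. -/
def sz {α : Type} [Enc α] (a : α) : ℕ := (Enc.enc a).size

theorem T.list_injective : Function.Injective T.list := by
  intro l
  induction l with
  | nil => rintro (_ | _) h <;> simp_all [T.list]
  | cons x l ih =>
    rintro (_ | ⟨y, l'⟩) h
    · simp [T.list] at h
    · simp only [T.list, List.foldr_cons, T.node.injEq] at h
      rw [h.1, ih h.2]

instance : Enc Unit := ⟨fun _ => .leaf none, fun _ _ _ => rfl⟩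
instance : Enc Bool := ⟨T.ofBool, fun a b h => by simpa [T.ofBool] using h⟩
instance : Enc (Option Bool) := ⟨fun x => .leaf (some x), fun a b h => by simpa using h⟩
instance {α β : Type} [Enc α] [Enc β] : Enc (α × β) :=
  ⟨fun p => .node (Enc.enc p.1) (Enc.enc p.2), fun p q h => by
    simp only [T.node.injEq] at h
    exact Prod.ext (Enc.inj h.1) (Enc.inj h.2)⟩
instance {α : Type} [Enc α] : Enc (List α) :=
  ⟨fun l => T.list (l.map Enc.enc), fun _ _ h =>
    List.map_injective_iff.2 Enc.inj (T.list_injective h)⟩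
instance : Enc ℕ :=
  ⟨fun n => Enc.enc (Computability.encodeNat n), fun n m h => by
    rw [← Computability.decode_encodeNat n, Enc.inj h, Computability.decode_encodeNat]⟩

section sizes
variable {α β : Type} [Enc α] [Enc β]

theorem sz_pos (a : α) : 0 < sz a := T.size_pos _

theorem sz_pair (a : α) (b : β) : sz (a, b) = 1 + sz a + sz b := rfl

theorem sz_nil : sz ([] : List α) = 1 := rfl

theorem sz_cons (a : α) (l : List α) : sz (a :: l) = 1 + sz a + sz l := rfl

theorem sz_bool (b : Bool) : sz b = 1 := rfl

theorem sz_unit (b : Unit) : sz b = 1 := rfl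

theorem sz_append (l l' : List α) : sz (l ++ l') + 1 = sz l + sz l' := by
  induction l with
  | nil => rw [List.nil_append, sz_nil]; omega
  | cons a l ih => rw [List.cons_append, sz_cons, sz_cons]; omega

theorem sz_reverse (l : List α) : sz l.reverse = sz l := by
  induction l with
  | nil => rfl
  | cons a l ih =>
    have := sz_append l.reverse [a]
    rw [List.reverse_cons, sz_cons]
    rw [sz_cons, sz_nil] at this
    omega

theorem sz_mem {a : α} {l : List α} (h : a ∈ l) : sz a ≤ sz l := by
  induction l with
  | nil => cases h
  | cons b l ih =>
    rw [sz_cons]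
    rcases List.mem_cons.1 h with rfl | h
    · omega
    · have := ih h; omega

theorem length_le_sz (l : List α) : l.length ≤ sz l := by
  induction l with
  | nil => simp
  | cons b l ih => rw [sz_cons, List.length_cons]; omega

theorem sz_sublist {l l' : List α} (h : l.Sublist l') : sz l ≤ sz l' := by
  induction h with
  | slnil => exact le_rfl
  | cons a _ ih => rw [sz_cons]; omega
  | cons_cons a _ ih => rw [sz_cons, sz_cons]; omega

theorem sz_list_le (l : List α) (M : ℕ) (h : ∀ a ∈ l, sz a ≤ M) :
    sz l ≤ l.length * (M + 1) + 1 := by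
  induction l with
  | nil => rw [sz_nil]; omega
  | cons a l ih =>
    have h1 := ih fun b hb => h b (List.mem_cons_of_mem _ hb)
    have h2 := h a List.mem_cons_self
    rw [sz_cons, List.length_cons, Nat.add_mul]; omega

end sizes

/-! ## Polynomial-time functions -/

/-- Oracles. -/
abbrev Orc := Set (List Sym)

theorem peval_mono (p : Polynomial ℕ) {a b : ℕ} (h : a ≤ b) : p.eval a ≤ p.eval b := by
  induction p using Polynomial.induction_on' with
  | add p q hp hq => simp only [Polynomial.eval_add]; omega
  | monomial n c =>
    simp only [Polynomial.eval_monomial]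
    exact Nat.mul_le_mul_left _ (Nat.pow_le_pow_left h n)

/-- Functions, relative to an oracle, that are computed by a program in polynomial time. -/
def PT {α β : Type} [Enc α] [Enc β] (f : Orc → α → β) : Prop :=
  ∃ (P : Prog) (p : Polynomial ℕ), ∀ X a, Computes X P (Enc.enc a) (Enc.enc (f X a)) (p.eval (sz a))

namespace PT

variable {α β γ δ : Type} [Enc α] [Enc β] [Enc γ] [Enc δ]

open Polynomial in
theorem size_le {f : Orc → α → β} (h : PT f) :
    ∃ p : Polynomial ℕ, ∀ X a, sz (f X a) ≤ p.eval (sz a) := by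
  obtain ⟨P, p, h⟩ := h
  refine ⟨p + X, fun Y a => ?_⟩
  have := (h Y a).size_le
  simp only [eval_add, eval_X]
  change sz (f Y a) ≤ sz a + _ at this
  omega

/-- A change of type that leaves the tree unchanged costs nothing. In this way `cons` is pairing,
and a number is the list of its bits. -/
theorem of_enc_eq {f : Orc → α → β} {g : Orc → α → γ} (hf : PT f)
    (h : ∀ X a, Enc.enc (f X a) = Enc.enc (g X a)) : PT g := by
  obtain ⟨P, p, hP⟩ := hf
  exact ⟨P, p, fun X a => h X a ▸ hP X a⟩

theorem of_eq {f g : Orc → α → β} (hf : PT f) (h : ∀ X a, f X a = g X a) : PT g :=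
  hf.of_enc_eq fun X a => by rw [h]

theorem id : PT (fun _ (a : α) => a) := by
  refine ⟨.skip, 1, fun X a s => ?_⟩
  simpa using Exec.skip (X := X) _

open Polynomial in
theorem comp {f : Orc → α → β} {g : Orc → β → γ} (hg : PT g) (hf : PT f) :
    PT (fun X a => g X (f X a)) := by
  obtain ⟨q, hq⟩ := hf.size_le
  obtain ⟨P, p, hP⟩ := hf
  obtain ⟨R, r, hR⟩ := hg
  refine ⟨.seq P R, p + r.comp q, fun Y a => ((hP Y a).seq (hR Y _)).mono ?_⟩
  simp only [eval_add, eval_comp]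
  exact Nat.add_le_add_left (peval_mono r (hq Y a)) _

open Polynomial in
theorem pair {f : Orc → α → β} {g : Orc → α → γ} (hf : PT f) (hg : PT g) :
    PT (fun X a => (f X a, g X a)) := by
  obtain ⟨pf, hpf⟩ := hf.size_le
  obtain ⟨pg, hpg⟩ := hg.size_le
  obtain ⟨P, p, hP⟩ := hf
  obtain ⟨R, r, hR⟩ := hg
  refine ⟨pairP P R, p + r + 25 * X + 18 * pf + 9 * pg + 30, fun Y a =>
    ((hP Y a).pair (hR Y a)).mono ?_⟩
  have h1 := hpf Y a
  have h2 := hpg Y a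
  simp only [eval_add, eval_mul, eval_X, eval_ofNat]
  change _ + _ + 25 * sz a + 18 * sz (f Y a) + 9 * sz (g Y a) + 30 ≤ _
  omega

open Polynomial in
theorem fst {f : Orc → α → β × γ} (hf : PT f) : PT (fun X a => (f X a).1) := by
  refine comp (g := fun _ (p : β × γ) => p.1) ⟨fstP, 18 * X + 20, fun Y a =>
    (Computes.fst (Enc.enc a.1) (Enc.enc a.2)).mono ?_⟩ hf
  simp only [eval_add, eval_mul, eval_X, eval_ofNat]
  change 18 * sz a.1 + 18 * sz a.2 + 20 ≤ 18 * (1 + sz a.1 + sz a.2) + 20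
  omega

open Polynomial in
theorem snd {f : Orc → α → β × γ} (hf : PT f) : PT (fun X a => (f X a).2) := by
  refine comp (g := fun _ (p : β × γ) => p.2) ⟨sndP, 9 * X + 8, fun Y a =>
    (Computes.snd (Enc.enc a.1) (Enc.enc a.2)).mono ?_⟩ hf
  simp only [eval_add, eval_mul, eval_X, eval_ofNat]
  change 9 * sz a.1 + 8 ≤ 9 * (1 + sz a.1 + sz a.2) + 8
  omega

open Polynomial in
theorem const (b : β) : PT (fun _ (_ : α) => b) := by
  -- The induction passes through subtrees, which need not encode elements of `β`.
  suffices h : ∀ t : T, ∃ (P : Prog) (p : Polynomial ℕ), ∀ (X : Orc) (x : T),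
      Computes X P x t (p.eval x.size) by
    obtain ⟨P, p, h⟩ := h (Enc.enc b)
    exact ⟨P, p, fun X a => h X _⟩
  intro t
  induction t with
  | leaf a =>
    refine ⟨leafP a, 9 * X + 6, fun Y x => (Computes.leaf a x).mono ?_⟩
    simp
  | node t u ht hu =>
    obtain ⟨P, p, hP⟩ := ht
    obtain ⟨R, r, hR⟩ := hu
    refine ⟨pairP P R, p + r + 25 * X + C (18 * t.size + 9 * u.size + 30), fun Y x =>
      ((hP Y x).pair (hR Y x)).mono ?_⟩
    simp only [eval_add, eval_mul, eval_X, eval_ofNat, eval_C]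
    omega

open Polynomial in
theorem cond {c : Orc → α → Bool} {f g : Orc → α → β} (hc : PT c) (hf : PT f) (hg : PT g) :
    PT (fun X a => bif c X a then f X a else g X a) := by
  obtain ⟨Q, q, hQ⟩ := hc
  obtain ⟨P, p, hP⟩ := hf
  obtain ⟨R, r, hR⟩ := hg
  refine ⟨iteP Q P R, q + p + r + 16 * X + 30, fun Y a => ?_⟩
  refine (Computes.ite (m := p.eval (sz a) + r.eval (sz a)) (hQ Y a) (fun h => ?_)
    (fun h => ?_)).mono ?_
  · simp only [h]; exact (hP Y a).mono (by omega)
  · simp only [h]; exact (hR Y a).mono (by omega)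
  · simp only [eval_add, eval_mul, eval_X, eval_ofNat]
    change _ + _ + 16 * sz a + 30 ≤ _
    omega

open Polynomial in
theorem eq [DecidableEq β] {f g : Orc → α → β} (hf : PT f) (hg : PT g) :
    PT (fun X a => decide (f X a = g X a)) := by
  refine comp (g := fun _ (p : β × β) => decide (p.1 = p.2)) ⟨eqP, 20 * X + 40, fun Y a => ?_⟩
    (hf.pair hg)
  have h := Computes.eq (X := Y) (Enc.enc a.1) (Enc.enc a.2)
  have e : (decide (a.1 = a.2))
      = @decide (Enc.enc a.1 = Enc.enc a.2) (Classical.propDecidable _) := by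
    by_cases ha : a.1 = a.2
    · rw [decide_eq_true ha, @decide_eq_true _ (Classical.propDecidable _) (congrArg _ ha)]
    · rw [decide_eq_false ha,
        @decide_eq_false _ (Classical.propDecidable _) (fun h => ha (Enc.inj h))]
  rw [← e] at h
  refine h.mono ?_
  simp only [eval_add, eval_mul, eval_X, eval_ofNat]
  change 20 * sz a.1 + 20 * sz a.2 + 40 ≤ 20 * (1 + sz a.1 + sz a.2) + 40
  omega

theorem and {f g : Orc → α → Bool} (hf : PT f) (hg : PT g) : PT (fun X a => f X a && g X a) :=
  (cond hf hg (const false)).of_eq fun X a => by cases f X a <;> rfl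

theorem or {f g : Orc → α → Bool} (hf : PT f) (hg : PT g) : PT (fun X a => f X a || g X a) :=
  (cond hf (const true) hg).of_eq fun X a => by cases f X a <;> rfl

theorem not {f : Orc → α → Bool} (hf : PT f) : PT (fun X a => !f X a) :=
  (cond hf (const false) (const true)).of_eq fun X a => by cases f X a <;> rfl

theorem cons {f : Orc → α → β} {g : Orc → α → List β} (hf : PT f) (hg : PT g) :
    PT (fun X a => f X a :: g X a) :=
  (pair hf hg).of_enc_eq fun _ _ => rfl

open Polynomial in
theorem tail {f : Orc → α → List β} (hf : PT f) : PT (fun X a => (f X a).tail) := by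
  refine comp (g := fun _ (p : List β) => p.tail) ⟨sndP, 9 * X + 8, fun Y l => ?_⟩ hf
  simp only [eval_add, eval_mul, eval_X, eval_ofNat]
  cases l with
  | nil => exact (Computes.snd_leaf none).mono (by omega)
  | cons b l =>
    refine (Computes.snd (Enc.enc b) (Enc.enc l)).mono ?_
    change 9 * sz b + 8 ≤ 9 * (1 + sz b + sz l) + 8
    omega

theorem isEmpty {f : Orc → α → List β} (hf : PT f) : PT (fun X a => (f X a).isEmpty) := by
  classical
  refine (hf.eq (const [])).of_eq fun X a => ?_
  cases f X a <;> simp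

open Polynomial in
theorem headI [Inhabited β] {f : Orc → α → List β} (hf : PT f) :
    PT (fun X a => (f X a).headI) := by
  refine comp (g := fun _ (p : List β) => p.headI) ?_ hf
  obtain ⟨P, p, hP⟩ := const (α := List β) (default : β)
  obtain ⟨E, e, hE⟩ := isEmpty (α := List β) PT.id
  refine ⟨iteP E P fstP, e + p + 34 * X + 50, fun Y l => ?_⟩
  refine (Computes.ite (m := p.eval (sz l) + 18 * sz l + 20) (hE Y l) (fun h => ?_)
    (fun h => ?_)).mono ?_
  · obtain rfl := List.isEmpty_iff.1 h
    exact (hP Y []).mono (by omega)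
  · cases l with
    | nil => cases h
    | cons b l =>
      refine (Computes.fst (Enc.enc b) (Enc.enc l)).mono ?_
      change 18 * sz b + 18 * sz l + 20 ≤ _ + 18 * (1 + sz b + sz l) + 20
      omega
  · simp only [eval_add, eval_mul, eval_X, eval_ofNat]
    change _ + _ + 16 * sz l + 30 ≤ _
    omega

open Polynomial in
/-- Folds, if the intermediate results have polynomial size. -/
theorem foldl {f : Orc → α → List γ} {g : Orc → α → β} {h : Orc → α → β → γ → β}
    (hf : PT f) (hg : PT g) (hh : PT (fun X (p : α × β × γ) => h X p.1 p.2.1 p.2.2))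
    (hb : ∃ q : Polynomial ℕ, ∀ X a l, l <+: f X a → sz (l.foldl (h X a) (g X a)) ≤ q.eval (sz a)) :
    PT (fun X a => (f X a).foldl (h X a) (g X a)) := by
  obtain ⟨q, hq⟩ := hb
  obtain ⟨pf, hpf⟩ := hf.size_le
  obtain ⟨Q, r, hQ⟩ := pair hf (pair PT.id hg)
  -- The input is carried along with the accumulator, because the step function may depend on it.
  obtain ⟨P, p, hP⟩ : PT (fun X (p : γ × α × β) => (p.2.1, h X p.2.1 p.2.2 p.1)) :=
    pair (fst (snd PT.id)) (comp hh (pair (fst (snd PT.id)) (pair (snd (snd PT.id)) (fst PT.id))))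
  refine ⟨.seq Q (.seq (foldP P) sndP),
    -- The argument of `p` bounds the size of the triple of list item, input and accumulator, whose
    -- two pairs account for the `2`.
    r + pf * (p.comp (2 + pf + X + q) + 18 * pf + 18 * (1 + X + q) + 30) + 9 * X + 20,
    fun Y a => ?_⟩
  have e : ∀ (l : List γ) (b : β), l.foldl (fun (s : α × β) x => (s.1, h Y s.1 s.2 x)) (a, b)
      = (a, l.foldl (h Y a) b) := by
    intro l
    induction l with
    | nil => intro b; rfl
    | cons x l ih => intro b; exact ih _
  have h1 : ∀ l, l <+: f Y a → sz (a, l.foldl (h Y a) (g Y a)) ≤ 1 + sz a + q.eval (sz a) := by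
    intro l hl
    rw [sz_pair]
    exact Nat.add_le_add_left (hq Y a l hl) _
  have hl := length_le_sz (f Y a)
  have hs := hpf Y a
  have h2 := Computes.fold (X := Y) Enc.enc Enc.enc (p := P)
    (F := fun (s : α × β) x => (s.1, h Y s.1 s.2 x))
    (n := p.eval (2 + pf.eval (sz a) + sz a + q.eval (sz a)))
    (M := 1 + sz a + q.eval (sz a)) (f Y a) (a, g Y a)
    (by
      intro l₁ x l₂ hx
      rw [e]
      refine (hP Y (x, a, l₁.foldl (h Y a) (g Y a))).mono (peval_mono p ?_)
      have h3 := hq Y a l₁ ⟨x :: l₂, hx.symm⟩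
      have h4 : sz x ≤ sz (f Y a) := sz_mem (by rw [hx]; simp)
      rw [sz_pair, sz_pair]
      omega)
    (fun l hl => by rw [e]; exact h1 l hl)
  rw [e] at h2
  have h3 := (hQ Y a).seq (h2.seq (Computes.snd _ _))
  refine h3.mono ?_
  simp only [eval_add, eval_mul, eval_X, eval_ofNat, eval_comp, eval_one]
  change _ + ((f Y a).length * (_ + 18 * sz (f Y a) + _ + _) + 5 + (9 * sz a + 8)) ≤ _
  have h5 : (f Y a).length * (p.eval (2 + pf.eval (sz a) + sz a + q.eval (sz a)) + 18 * sz (f Y a)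
      + 18 * (1 + sz a + q.eval (sz a)) + 30) ≤ pf.eval (sz a) *
      (p.eval (2 + pf.eval (sz a) + sz a + q.eval (sz a)) + 18 * pf.eval (sz a)
      + 18 * (1 + sz a + q.eval (sz a)) + 30) :=
    Nat.mul_le_mul (hl.trans hs) (by omega)
  omega

open Polynomial in
/-- Folds, if every step increases the size by at most a polynomial in the input. -/
theorem foldl_growth {f : Orc → α → List γ} {g : Orc → α → β} {h : Orc → α → β → γ → β}
    (hf : PT f) (hg : PT g) (hh : PT (fun X (p : α × β × γ) => h X p.1 p.2.1 p.2.2))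
    (hb : ∃ q : Polynomial ℕ, ∀ X a b c, c ∈ f X a → sz (h X a b c) ≤ sz b + q.eval (sz a)) :
    PT (fun X a => (f X a).foldl (h X a) (g X a)) := by
  obtain ⟨q, hq⟩ := hb
  obtain ⟨pf, hpf⟩ := hf.size_le
  obtain ⟨pg, hpg⟩ := hg.size_le
  refine foldl hf hg hh ⟨pg + pf * q, fun X a l hl => ?_⟩
  have key : ∀ (l : List γ) b, (∀ c ∈ l, c ∈ f X a) →
      sz (l.foldl (h X a) b) ≤ sz b + l.length * q.eval (sz a) := by
    intro l
    induction l with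
    | nil => intro b _; simp
    | cons c l ih =>
      intro b hc
      have h1 := ih (h X a b c) fun d hd => hc d (List.mem_cons_of_mem _ hd)
      have h2 := hq X a b c (hc c List.mem_cons_self)
      rw [List.foldl_cons, List.length_cons, Nat.add_mul]
      omega
  have h1 := key l (g X a) fun c hc => hl.subset hc
  have h2 := hpg X a
  have h3 : l.length * q.eval (sz a) ≤ pf.eval (sz a) * q.eval (sz a) :=
    Nat.mul_le_mul_right _ ((hl.length_le.trans (length_le_sz _)).trans (hpf X a))
  simp only [eval_add, eval_mul]
  omega

open Polynomial in
theorem reverse {f : Orc → α → List β} (hf : PT f) : PT (fun X a => (f X a).reverse) := by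
  obtain ⟨pf, hpf⟩ := hf.size_le
  refine (foldl_growth (h := fun _ _ b c => c :: b) hf (const [])
    (cons (snd (snd PT.id)) (fst (snd PT.id))) ⟨pf + 1, fun X a b c hc => ?_⟩).of_eq fun X a => ?_
  · have h1 := sz_mem hc
    have h2 := hpf X a
    simp only [sz_cons, eval_add, eval_one]
    omega
  · simp

open Polynomial in
theorem append {f g : Orc → α → List β} (hf : PT f) (hg : PT g) :
    PT (fun X a => f X a ++ g X a) := by
  obtain ⟨pf, hpf⟩ := hf.size_le
  refine (foldl_growth (h := fun _ _ b c => c :: b) hf.reverse hg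
    (cons (snd (snd PT.id)) (fst (snd PT.id))) ⟨pf + 1, fun X a b c hc => ?_⟩).of_eq fun X a => ?_
  · have h1 := sz_mem (List.mem_reverse.1 hc)
    have h2 := hpf X a
    simp only [sz_cons, eval_add, eval_one]
    omega
  · simp

section hof

variable {f : Orc → α → List γ}

open Polynomial in
theorem size_le_of_mem (hf : PT f) {g : Orc → α × γ → β} (hg : PT g) :
    ∃ q : Polynomial ℕ, ∀ X a c, c ∈ f X a → sz (g X (a, c)) ≤ q.eval (sz a) := by
  obtain ⟨pf, hpf⟩ := hf.size_le
  obtain ⟨pg, hpg⟩ := hg.size_le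
  refine ⟨pg.comp (1 + X + pf), fun Y a c hc => (hpg Y _).trans ?_⟩
  rw [eval_comp]
  refine peval_mono pg ?_
  have h1 := sz_mem hc
  have h2 := hpf Y a
  simp only [sz_pair, eval_add, eval_one, eval_X]
  omega

open Polynomial in
theorem map {g : Orc → α → γ → β} (hf : PT f) (hg : PT (fun X (p : α × γ) => g X p.1 p.2)) :
    PT (fun X a => (f X a).map (g X a)) := by
  obtain ⟨q, hq⟩ := size_le_of_mem hf hg
  refine (foldl_growth (h := fun X a b c => g X a c :: b) hf (const [])
    (cons (comp hg (pair (fst PT.id) (snd (snd PT.id)))) (fst (snd PT.id)))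
    ⟨q + 1, fun X a b c hc => ?_⟩).reverse.of_eq fun X a => ?_
  · have : sz (g X a c) ≤ q.eval (sz a) := hq X a c hc
    simp only [sz_cons, eval_add, eval_one]
    omega
  · suffices h : ∀ (l : List γ) r, (l.foldl (fun b c => g X a c :: b) r)
        = (l.map (g X a)).reverse ++ r by simp [h]
    intro l
    induction l with
    | nil => intro r; rfl
    | cons c l ih => intro r; simp [ih]

open Polynomial in
theorem flatMap {g : Orc → α → γ → List β} (hf : PT f)
    (hg : PT (fun X (p : α × γ) => g X p.1 p.2)) :
    PT (fun X a => (f X a).flatMap (g X a)) := by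
  obtain ⟨q, hq⟩ := size_le_of_mem hf hg
  refine (foldl_growth (h := fun X a b c => b ++ g X a c) hf (const [])
    (append (fst (snd PT.id)) (comp hg (pair (fst PT.id) (snd (snd PT.id)))))
    ⟨q, fun X a b c hc => ?_⟩).of_eq fun X a => ?_
  · have h1 : sz (g X a c) ≤ q.eval (sz a) := hq X a c hc
    have h2 := sz_append b (g X a c)
    change sz (b ++ g X a c) ≤ _
    omega
  · suffices h : ∀ (l : List γ) r, (l.foldl (fun b c => b ++ g X a c) r)
        = r ++ l.flatMap (g X a) by simp [h]
    intro l
    induction l with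
    | nil => intro r; simp
    | cons c l ih => intro r; simp [ih]

theorem filter {g : Orc → α → γ → Bool} (hf : PT f)
    (hg : PT (fun X (p : α × γ) => g X p.1 p.2)) :
    PT (fun X a => (f X a).filter (g X a)) := by
  refine (flatMap (g := fun X a c => bif g X a c then [c] else []) hf
    (cond hg (cons (snd PT.id) (const [])) (const []))).of_eq fun X a => ?_
  induction f X a with
  | nil => rfl
  | cons c l ih =>
    rw [List.flatMap_cons, ih]
    cases h : g X a c <;> simp [h]

open Polynomial in
theorem all {g : Orc → α → γ → Bool} (hf : PT f)
    (hg : PT (fun X (p : α × γ) => g X p.1 p.2)) :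
    PT (fun X a => (f X a).all (g X a)) := by
  refine (foldl_growth (h := fun X a b c => b && g X a c) hf (const true)
    (and (fst (snd PT.id)) (comp hg (pair (fst PT.id) (snd (snd PT.id)))))
    ⟨1, fun X a b c hc => ?_⟩).of_eq fun X a => ?_
  · rw [sz_bool, sz_bool]; omega
  · suffices h : ∀ (l : List γ) r, (l.foldl (fun b c => b && g X a c) r)
        = (r && l.all (g X a)) by simp [h]
    intro l
    induction l with
    | nil => intro r; simp
    | cons c l ih => intro r; simp [ih, Bool.and_assoc]

theorem any {g : Orc → α → γ → Bool} (hf : PT f)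
    (hg : PT (fun X (p : α × γ) => g X p.1 p.2)) :
    PT (fun X a => (f X a).any (g X a)) :=
  (all (g := fun X a c => !g X a c) hf hg.not).not.of_eq fun X a => by simp [List.any_eq_not_all_not]

end hof

/-! ## Oracle queries -/

/-- A list of bits and commas as a string. -/
def _root_.PLSO.symbols (l : List (Option Bool)) : List Sym := l.map fun x => leafSym (some x)

theorem _root_.PLSO.frontier_enc (l : List (Option Bool)) : (Enc.enc l).frontier = symbols l := by
  induction l with
  | nil => rfl
  | cons x l ih =>
    have : (Enc.enc (x :: l)).frontier = leafSym (some x) :: (Enc.enc l).frontier := by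
      change ((T.node (.leaf (some x)) (Enc.enc l)).code.filter isLetter) = _
      rcases x with _ | b <;> rfl
    rw [this, ih]
    rfl

open Classical Polynomial in
theorem ask {f : Orc → α → List (Option Bool)} (hf : PT f) :
    PT (fun X a => decide (symbols (f X a) ∈ X)) := by
  refine comp (g := fun X l => decide (symbols l ∈ X)) ⟨askP, 14 * X + 20, fun Y l => ?_⟩ hf
  have := Computes.ask (X := Y) (Enc.enc l)
  rw [frontier_enc] at this
  simp only [eval_add, eval_mul, eval_X, eval_ofNat]
  exact this

/-! ## Natural numbers -/

open Computability in
theorem bits {f : Orc → α → ℕ} (hf : PT f) : PT (fun X a => encodeNat (f X a)) :=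
  hf.of_enc_eq fun _ _ => rfl

end PT

/-- The number with the given bits, the least significant bit first. -/
def bitsVal (l : List Bool) : ℕ := l.foldr (fun b n => b.toNat + 2 * n) 0

open Computability in
theorem bitsVal_encodeNat (n : ℕ) : bitsVal (encodeNat n) = n := by
  have h : ∀ p : PosNum, bitsVal (encodePosNum p) = (p : ℕ) := by
    intro p
    induction p with
    | one => rfl
    | bit0 p ih =>
      rw [PosNum.cast_bit0, ← ih]
      simp only [encodePosNum, bitsVal, List.foldr_cons, Bool.toNat_false]
      omega
    | bit1 p ih =>
      rw [PosNum.cast_bit1, ← ih]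
      simp only [encodePosNum, bitsVal, List.foldr_cons, Bool.toNat_true]
      omega
  conv_rhs => rw [← Num.to_of_nat n]
  unfold encodeNat
  cases (n : Num) with
  | zero => rfl
  | pos p => exact h p

/-- One step of the comparison of two numbers: the bits of the second one that remain, and whether
the bits read so far are in the order `≤`. -/
def leStep (s : List Bool × Bool) (b : Bool) : List Bool × Bool :=
  (s.1.tail, bif decide (b = s.1.headI) then s.2 else s.1.headI)

/-- Comparison of numbers in binary. -/
def leBits (l m : List Bool) : Bool :=
  let s := l.foldl leStep (m, true)
  s.1.any (fun b => b) || s.2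

/-- The least significant bits come first, so a later difference overrides the verdict `c` on the
earlier bits. Since `headI` of the empty list is `false`, a shorter second number is padded with
zeros; if a true bit of it remains at the end, it is the larger one. -/
theorem foldl_leStep (l : List Bool) : ∀ (m : List Bool) (c : Bool),
    ((l.foldl leStep (m, c)).1.any (fun b => b) || (l.foldl leStep (m, c)).2) = true ↔
      bitsVal l < bitsVal m ∨ bitsVal l = bitsVal m ∧ c = true := by
  induction l with
  | nil =>
    intro m c
    have h : m.any (fun b => b) = true ↔ 0 < bitsVal m := by
      induction m with
      | nil => simp [bitsVal]
      | cons b m ih =>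
        simp only [List.any_cons, Bool.or_eq_true, ih, bitsVal, List.foldr_cons]
        cases b <;> simp
    have h0 : bitsVal [] = 0 := rfl
    rw [List.foldl_nil, Bool.or_eq_true, h, h0]
    constructor
    · rintro (h | h)
      · exact .inl h
      · rcases Nat.eq_zero_or_pos (bitsVal m) with h' | h'
        · exact .inr ⟨h'.symm, h⟩
        · exact .inl h'
    · rintro (h | h)
      · exact .inl h
      · exact .inr h.2
  | cons b l ih =>
    intro m c
    have e : bitsVal m = m.headI.toNat + 2 * bitsVal m.tail := by cases m <;> rfl
    have e' : bitsVal (b :: l) = b.toNat + 2 * bitsVal l := rfl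
    rw [List.foldl_cons, leStep, ih, e, e']
    cases b <;> cases m.headI <;> simp <;> omega

theorem leBits_encodeNat (n m : ℕ) :
    leBits (Computability.encodeNat n) (Computability.encodeNat m) = decide (n ≤ m) := by
  rw [Bool.eq_iff_iff, leBits, foldl_leStep, bitsVal_encodeNat, bitsVal_encodeNat,
    decide_eq_true_iff, Nat.le_iff_lt_or_eq]
  simp

/-- The successor of a number in binary. -/
def incBits : List Bool → List Bool
  | [] => [true]
  | false :: l => true :: l
  | true :: l => false :: incBits l

/-- One step of the computation of the successor: the reversed output, and the carry. -/
def incStep (s : List Bool × Bool) (b : Bool) : List Bool × Bool :=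
  (bif s.2 then (!b) :: s.1 else b :: s.1, s.2 && b)

/-- The successor of a number in binary, as a fold. -/
def incBits' (l : List Bool) : List Bool :=
  let s := l.foldl incStep ([], true)
  (bif s.2 then true :: s.1 else s.1).reverse

theorem incBits'_eq (l : List Bool) : incBits' l = incBits l := by
  -- Generalised over the output so far and over the carry; without a carry, the remaining bits are
  -- copied.
  suffices h : ∀ (l o : List Bool) (c : Bool),
      (bif (l.foldl incStep (o, c)).2 then true :: (l.foldl incStep (o, c)).1
        else (l.foldl incStep (o, c)).1).reverse = o.reverse ++ (bif c then incBits l else l) by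
    rw [incBits']
    simpa using h l [] true
  intro l
  induction l with
  | nil => intro o c; cases c <;> simp [incBits]
  | cons b l ih =>
    intro o c
    rw [List.foldl_cons, incStep, ih]
    cases c <;> cases b <;> simp [incBits]

open Computability in
theorem incBits_encodeNat (n : ℕ) : incBits (encodeNat n) = encodeNat (n + 1) := by
  have h : ∀ p : PosNum, incBits (encodePosNum p) = encodePosNum p.succ := by
    intro p
    induction p with
    | one => rfl
    | bit0 p ih => rfl
    | bit1 p ih => simp [encodePosNum, incBits, PosNum.succ, ih]
  unfold encodeNat
  rw [Nat.cast_add, Nat.cast_one, Num.add_one]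
  cases (n : Num) with
  | zero => rfl
  | pos p => exact h p

namespace PT

variable {α : Type} [Enc α]

theorem le {f g : Orc → α → ℕ} (hf : PT f) (hg : PT g) :
    PT (fun X a => decide (f X a ≤ g X a)) := by
  have h : PT (fun (_ : Orc) (p : List Bool × List Bool) => leBits p.1 p.2) := by
    have hs : PT (fun (_ : Orc) (p : List Bool × List Bool) =>
        p.1.foldl leStep (p.2, true)) := by
      refine foldl_growth (h := fun _ _ => leStep) (fst PT.id) (pair (snd PT.id) (const true)) ?_
        ⟨0, fun X a b c _ => ?_⟩
      · have h1 : PT (fun (_ : Orc) (p : (List Bool × List Bool) × (List Bool × Bool) × Bool) =>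
            p.2.1.1) := fst (fst (snd PT.id))
        exact pair h1.tail (cond ((snd (snd PT.id)).eq h1.headI) (snd (fst (snd PT.id))) h1.headI)
      · rw [leStep, sz_pair, ← b.eta, sz_pair, sz_bool, sz_bool]
        have := sz_sublist b.1.tail_sublist
        simpa using this
    exact or (any (g := fun _ _ b => b) (fst hs) (snd PT.id)) (snd hs)
  exact (h.comp (pair hf.bits hg.bits)).of_eq fun X a => leBits_encodeNat _ _

theorem succ {f : Orc → α → ℕ} (hf : PT f) : PT (fun X a => f X a + 1) := by
  have h : PT (fun (_ : Orc) (l : List Bool) => incBits' l) := by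
    have hs : PT (fun (_ : Orc) (l : List Bool) => l.foldl incStep ([], true)) := by
      refine foldl_growth (h := fun _ _ => incStep) PT.id (const _) ?_ ⟨2, fun X a b c _ => ?_⟩
      · have h1 : PT (fun (_ : Orc) (p : List Bool × (List Bool × Bool) × Bool) => p.2.1.1) :=
          fst (fst (snd PT.id))
        have h2 : PT (fun (_ : Orc) (p : List Bool × (List Bool × Bool) × Bool) => p.2.1.2) :=
          snd (fst (snd PT.id))
        have h3 : PT (fun (_ : Orc) (p : List Bool × (List Bool × Bool) × Bool) => p.2.2) :=
          snd (snd PT.id)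
        exact pair (cond h2 (cons h3.not h1) (cons h3 h1)) (and h2 h3)
      · rw [incStep, sz_pair, ← b.eta, sz_pair, sz_bool, sz_bool]
        cases b.2 <;> simp [sz_cons, sz_bool] <;> omega
    exact reverse (cond (snd hs) (cons (const true) (fst hs)) (fst hs))
  refine (h.comp hf.bits).of_enc_eq fun X a => ?_
  rw [incBits'_eq, incBits_encodeNat]
  rfl

end PT

/-! ## The decision procedure

Nodes of trees are numbers in unary. Tokens are the symbols of an axiom or of a concept in prefix
order, with a tag and at most three arguments. -/

/-- Nodes. -/
abbrev Node := List Unit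

/-- Tokens. -/
abbrev Tok := ℕ × ℕ × ℕ × ℕ

/-- States of the concept parser: the rest of the input, the number of the concepts that are
expected (in unary), and the token lists that were read (in reverse order). -/
abbrev ParserState := List ℕ × List Unit × List (List Tok)

/-- Append a token to the topmost token list. -/
def addTok (t : Tok) (o : List (List Tok)) : List (List Tok) := (t :: o.headI) :: o.tail

/-- One step of the concept parser. -/
def parseStep (s : ParserState) : ParserState :=
  bif s.2.1.isEmpty then
    bif decide (s.1.headI = 1) then (s.1.tail, [()], [] :: s.2.2) else s
  else bif decide (s.1.headI = 0) then
    (s.1.tail.tail, s.2.1.tail, addTok (0, s.1.tail.headI, 0, 0) s.2.2)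
  else bif decide (s.1.headI = 1) then
    (s.1.tail, s.2.1.tail, addTok (1, 0, 0, 0) s.2.2)
  else bif decide (s.1.headI = 2) then
    (s.1.tail.tail.tail.tail, s.2.1.tail,
      addTok (2, s.1.tail.headI, s.1.tail.tail.headI, s.1.tail.tail.tail.headI) s.2.2)
  else bif decide (s.1.headI = 3) then
    (s.1.tail.tail, s.2.1, addTok (3, s.1.tail.headI, 0, 0) s.2.2)
  else (s.1.tail, () :: s.2.1, addTok (4, 0, 0, 0) s.2.2)

/-- Read a list of concepts; the result consists of the rest of the input and of the token lists
(in reverse order). -/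
def parseConcepts (l : List ℕ) : List ℕ × List (List Tok) :=
  let s := l.foldl (fun s _ => parseStep s) (l, [], [])
  (s.1.tail, s.2.2)

/-- One step of the axiom parser. Inclusions and disjointness axioms are skipped. -/
def parseAxStep (s : List ℕ × List Tok) : List ℕ × List Tok :=
  bif decide (s.1.headI = 1) then
    bif decide (s.1.tail.headI = 2) then
      (s.1.tail.tail.tail.tail.tail, (2, s.1.tail.tail.headI, s.1.tail.tail.tail.headI,
        s.1.tail.tail.tail.tail.headI) :: s.2)
    else bif decide (s.1.tail.headI = 0) || decide (s.1.tail.headI = 1) then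
      (s.1.tail.tail.tail, (s.1.tail.headI, s.1.tail.tail.headI, 0, 0) :: s.2)
    else (s.1.tail.tail.tail.tail, s.2)
  else s

/-- Read a list of axioms. -/
def parseAxioms (l : List ℕ) : List ℕ × List Tok :=
  let s := l.foldl (fun s _ => parseAxStep s) (l, [])
  (s.1.tail, s.2)

/-- Edges, concept facts and property facts. -/
abbrev Facts := List (Node × ℕ × Node) × List (Node × ℕ) × List (Node × ℕ × ℕ)

/-- States of the construction of a model of a concept: the pending nodes, the values for the
remaining interval constraints, whether there was no clash, and the facts. -/
abbrev BuildState := List Node × List ℕ × Bool × Facts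

/-- Does the list of axioms contain an axiom with the given tag and first argument? -/
def hasAx (K : List Tok) (tag r : ℕ) : Bool :=
  K.any fun x => decide (x.1 = tag) && decide (x.2.1 = r)

/-- The clash test for a new property fact. -/
def valueOK (K : List Tok) (V : List (Node × ℕ × ℕ)) (n : Node) (t : Tok) (v : ℕ) : Bool :=
  decide (t.2.2.1 ≤ v) && decide (v ≤ t.2.2.2) && (!hasAx K 1 t.2.1 ||
    V.all fun x => !(decide (x.1 = n) && decide (x.2.1 = t.2.1)) || decide (x.2.2 = v))

/-- The edges from a node that are labelled with a role. -/
def edgesFrom (E : List (Node × ℕ × Node)) (n : Node) (r : ℕ) : List (Node × ℕ × Node) :=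
  E.filter fun e => decide (e.1 = n) && decide (e.2.1 = r)

/-- A fresh node. -/
def fresh (E : List (Node × ℕ × Node)) : Node := () :: E.map fun _ => ()

/-- One step of the construction of a model. -/
def buildStep (K : List Tok) (s : BuildState) (t : Tok) : BuildState :=
  bif decide (t.1 = 0) then
    (s.1.tail, s.2.1, s.2.2.1, s.2.2.2.1, (s.1.headI, t.2.1) :: s.2.2.2.2.1, s.2.2.2.2.2)
  else bif decide (t.1 = 1) then
    (s.1.tail, s.2.1, false, s.2.2.2)
  else bif decide (t.1 = 2) then
    (s.1.tail, s.2.1.tail, s.2.2.1 && valueOK K s.2.2.2.2.2 s.1.headI t s.2.1.headI,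
      s.2.2.2.1, s.2.2.2.2.1, (s.1.headI, t.2.1, s.2.1.headI) :: s.2.2.2.2.2)
  else bif decide (t.1 = 3) then
    bif hasAx K 0 t.2.1 && !(edgesFrom s.2.2.2.1 s.1.headI t.2.1).isEmpty then
      ((edgesFrom s.2.2.2.1 s.1.headI t.2.1).headI.2.2 :: s.1.tail, s.2)
    else
      (fresh s.2.2.2.1 :: s.1.tail, s.2.1, s.2.2.1,
        (s.1.headI, t.2.1, fresh s.2.2.2.1) :: s.2.2.2.1, s.2.2.2.2)
  else (s.1.headI :: s.1.headI :: s.1.tail, s.2)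

/-- Construct a model of a concept, given by its tokens. -/
def build (K : List Tok) (C : List Tok) (vs : List ℕ) : BuildState :=
  C.foldl (buildStep K) ([[]], vs, true, [], [], [])

/-- The concept names that hold at a node because of the facts and of the range axioms. -/
def lab (K : List Tok) (F : Facts) (n : Node) : List ℕ :=
  (F.2.1.filter fun x => decide (x.1 = n)).map (fun x => x.2) ++
  (K.filter fun x => decide (x.1 = 2) && F.1.any fun e => decide (e.2.1 = x.2.2.1) &&
    bif decide (x.2.1 = 0) then decide (e.2.2 = n) else decide (e.1 = n)).map fun x => x.2.2.2

/-- The encoding of one side of an oracle query. -/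
def sideCode (l : List ℕ) : List (Option Bool) :=
  l.flatMap (fun A => some true :: none :: ((Computability.encodeNat A).map some ++ [none]))
    ++ [none]

open Classical in
/-- Oracle queries. -/
noncomputable def askQuery (X : Orc) (l r : List ℕ) : Bool :=
  decide (symbols (sideCode l ++ sideCode r) ∈ X)

/-- The concept names at a node that are known to the oracle. -/
noncomputable def known (X : Orc) (K : List Tok) (F : Facts) (n : Node) : List ℕ :=
  (lab K F n).filter fun A => askQuery X [A] [A]

/-- The nodes. -/
def nodes (F : Facts) : List Node := [] :: F.1.map fun e => e.2.2

/-- Is the construction free of clashes? -/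
noncomputable def valid (X : Orc) (K : List Tok) (s : BuildState) : Bool :=
  s.2.2.1 && (nodes s.2.2.2).all fun n => !askQuery X (known X K s.2.2.2 n) []

/-- Does a concept name hold at a node? -/
noncomputable def holds (X : Orc) (K : List Tok) (F : Facts) (n : Node) (A : ℕ) : Bool :=
  ((lab K F n).any fun B => decide (B = A)) || askQuery X (known X K F n) [A]

/-- One step of the evaluation of a concept, from the last token to the first one, with a stack of
extensions. -/
noncomputable def evalStep (X : Orc) (K : List Tok) (F : Facts) (s : List (List Node)) (t : Tok) :
    List (List Node) :=
  bif decide (t.1 = 0) then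
    ((nodes F).filter fun n => holds X K F n t.2.1) :: s
  else bif decide (t.1 = 1) then
    [] :: s
  else bif decide (t.1 = 2) then
    ((F.2.2.filter fun x => decide (x.2.1 = t.2.1) && (decide (t.2.2.1 ≤ x.2.2) &&
      decide (x.2.2 ≤ t.2.2.2))).map fun x => x.1) :: s
  else bif decide (t.1 = 3) then
    ((F.1.filter fun e => decide (e.2.1 = t.2.1) &&
      s.headI.any fun m => decide (m = e.2.2)).map fun e => e.1) :: s.tail
  else (s.headI.filter fun n => s.tail.headI.any fun m => decide (m = n)) :: s.tail.tail

/-- Does a concept, given by its tokens in reverse order, hold at the root? -/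
noncomputable def satisfied (X : Orc) (K : List Tok) (F : Facts) (D : List Tok) : Bool :=
  (D.foldl (evalStep X K F) []).headI.any fun n => decide (n = [])

/-- The values to be considered for interval constraints. -/
def points (lhs rhs : List (List Tok)) : List ℕ :=
  0 :: (lhs.flatMap fun C => C.flatMap fun t => bif decide (t.1 = 2) then [t.2.2.1] else []) ++
    rhs.flatMap fun D => D.flatMap fun t =>
      bif decide (t.1 = 2) then [t.2.2.1, t.2.2.2 + 1] else []

/-- The lists of `c` elements of `P`. -/
def tuples (P : List ℕ) : ℕ → List (List ℕ)
  | 0 => [[]]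
  | c + 1 => P.flatMap fun p => (tuples P c).map fun l => p :: l

/-- The decision procedure, on token lists (in reverse order). -/
noncomputable def decideToks (c : ℕ) (X : Orc) (K : List Tok) (lhs rhs : List (List Tok)) : Bool :=
  lhs.all fun C => (tuples (points lhs rhs) c).all fun vs =>
    !valid X K (build K C.reverse vs) ||
      rhs.any fun D => satisfied X K (build K C.reverse vs).2.2.2 D

/-- The decision procedure. -/
noncomputable def decideNats (c : ℕ) (X : Orc) (l : List ℕ) : Bool :=
  decideToks c X (parseAxioms l).2 (parseConcepts (parseAxioms l).1).2
    (parseConcepts (parseConcepts (parseAxioms l).1).1).2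

/-! ## The decision procedure takes polynomial time -/

set_option linter.unusedTactic false
set_option linter.unreachableTactic false

namespace PT

variable {α : Type} [Enc α]

theorem addTok {f : Orc → α → Tok} {g : Orc → α → List (List Tok)} (hf : PT f) (hg : PT g) :
    PT (fun X a => addTok (f X a) (g X a)) :=
  cons (cons hf hg.headI) hg.tail

theorem parseStep {f : Orc → α → ParserState} (hf : PT f) : PT (fun X a => parseStep (f X a)) := by
  refine comp (g := fun _ s => PLSO.parseStep s) ?_ hf
  unfold PLSO.parseStep
  -- The body is composed of operations that are already known to be polynomial, and the search
  -- follows its syntax. The same holds for the functions below.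
  repeat' first
    | with_reducible exact PT.id | with_reducible apply const | with_reducible apply fst
    | with_reducible apply snd | with_reducible apply cond | with_reducible apply isEmpty
    | with_reducible apply eq | with_reducible apply headI | with_reducible apply tail
    | with_reducible apply cons | with_reducible apply and | with_reducible apply or
    | with_reducible apply not | with_reducible apply le | with_reducible apply filter
    | with_reducible apply any | with_reducible apply all | with_reducible apply map
    | with_reducible apply append | with_reducible apply addTok | with_reducible apply pair

theorem parseAxStep {f : Orc → α → List ℕ × List Tok} (hf : PT f) :
    PT (fun X a => parseAxStep (f X a)) := by
  refine comp (g := fun _ s => PLSO.parseAxStep s) ?_ hf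
  unfold PLSO.parseAxStep
  repeat' first
    | with_reducible exact PT.id | with_reducible apply const | with_reducible apply fst
    | with_reducible apply snd | with_reducible apply cond | with_reducible apply isEmpty
    | with_reducible apply eq | with_reducible apply headI | with_reducible apply tail
    | with_reducible apply cons | with_reducible apply and | with_reducible apply or
    | with_reducible apply not | with_reducible apply le | with_reducible apply filter
    | with_reducible apply any | with_reducible apply all | with_reducible apply map
    | with_reducible apply append | with_reducible apply pair

theorem hasAx {f : Orc → α → List Tok} {g h : Orc → α → ℕ} (hf : PT f) (hg : PT g) (hh : PT h) :
    PT (fun X a => hasAx (f X a) (g X a) (h X a)) := by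
  refine comp (g := fun _ (p : List Tok × ℕ × ℕ) => PLSO.hasAx p.1 p.2.1 p.2.2) ?_
    (pair hf (pair hg hh))
  unfold PLSO.hasAx
  repeat' first
    | with_reducible exact PT.id | with_reducible apply const | with_reducible apply fst
    | with_reducible apply snd | with_reducible apply cond | with_reducible apply isEmpty
    | with_reducible apply eq | with_reducible apply headI | with_reducible apply tail
    | with_reducible apply cons | with_reducible apply and | with_reducible apply or
    | with_reducible apply not | with_reducible apply le | with_reducible apply filter
    | with_reducible apply any | with_reducible apply all | with_reducible apply map
    | with_reducible apply append | with_reducible apply pair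

theorem buildStep : PT (fun _ (p : List Tok × BuildState × Tok) =>
    buildStep p.1 p.2.1 p.2.2) := by
  unfold PLSO.buildStep valueOK edgesFrom fresh
  repeat' first
    | with_reducible exact PT.id | with_reducible apply const | with_reducible apply fst
    | with_reducible apply snd | with_reducible apply cond | with_reducible apply isEmpty
    | with_reducible apply eq | with_reducible apply headI | with_reducible apply tail
    | with_reducible apply cons | with_reducible apply and | with_reducible apply or
    | with_reducible apply not | with_reducible apply le | with_reducible apply filter
    | with_reducible apply any | with_reducible apply all | with_reducible apply map
    | with_reducible apply append | with_reducible apply hasAx | with_reducible apply pair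

theorem lab {f : Orc → α → List Tok} {g : Orc → α → Facts} {h : Orc → α → Node} (hf : PT f)
    (hg : PT g) (hh : PT h) : PT (fun X a => lab (f X a) (g X a) (h X a)) := by
  refine comp (g := fun _ (p : List Tok × Facts × Node) => PLSO.lab p.1 p.2.1 p.2.2) ?_
    (pair hf (pair hg hh))
  unfold PLSO.lab
  repeat' first
    | with_reducible exact PT.id | with_reducible apply const | with_reducible apply fst
    | with_reducible apply snd | with_reducible apply cond | with_reducible apply isEmpty
    | with_reducible apply eq | with_reducible apply headI | with_reducible apply tail
    | with_reducible apply cons | with_reducible apply and | with_reducible apply or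
    | with_reducible apply not | with_reducible apply le | with_reducible apply filter
    | with_reducible apply any | with_reducible apply all | with_reducible apply map
    | with_reducible apply append | with_reducible apply pair

theorem sideCode {f : Orc → α → List ℕ} (hf : PT f) : PT (fun X a => sideCode (f X a)) := by
  refine comp (g := fun _ s => PLSO.sideCode s) ?_ hf
  unfold PLSO.sideCode
  -- A bit and its image under `some` are represented by the same leaf.
  have hs : PT (fun (_ : Orc) (b : Bool) => some b) := by
    exact PT.id.of_enc_eq fun _ _ => rfl
  repeat' first
    | exact hs.comp (snd PT.id)
    | with_reducible exact PT.id | with_reducible apply const | with_reducible apply fst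
    | with_reducible apply snd | with_reducible apply cond | with_reducible apply isEmpty
    | with_reducible apply eq | with_reducible apply headI | with_reducible apply tail
    | with_reducible apply cons | with_reducible apply and | with_reducible apply or
    | with_reducible apply not | with_reducible apply le | with_reducible apply filter
    | with_reducible apply any | with_reducible apply all | with_reducible apply map
    | with_reducible apply append | with_reducible apply bits | with_reducible apply flatMap
    | with_reducible apply pair

theorem askQuery {f g : Orc → α → List ℕ} (hf : PT f) (hg : PT g) :
    PT (fun X a => askQuery X (f X a) (g X a)) :=
  ask (append (sideCode hf) (sideCode hg))

theorem known {f : Orc → α → List Tok} {g : Orc → α → Facts} {h : Orc → α → Node} (hf : PT f)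
    (hg : PT g) (hh : PT h) : PT (fun X a => known X (f X a) (g X a) (h X a)) := by
  refine comp (g := fun X (p : List Tok × Facts × Node) => PLSO.known X p.1 p.2.1 p.2.2) ?_
    (pair hf (pair hg hh))
  unfold PLSO.known
  repeat' first
    | with_reducible exact PT.id | with_reducible apply const | with_reducible apply fst
    | with_reducible apply snd | with_reducible apply cond | with_reducible apply isEmpty
    | with_reducible apply eq | with_reducible apply headI | with_reducible apply tail
    | with_reducible apply cons | with_reducible apply and | with_reducible apply or
    | with_reducible apply not | with_reducible apply le | with_reducible apply filter
    | with_reducible apply any | with_reducible apply all | with_reducible apply map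
    | with_reducible apply append | with_reducible apply lab | with_reducible apply askQuery
    | with_reducible apply pair

theorem holds {f : Orc → α → List Tok} {g : Orc → α → Facts} {h : Orc → α → Node}
    {k : Orc → α → ℕ} (hf : PT f) (hg : PT g) (hh : PT h) (hk : PT k) :
    PT (fun X a => holds X (f X a) (g X a) (h X a) (k X a)) := by
  refine comp (g := fun X (p : List Tok × Facts × Node × ℕ) =>
    PLSO.holds X p.1 p.2.1 p.2.2.1 p.2.2.2) ?_ (pair hf (pair hg (pair hh hk)))
  unfold PLSO.holds
  repeat' first
    | with_reducible exact PT.id | with_reducible apply const | with_reducible apply fst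
    | with_reducible apply snd | with_reducible apply cond | with_reducible apply isEmpty
    | with_reducible apply eq | with_reducible apply headI | with_reducible apply tail
    | with_reducible apply cons | with_reducible apply and | with_reducible apply or
    | with_reducible apply not | with_reducible apply le | with_reducible apply filter
    | with_reducible apply any | with_reducible apply all | with_reducible apply map
    | with_reducible apply append | with_reducible apply lab | with_reducible apply askQuery
    | with_reducible apply known | with_reducible apply pair

theorem nodes {f : Orc → α → Facts} (hf : PT f) : PT (fun X a => nodes (f X a)) :=
  cons (const []) (map hf.fst (snd (snd (snd PT.id))))

theorem valid {f : Orc → α → List Tok} {g : Orc → α → BuildState} (hf : PT f) (hg : PT g) :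
    PT (fun X a => valid X (f X a) (g X a)) := by
  refine comp (g := fun X (p : List Tok × BuildState) => PLSO.valid X p.1 p.2) ?_ (pair hf hg)
  unfold PLSO.valid
  repeat' first
    | with_reducible exact PT.id | with_reducible apply const | with_reducible apply fst
    | with_reducible apply snd | with_reducible apply cond | with_reducible apply isEmpty
    | with_reducible apply eq | with_reducible apply headI | with_reducible apply tail
    | with_reducible apply cons | with_reducible apply and | with_reducible apply or
    | with_reducible apply not | with_reducible apply le | with_reducible apply filter
    | with_reducible apply any | with_reducible apply all | with_reducible apply map
    | with_reducible apply append | with_reducible apply askQuery | with_reducible apply known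
    | with_reducible apply nodes | with_reducible apply pair

theorem evalStep : PT (fun X (p : (List Tok × Facts × List Tok) × List (List Node) × Tok) =>
    evalStep X p.1.1 p.1.2.1 p.2.1 p.2.2) := by
  unfold PLSO.evalStep
  repeat' first
    | with_reducible exact PT.id | with_reducible apply const | with_reducible apply fst
    | with_reducible apply snd | with_reducible apply cond | with_reducible apply isEmpty
    | with_reducible apply eq | with_reducible apply headI | with_reducible apply tail
    | with_reducible apply cons | with_reducible apply and | with_reducible apply or
    | with_reducible apply not | with_reducible apply le | with_reducible apply filter
    | with_reducible apply any | with_reducible apply all | with_reducible apply map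
    | with_reducible apply append | with_reducible apply holds | with_reducible apply nodes
    | with_reducible apply pair

end PT

-- Size bounds for the states of the parser, of the evaluation and of the tree construction

theorem sz_zero : sz (0 : ℕ) = 1 := rfl

theorem sz_headI_tail (l : List ℕ) : sz l.headI + sz l.tail ≤ sz l + 1 := by
  cases l with
  | nil => exact le_of_eq rfl
  | cons n l => simp only [List.headI_cons, List.tail_cons, sz_cons]; omega

theorem sz_headI_tail' {α : Type} [Enc α] (l : List (List α)) :
    sz l.headI + sz l.tail ≤ sz l + 1 := by
  cases l with
  | nil => exact le_of_eq rfl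
  | cons n l => simp only [List.headI_cons, List.tail_cons, sz_cons]; omega

theorem sz_tail {α : Type} [Enc α] (l : List α) : sz l.tail ≤ sz l := sz_sublist l.tail_sublist

theorem sz_addTok (t : Tok) (o : List (List Tok)) : sz (addTok t o) ≤ sz o + sz t + 3 := by
  rw [addTok, sz_cons, sz_cons]
  have := sz_headI_tail' o
  omega

/-- Numbers are moved from the input to a token and not copied; only tags, default zeros and list
cells are new. The constant is generous. -/
theorem sz_parseStep (s : ParserState) : sz (parseStep s) ≤ sz s + 100 := by
  obtain ⟨l, p, o⟩ := s
  have h1 := sz_headI_tail l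
  have h2 := sz_headI_tail l.tail
  have h3 := sz_headI_tail l.tail.tail
  have h4 := sz_headI_tail l.tail.tail.tail
  have h5 := sz_tail p
  have n1 : sz (1 : ℕ) = 3 := rfl
  have n2 : sz (2 : ℕ) = 5 := rfl
  have n3 : sz (3 : ℕ) = 5 := rfl
  have n4 : sz (4 : ℕ) = 7 := rfl
  have a0 := sz_addTok (0, l.tail.headI, 0, 0) o
  have a1 := sz_addTok (1, 0, 0, 0) o
  have a2 := sz_addTok (2, l.tail.headI, l.tail.tail.headI, l.tail.tail.tail.headI) o
  have a3 := sz_addTok (3, l.tail.headI, 0, 0) o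
  have a4 := sz_addTok (4, 0, 0, 0) o
  have p0 := sz_pos p
  have q0 := sz_pos l.headI
  simp only [sz_pair, sz_zero, n1, n2, n3, n4] at a0 a1 a2 a3 a4
  simp only [parseStep]
  cases p.isEmpty
  · cases decide (l.headI = 0)
    · cases decide (l.headI = 1)
      · cases decide (l.headI = 2)
        · cases decide (l.headI = 3)
          · simp only [sz_pair, sz_cons, sz_unit, cond_false]; omega
          · simp only [sz_pair, cond_true, cond_false]; omega
        · simp only [sz_pair, cond_true, cond_false]; omega
      · simp only [sz_pair, cond_true, cond_false]; omega
    · simp only [sz_pair, cond_true, cond_false]; omega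
  · cases decide (l.headI = 1)
    · simp only [cond_true, cond_false]; omega
    · simp only [sz_pair, sz_cons, sz_unit, sz_nil, cond_true]; omega

theorem sz_parseAxStep (s : List ℕ × List Tok) : sz (parseAxStep s) ≤ sz s + 100 := by
  obtain ⟨l, o⟩ := s
  have h1 := sz_headI_tail l
  have h2 := sz_headI_tail l.tail
  have h3 := sz_headI_tail l.tail.tail
  have h4 := sz_headI_tail l.tail.tail.tail
  have h5 := sz_headI_tail l.tail.tail.tail.tail
  have n2 : sz (2 : ℕ) = 5 := rfl
  have q0 := sz_pos l.headI
  have q1 := sz_pos l.tail.headI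
  have q2 := sz_pos l.tail.tail.headI
  have q3 := sz_pos l.tail.tail.tail.headI
  simp only [parseAxStep]
  cases decide (l.headI = 1)
  · simp only [cond_false]; omega
  · cases decide (l.tail.headI = 2)
    · cases (decide (l.tail.headI = 0) || decide (l.tail.headI = 1))
      · simp only [sz_pair, cond_true, cond_false]; omega
      · simp only [sz_pair, sz_cons, sz_zero, cond_true, cond_false]; omega
    · simp only [sz_pair, sz_cons, n2, cond_true]; omega

/-- The extension that is pushed is a sublist of a list that depends only on the facts or, for an
intersection, of an extension that is removed. -/
theorem sz_evalStep (X : Orc) (K : List Tok) (F : Facts) (s : List (List Node)) (t : Tok) :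
    sz (evalStep X K F s t) ≤ sz s + (sz (nodes F) + sz (F.2.2.map fun x => x.1) +
      sz (F.1.map fun e => e.1) + 5) := by
  have h1 := sz_sublist ((nodes F).filter_sublist (p := fun n => holds X K F n t.2.1))
  have h2 := sz_sublist ((F.2.2.filter_sublist (p := fun x => decide (x.2.1 = t.2.1) &&
    (decide (t.2.2.1 ≤ x.2.2) && decide (x.2.2 ≤ t.2.2.2)))).map fun x => x.1)
  have h3 := sz_sublist ((F.1.filter_sublist (p := fun e => decide (e.2.1 = t.2.1) &&
      s.headI.any fun m => decide (m = e.2.2))).map fun e => e.1)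
  have h4 := sz_sublist (s.headI.filter_sublist (p := fun n => s.tail.headI.any fun m =>
    decide (m = n)))
  have h5 := sz_tail s
  have h6 := sz_tail s.tail
  have h7 := sz_headI_tail' s
  have n0 : sz ([] : List Node) = 1 := rfl
  unfold evalStep
  cases decide (t.1 = 0)
  · cases decide (t.1 = 1)
    · cases decide (t.1 = 2)
      · cases decide (t.1 = 3)
        · simp only [sz_cons, cond_false]; omega
        · simp only [sz_cons, cond_true, cond_false]; omega
      · simp only [sz_cons, cond_true, cond_false]; omega
    · simp only [sz_cons, n0, cond_true, cond_false]; omega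
  · simp only [sz_cons, cond_true]; omega

/-- A size bound for states of the construction after `k` steps, where `M` bounds the names. -/
structure BuildBound (M k : ℕ) (s : BuildState) : Prop where
  pend_length : s.1.length ≤ k + 1
  pend : ∀ n ∈ s.1, n.length ≤ k
  values : sz s.2.1 ≤ M
  edges_length : s.2.2.2.1.length ≤ k
  edges : ∀ e ∈ s.2.2.2.1, e.1.length ≤ k ∧ sz e.2.1 ≤ M ∧ e.2.2.length ≤ k
  labels_length : s.2.2.2.2.1.length ≤ k
  labels : ∀ e ∈ s.2.2.2.2.1, e.1.length ≤ k ∧ sz e.2 ≤ M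
  props_length : s.2.2.2.2.2.length ≤ k
  props : ∀ e ∈ s.2.2.2.2.2, e.1.length ≤ k ∧ sz e.2.1 ≤ M ∧ sz e.2.2 ≤ M

theorem sz_node (n : Node) : sz n = 2 * n.length + 1 := by
  induction n with
  | nil => rfl
  | cons u n ih => rw [sz_cons, ih, sz_unit, List.length_cons]; ring

theorem BuildBound.sz_le {M k : ℕ} {s : BuildState} (h : BuildBound M k s) :
    sz s ≤ 4 * ((k + 1) * (4 * k + 2 * M + 10)) + M + 20 := by
  obtain ⟨p, v, b, E, L, V⟩ := s
  have h1 := sz_list_le p (4 * k + 2 * M + 9) fun n hn => by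
    have := h.pend n hn; rw [sz_node]; omega
  have h2 := sz_list_le E (4 * k + 2 * M + 9) fun e he => by
    obtain ⟨a1, a2, a3⟩ := h.edges e he
    change sz (e.1, e.2.1, e.2.2) ≤ _
    simp only [sz_pair, sz_node]; omega
  have h3 := sz_list_le L (4 * k + 2 * M + 9) fun e he => by
    obtain ⟨a1, a2⟩ := h.labels e he
    change sz (e.1, e.2) ≤ _
    simp only [sz_pair, sz_node]; omega
  have h4 := sz_list_le V (4 * k + 2 * M + 9) fun e he => by
    obtain ⟨a1, a2, a3⟩ := h.props e he
    change sz (e.1, e.2.1, e.2.2) ≤ _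
    simp only [sz_pair, sz_node]; omega
  have m1 := Nat.mul_le_mul_right (4 * k + 2 * M + 9 + 1) h.pend_length
  have m2 := Nat.mul_le_mul_right (4 * k + 2 * M + 9 + 1) (h.edges_length.trans (Nat.le_succ k))
  have m3 := Nat.mul_le_mul_right (4 * k + 2 * M + 9 + 1) (h.labels_length.trans (Nat.le_succ k))
  have m4 := Nat.mul_le_mul_right (4 * k + 2 * M + 9 + 1) (h.props_length.trans (Nat.le_succ k))
  have hv := h.values
  simp only [sz_pair, sz_bool]
  simp only [Nat.succ_eq_add_one, Nat.add_assoc, Nat.reduceAdd] at *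
  omega

theorem length_headI_le {l : List Node} {k : ℕ} (h : ∀ n ∈ l, n.length ≤ k) :
    l.headI.length ≤ k := by
  cases l with
  | nil => exact Nat.zero_le _
  | cons n l => exact h n List.mem_cons_self

theorem sz_headI_le (l : List ℕ) : sz l.headI ≤ sz l := by
  cases l with
  | nil => exact le_of_eq rfl
  | cons n l => exact sz_mem List.mem_cons_self

/-- A step copies nodes, whose unary size grows during the construction, so it has no fixed growth.
What is controlled is the number of entries and the length of nodes: each step adds at most one fact
and at most one pending node, and a fresh node is longer by one than the list of edges. -/
theorem BuildBound.step {M k : ℕ} {s : BuildState} (h : BuildBound M k s) (K : List Tok) (t : Tok)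
    (ht : sz t ≤ M) : BuildBound M (k + 1) (buildStep K s t) := by
  obtain ⟨p, v, b, E, L, V⟩ := s
  obtain ⟨i1, i2, i3, i4, i5, i6, i7, i8, i9⟩ := h
  simp only at i1 i2 i3 i4 i5 i6 i7 i8 i9
  have hs : sz t = 1 + sz t.1 + (1 + sz t.2.1 + (1 + sz t.2.2.1 + sz t.2.2.2)) := rfl
  have hh := length_headI_le i2
  have ht1 : ∀ n ∈ p.tail, n.length ≤ k + 1 := fun n hn =>
    (i2 n (List.mem_of_mem_tail hn)).trans (Nat.le_succ k)
  have ht2 : p.tail.length ≤ k + 1 := by rw [List.length_tail]; omega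
  have j5 : ∀ e ∈ E, e.1.length ≤ k + 1 ∧ sz e.2.1 ≤ M ∧ e.2.2.length ≤ k + 1 := fun e he => by
    have := i5 e he; omega
  have j7 : ∀ e ∈ L, e.1.length ≤ k + 1 ∧ sz e.2 ≤ M := fun e he => by
    have := i7 e he; omega
  have j9 : ∀ e ∈ V, e.1.length ≤ k + 1 ∧ sz e.2.1 ≤ M ∧ sz e.2.2 ≤ M := fun e he => by
    have := i9 e he; omega
  unfold buildStep
  cases decide (t.1 = 0)
  · cases decide (t.1 = 1)
    · cases decide (t.1 = 2)
      · cases decide (t.1 = 3)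
        · exact ⟨by simp; omega, by
            intro n hn
            simp only [cond_false, List.mem_cons] at hn
            rcases hn with rfl | rfl | hn
            · omega
            · omega
            · exact ht1 n hn, i3, by simp; omega, j5, by simp; omega, j7, by simp; omega, j9⟩
        · cases hc : (hasAx K 0 t.2.1 && !(edgesFrom E p.headI t.2.1).isEmpty)
          · have hf : (fresh E).length ≤ k + 1 := by simp [fresh]; omega
            simp only [cond_true, cond_false]
            exact ⟨by simp; omega, by
              intro n hn
              rcases List.mem_cons.1 hn with rfl | hn
              · exact hf
              · exact ht1 n hn, i3, by simp; omega, by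
              intro e he
              rcases List.mem_cons.1 he with rfl | he
              · exact ⟨by simp only; omega, by simp only; omega, hf⟩
              · exact j5 e he, by simp; omega, j7, by simp; omega, j9⟩
          · simp only [cond_true, cond_false]
            exact ⟨by simp; omega, by
              intro n hn
              rcases List.mem_cons.1 hn with rfl | hn
              · simp only [Bool.and_eq_true, Bool.not_eq_true', List.isEmpty_eq_false_iff] at hc
                obtain ⟨e, r, her⟩ := List.exists_cons_of_ne_nil hc.2
                rw [her]
                have : e ∈ edgesFrom E p.headI t.2.1 := by rw [her]; exact List.mem_cons_self
                exact (j5 e (List.mem_of_mem_filter this)).2.2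
              · exact ht1 n hn, i3, by simp; omega, j5, by simp; omega, j7, by simp; omega, j9⟩
      · exact ⟨by simp; omega, ht1, (sz_tail v).trans i3, by simp; omega, j5, by simp; omega, j7,
          by simp; omega, by
          intro e he
          rcases List.mem_cons.1 he with rfl | he
          · exact ⟨by simp only; omega, by simp only; omega, (sz_headI_le v).trans i3⟩
          · exact j9 e he⟩
    · exact ⟨by simp; omega, ht1, i3, by simp; omega, j5, by simp; omega, j7, by simp; omega, j9⟩
  · exact ⟨by simp; omega, ht1, i3, by simp; omega, j5, by simp; omega, by
      intro e he
      rcases List.mem_cons.1 he with rfl | he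
      · exact ⟨by simp only; omega, by simp only; omega⟩
      · exact j7 e he, by simp; omega, j9⟩

theorem sz_foldl_buildStep (K C : List Tok) (vs : List ℕ) (M : ℕ) (hC : ∀ t ∈ C, sz t ≤ M)
    (hv : sz vs ≤ M) (hM : C.length ≤ M) :
    sz (build K C vs) ≤ 4 * ((M + 1) * (4 * M + 2 * M + 10)) + M + 20 := by
  have key : ∀ (C : List Tok) (k : ℕ) (s : BuildState), (∀ t ∈ C, sz t ≤ M) → BuildBound M k s →
      BuildBound M (k + C.length) (C.foldl (buildStep K) s) := by
    intro C
    induction C with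
    | nil => intro k s _ h; exact h
    | cons t C ih =>
      intro k s hC h
      have := ih (k + 1) _ (fun u hu => hC u (List.mem_cons_of_mem _ hu))
        (h.step K t (hC t List.mem_cons_self))
      rw [List.length_cons, show k + (C.length + 1) = k + 1 + C.length by ring]
      exact this
  have h0 : BuildBound M 0 ([[]], vs, true, [], [], []) :=
    ⟨by simp, by simp, hv, by simp, by simp, by simp, by simp, by simp, by simp⟩
  have h := (key C 0 _ hC h0).sz_le
  rw [Nat.zero_add] at h
  refine h.trans ?_
  have : (C.length + 1) * (4 * C.length + 2 * M + 10) ≤ (M + 1) * (4 * M + 2 * M + 10) :=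
    Nat.mul_le_mul (by omega) (by omega)
  omega

namespace PT

variable {α : Type} [Enc α]

theorem parseConcepts {f : Orc → α → List ℕ} (hf : PT f) : PT (fun X a => parseConcepts (f X a)) := by
  refine comp (g := fun _ s => PLSO.parseConcepts s) ?_ hf
  have h : PT (fun (_ : Orc) (l : List ℕ) =>
      l.foldl (fun (s : ParserState) _ => PLSO.parseStep s) (l, [], [])) :=
    foldl_growth (h := fun _ _ (s : ParserState) _ => PLSO.parseStep s) PT.id
      (pair PT.id (const _)) (parseStep (fst (snd PT.id)))
      ⟨100, fun X a b c _ => by simpa using sz_parseStep b⟩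
  exact pair (tail (fst h)) (snd (snd h))

theorem parseAxioms {f : Orc → α → List ℕ} (hf : PT f) : PT (fun X a => parseAxioms (f X a)) := by
  refine comp (g := fun _ s => PLSO.parseAxioms s) ?_ hf
  have h : PT (fun (_ : Orc) (l : List ℕ) =>
      l.foldl (fun (s : List ℕ × List Tok) _ => PLSO.parseAxStep s) (l, [])) :=
    foldl_growth (h := fun _ _ (s : List ℕ × List Tok) _ => PLSO.parseAxStep s) PT.id
      (pair PT.id (const _)) (parseAxStep (fst (snd PT.id)))
      ⟨100, fun X a b c _ => by simpa using sz_parseAxStep b⟩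
  exact pair (tail (fst h)) (snd h)

end PT

namespace PT

variable {α : Type} [Enc α]

open Polynomial in
theorem build {f g : Orc → α → List Tok} {h : Orc → α → List ℕ} (hf : PT f) (hg : PT g)
    (hh : PT h) : PT (fun X a => build (f X a) (g X a) (h X a)) := by
  refine comp (g := fun _ (p : List Tok × List Tok × List ℕ) => PLSO.build p.1 p.2.1 p.2.2)
    (f := fun X a => (f X a, g X a, h X a)) ?_
    (pair hf (pair hg hh))
  unfold PLSO.build
  have h0 : PT (fun _ (p : List Tok × List Tok × List ℕ) =>
      ((([[]] : List Node), p.2.2, true, [], [], []) : BuildState)) :=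
    pair (const ([[]] : List Node)) (pair (snd (snd PT.id))
      (const ((true, [], [], []) : Bool × Facts)))
  have h1 : PT (fun _ (p : (List Tok × List Tok × List ℕ) × BuildState × Tok) =>
      PLSO.buildStep p.1.1 p.2.1 p.2.2) :=
    comp (g := fun _ (p : List Tok × BuildState × Tok) => PLSO.buildStep p.1 p.2.1 p.2.2)
      (f := fun _ (p : (List Tok × List Tok × List ℕ) × BuildState × Tok) => (p.1.1, p.2))
      buildStep (pair (fst (fst PT.id)) (snd PT.id))
  refine foldl (f := fun _ (p : List Tok × List Tok × List ℕ) => p.2.1)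
    (h := fun _ (p : List Tok × List Tok × List ℕ) => PLSO.buildStep p.1)
    (fst (snd PT.id)) h0 h1 ⟨4 * ((X + 1) * (4 * X + 2 * X + 10)) + X + 20, fun Y a l hl => ?_⟩
  have ha : sz a = 1 + sz a.1 + (1 + sz a.2.1 + sz a.2.2) := rfl
  have := sz_foldl_buildStep a.1 l a.2.2 (sz a) (fun t ht => by
      have := sz_mem (hl.subset ht); omega) (by omega) (by
      have := hl.length_le.trans (length_le_sz a.2.1); omega)
  unfold PLSO.build at this
  simpa using this

open Polynomial in
theorem satisfied {f : Orc → α → List Tok} {g : Orc → α → Facts} {h : Orc → α → List Tok}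
    (hf : PT f) (hg : PT g) (hh : PT h) :
    PT (fun X a => satisfied X (f X a) (g X a) (h X a)) := by
  refine comp (g := fun X (p : List Tok × Facts × List Tok) => PLSO.satisfied X p.1 p.2.1 p.2.2)
    (f := fun X a => (f X a, g X a, h X a)) ?_
    (pair hf (pair hg hh))
  unfold PLSO.satisfied
  refine any (g := fun _ _ (n : Node) => decide (n = [])) (headI ?_)
    (eq (snd PT.id) (const ([] : Node)))
  have hF : PT (fun (_ : Orc) (p : List Tok × Facts × List Tok) => p.2.1) := fst (snd PT.id)
  obtain ⟨q1, h1⟩ := (nodes hF).size_le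
  obtain ⟨q2, h2⟩ := (map (g := fun _ _ x => x.1) (snd (snd hF)) (fst (snd PT.id))).size_le
  obtain ⟨q3, h3⟩ := (map (g := fun _ _ x => x.1) (fst hF) (fst (snd PT.id))).size_le
  refine foldl_growth (f := fun _ (p : List Tok × Facts × List Tok) => p.2.2)
    (h := fun X (p : List Tok × Facts × List Tok) => PLSO.evalStep X p.1 p.2.1)
    (snd (snd PT.id)) (const ([] : List (List Node))) evalStep ⟨q1 + q2 + q3 + 5, fun Y a b c _ => ?_⟩
  have e := sz_evalStep Y a.1 a.2.1 b c
  have e1 := h1 Y a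
  have e2 := h2 Y a
  have e3 := h3 Y a
  simp only [eval_add, eval_ofNat]
  omega

theorem points {f g : Orc → α → List (List Tok)} (hf : PT f) (hg : PT g) :
    PT (fun X a => points (f X a) (g X a)) := by
  refine comp (g := fun _ (p : List (List Tok) × List (List Tok)) => PLSO.points p.1 p.2)
    (f := fun X a => (f X a, g X a)) ?_ (pair hf hg)
  unfold PLSO.points
  repeat' first
    | with_reducible exact PT.id | with_reducible apply const | with_reducible apply fst
    | with_reducible apply snd | with_reducible apply cond | with_reducible apply eq
    | with_reducible apply cons | with_reducible apply append | with_reducible apply flatMap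
    | with_reducible apply succ

/-- The induction is on the fixed number `c`, and every unit of `c` adds another pass over the
points. Here the bound on the number of interval constraints makes the procedure polynomial. -/
theorem tuples {f : Orc → α → List ℕ} (hf : PT f) (c : ℕ) : PT (fun X a => tuples (f X a) c) := by
  induction c with
  | zero => exact const _
  | succ c ih =>
    exact flatMap (g := fun X a p => (PLSO.tuples (f X a) c).map fun l => p :: l) hf
      (map (g := fun X (a : α × ℕ) l => a.2 :: l) (comp ih (fst PT.id))
        (cons (snd (fst PT.id)) (snd PT.id)))

theorem decideToks (c : ℕ) : PT (fun X (p : List Tok × List (List Tok) × List (List Tok)) =>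
    decideToks c X p.1 p.2.1 p.2.2) := by
  unfold PLSO.decideToks
  have hp : PT (fun (_ : Orc) (p : List Tok × List (List Tok) × List (List Tok)) =>
      PLSO.tuples (PLSO.points p.2.1 p.2.2) c) :=
    tuples (points (fst (snd PT.id)) (snd (snd PT.id))) c
  have hb : PT (fun (_ : Orc)
      (p : ((List Tok × List (List Tok) × List (List Tok)) × List Tok) × List ℕ) =>
      PLSO.build p.1.1.1 p.1.2.reverse p.2) :=
    build (fst (fst (fst PT.id))) (reverse (snd (fst PT.id))) (snd PT.id)
  refine all (f := fun _ (p : List Tok × List (List Tok) × List (List Tok)) => p.2.1)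
    (g := fun X p C => (PLSO.tuples (PLSO.points p.2.1 p.2.2) c).all fun vs =>
    !PLSO.valid X p.1 (PLSO.build p.1 C.reverse vs) ||
      p.2.2.any fun D => PLSO.satisfied X p.1 (PLSO.build p.1 C.reverse vs).2.2.2 D)
    (fst (snd PT.id)) ?_
  refine all (f := fun _ (p : (List Tok × List (List Tok) × List (List Tok)) × List Tok) =>
      PLSO.tuples (PLSO.points p.1.2.1 p.1.2.2) c)
    (g := fun X p vs => !PLSO.valid X p.1.1 (PLSO.build p.1.1 p.2.reverse vs) ||
      p.1.2.2.any fun D => PLSO.satisfied X p.1.1 (PLSO.build p.1.1 p.2.reverse vs).2.2.2 D)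
    (comp (f := fun _ (p : (List Tok × List (List Tok) × List (List Tok)) × List Tok) => p.1)
      hp (fst PT.id)) ?_
  refine or (not (valid (fst (fst (fst PT.id))) hb)) ?_
  refine any (f := fun _
      (p : ((List Tok × List (List Tok) × List (List Tok)) × List Tok) × List ℕ) => p.1.1.2.2)
    (g := fun X p D =>
      PLSO.satisfied X p.1.1.1 (PLSO.build p.1.1.1 p.1.2.reverse p.2).2.2.2 D)
    (snd (snd (fst (fst PT.id)))) ?_
  exact satisfied (fst (fst (fst (fst PT.id))))
    (g := fun _ (p : (((List Tok × List (List Tok) × List (List Tok)) × List Tok) × List ℕ) ×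
      List Tok) => (PLSO.build p.1.1.1.1 p.1.1.2.reverse p.1.2).2.2.2)
    (snd (snd (snd (comp (f := fun _
      (p : (((List Tok × List (List Tok) × List (List Tok)) × List Tok) × List ℕ) ×
      List Tok) => p.1) hb (fst PT.id))))) (snd PT.id)

theorem decideNats (c : ℕ) : PT (fun X l => decideNats c X l) := by
  have h1 : PT (fun (_ : Orc) (l : List ℕ) => PLSO.parseAxioms l) := parseAxioms PT.id
  have h2 := parseConcepts (fst h1)
  have h3 := parseConcepts (fst h2)
  exact comp (g := fun X (p : List Tok × List (List Tok) × List (List Tok)) =>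
    PLSO.decideToks c X p.1 p.2.1 p.2.2)
    (f := fun _ l => ((PLSO.parseAxioms l).2, (PLSO.parseConcepts (PLSO.parseAxioms l).1).2,
      (PLSO.parseConcepts (PLSO.parseConcepts (PLSO.parseAxioms l).1).1).2))
    (decideToks c) (pair (snd h1) (pair (snd h2) (snd h3)))

end PT

/-! ## Machines for polynomial-time functions -/

/-- One step of splitting a string at the commas: the current item and the completed items, both in
reverse order. -/
def splitStep (s : List Bool × List (List Bool)) (x : Option Bool) : List Bool × List (List Bool) :=
  bif decide (x = none) then ([], s.1.reverse :: s.2) else (decide (x = some true) :: s.1, s.2)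

/-- Split a string at the commas. -/
def splitNats (l : List (Option Bool)) : List (List Bool) := (l.foldl splitStep ([], [])).2.reverse

theorem PT.splitNats : PT fun _ l => splitNats l := by
  unfold PLSO.splitNats
  refine reverse (snd (foldl_growth (f := fun _ (l : List (Option Bool)) => l)
    (h := fun _ _ => splitStep) PT.id (const ([], [])) ?_ ⟨5, fun X a b c _ => ?_⟩))
  · unfold splitStep
    have hb : PT (fun (_ : Orc) (p : List (Option Bool) × (List Bool × List (List Bool)) ×
        Option Bool) => p.2.1) := fst (snd PT.id)
    have hx : PT (fun (_ : Orc) (p : List (Option Bool) × (List Bool × List (List Bool)) ×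
        Option Bool) => p.2.2) := snd (snd PT.id)
    exact cond (eq hx (const none)) (pair (const []) (cons (reverse (fst hb)) (snd hb)))
      (pair (cons (eq hx (const (some true))) (fst hb)) (snd hb))
  · obtain ⟨b1, b2⟩ := b
    have := sz_pos b1
    unfold splitStep
    cases decide (c = none)
    · simp only [cond_false, sz_pair, sz_cons, sz_bool, Polynomial.eval_ofNat]; omega
    · simp only [cond_true, sz_pair, sz_cons, sz_nil, sz_reverse, Polynomial.eval_ofNat]; omega

/-- The string of a list of numbers, as a list of bits and commas. -/
def natsCode (l : List ℕ) : List (Option Bool) :=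
  l.flatMap fun n => (Computability.encodeNat n).map some ++ [none]

theorem symbols_natsCode (l : List ℕ) : symbols (natsCode l) = encodeNats l := by
  rw [symbols, natsCode, List.map_flatMap]
  simp [leafSym]
  rfl

theorem foldl_splitStep (m : List Bool) : ∀ (r : List (Option Bool)) (c : List Bool)
    (o : List (List Bool)), (m.map some ++ none :: r).foldl splitStep (c, o)
      = r.foldl splitStep ([], (c.reverse ++ m) :: o) := by
  induction m with
  | nil => intro r c o; simp [splitStep]
  | cons b m ih =>
    intro r c o
    rw [List.map_cons, List.cons_append, List.foldl_cons]
    have : splitStep (c, o) (some b) = (b :: c, o) := by cases b <;> rfl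
    rw [this, ih]
    simp

theorem splitNats_natsCode (l : List ℕ) :
    splitNats (natsCode l) = l.map Computability.encodeNat := by
  suffices h : ∀ (l : List ℕ) (o : List (List Bool)), ((natsCode l).foldl splitStep ([], o)).2
      = (l.map Computability.encodeNat).reverse ++ o by
    rw [splitNats, h]; simp
  intro l
  induction l with
  | nil => intro o; rfl
  | cons n l ih =>
    intro o
    have : natsCode (n :: l) = (Computability.encodeNat n).map some ++ none :: natsCode l := by
      simp [natsCode]
    rw [this, foldl_splitStep, ih]
    simp

/-- Convert the input string into a list. -/
def readP : Prog := .seq (move .A .B) (.seq (.push .S fun _ => .blank)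
  (drain .B (.seq (pushR .S) (.push .S fun _ => .bra))))

theorem Exec.readP {X : Orc} (l : List (Option Bool)) :
    Exec X readP (st [] (symbols l) [] [] []) (st (Enc.enc l).code [] [] [] [])
      (7 * l.length + 10) := by
  have h1 := Exec.move (X := X) (src := .A) (dst := .B) (by decide) (st [] (symbols l) [] [] [])
  have h2 := Exec.push (X := X) .S .blank (st [] [] (symbols l).reverse [] [])
  have h3 := Exec.drain (X := X) (src := .B) (q := .seq (pushR .S) (.push .S fun _ => .bra))
    (F := fun K x => Function.update K .S (.bra :: x :: K .S)) (c := 2)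
    (fun K x l => by
      rw [Function.update_of_ne (by decide), Function.update_comm (by decide)])
    (fun K x => by
      have e1 := Run.push (X := X) .S (fun v => v.getD .blank) (some x) K
      have e2 := Run.push (X := X) .S (fun _ => .bra) (some x) (Function.update K .S (x :: K .S))
      rw [Function.update_self, Function.update_idem] at e2
      exact ⟨_, _, le_rfl, e1.seq e2⟩)
    (symbols l).reverse (st [.blank] [] (symbols l).reverse [] []) rfl
  have hf : ∀ l : List (Option Bool), (symbols l).reverse.foldl
      (fun (K : Stacks) x => Function.update K .S (.bra :: x :: K .S)) (st [.blank] [] [] [] [])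
      = st (Enc.enc l).code [] [] [] [] := by
    intro l
    induction l with
    | nil => rfl
    | cons x l ih =>
      have e : symbols (x :: l) = leafSym (some x) :: symbols l := rfl
      rw [e, List.reverse_cons, List.foldl_append, ih]
      simp only [List.foldl_cons, List.foldl_nil, update_st_S, st_S]
      rfl
  have hl : (symbols l).length = l.length := by simp [symbols]
  simp only [update_st_A, update_st_B, update_st_S, st_A, st_B, st_S, List.append_nil, hf,
    List.length_reverse, hl] at h1 h2 h3
  exact (h1.seq (h2.seq h3)).mono (by omega)

open Polynomial in
-- After splitting at the commas, no conversion remains: numbers are represented by their lists of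
-- bits, so the list of bit strings is already the tree of the list of numbers. The final pop brings
-- the leaf with the answer into the register.
theorem PT.exists_machine {g : Orc → List ℕ → Bool} (hg : PT g) :
    ∃ (M : OracleTM) (p : Polynomial ℕ), ∀ (X : Orc) (l : List ℕ) (Q : Prop),
      (g X l = true ↔ Q) →
        M.DecidesInTime X (encodeNats l) (p.eval (encodeNats l).length) Q := by
  obtain ⟨P, p, hP⟩ := PT.splitNats
  obtain ⟨R, r, hR⟩ := hg
  obtain ⟨q, hq⟩ := PT.splitNats.size_le
  refine ⟨(Prog.seq readP (.seq P (.seq R (popR .S)))).toTM,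
    7 * X + 12 + p.comp (3 * X + 1) + r.comp (q.comp (3 * X + 1)), fun Y l Q hQ => ?_⟩
  have hA : (fun k => if k = .A then encodeNats l else [] : Stacks)
      = st [] (symbols (natsCode l)) [] [] [] := by
    funext k; cases k <;> simp [symbols_natsCode]
  have hl : (natsCode l).length = (encodeNats l).length := by
    rw [← symbols_natsCode]; simp [symbols]
  have hz : sz (natsCode l) ≤ 3 * (encodeNats l).length + 1 := by
    rw [← hl]
    have := sz_list_le (natsCode l) 1 fun a _ => le_rfl
    omega
  have e1 := Exec.readP (X := Y) (natsCode l)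
  have e2 := hP Y (natsCode l) []
  have e3 := hR Y l []
  simp only [splitNats_natsCode] at e2
  -- The instance for `ℕ` is defined through `encodeNat`, so both sides are the same tree.
  have e : Enc.enc (l.map Computability.encodeNat) = Enc.enc l := by
    change T.list ((l.map Computability.encodeNat).map Enc.enc) = T.list (l.map Enc.enc)
    rw [List.map_map]
    rfl
  have hz' : sz l ≤ q.eval (sz (natsCode l)) := by
    have := hq Y (natsCode l)
    rw [splitNats_natsCode] at this
    unfold sz at this ⊢
    rwa [e] at this
  rw [e] at e2
  simp only [List.append_nil] at e2 e3
  obtain ⟨v, m, hm, hr⟩ := (e1.seq (e2.seq e3)) none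
  have e4 := Run.pop (X := Y) .S (fun _ x => x) v (st ((Enc.enc (g Y l)).code) [] [] [] [])
  have hd : (((Enc.enc (g Y l)).code).head?) = some (.bit (g Y l)) := rfl
  simp only [st_S, hd] at e4
  rw [← hA] at hr
  cases hr with
  | @seq _ _ _ s _ n1 n2 ha hb =>
    cases hb with
    | @seq _ _ _ s' _ n3 n4 hc hd =>
      refine Prog.toTM_decides _ (ha.seq (hc.seq (hd.seq e4))) ?_ hQ
      have i1 := peval_mono p hz
      have i2 := peval_mono r (hz'.trans (peval_mono q hz))
      simp only [eval_add, eval_mul, eval_comp, eval_X, eval_ofNat, eval_one]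
      omega

/-! ## Correctness of the parser -/

/-- The tokens of a concept, in prefix order. -/
def SimplePL.toks : SimplePL → List Tok
  | .atom A => [(0, A, 0, 0)]
  | .bot => [(1, 0, 0, 0)]
  | .interval f l u => [(2, f, l, u)]
  | .ex r C => (3, r, 0, 0) :: C.toks
  | .inter C D => (4, 0, 0, 0) :: (C.toks ++ D.toks)

/-- The token of an axiom. -/
def PLAxiom.tok : PLAxiom → Option Tok
  | .funcRole r => some (0, r, 0, 0)
  | .funcProp f => some (1, f, 0, 0)
  | .range (.name r) A => some (2, 0, r, A)
  | .range (.inv r) A => some (2, 1, r, A)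
  | .incl _ _ => none
  | .disj _ _ => none

theorem SimplePL.length_toks_le (C : SimplePL) : C.toks.length ≤ C.code.length := by
  induction C with
  | atom | bot | interval => simp [SimplePL.toks, SimplePL.code]
  | ex r C ih => simp only [SimplePL.toks, SimplePL.code, List.length_cons]; omega
  | inter C D ihC ihD =>
    simp only [SimplePL.toks, SimplePL.code, List.length_cons, List.length_append]; omega

/-- There is one step per token. The counter of expected concepts finds the end of the concept: an
intersection increases it, an existential restriction keeps it, and the other tokens decrease it. -/
theorem parseStep_iterate_concept (C : SimplePL) : ∀ (l : List ℕ) (p : List Unit) (t : List Tok)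
    (o : List (List Tok)), parseStep^[C.toks.length] (C.code ++ l, () :: p, t :: o)
      = (l, p, (C.toks.reverse ++ t) :: o) := by
  induction C with
  | atom A => intro l p t o; rfl
  | bot => intro l p t o; rfl
  | interval f a b => intro l p t o; rfl
  | ex r C ih =>
    intro l p t o
    have : parseStep ((SimplePL.ex r C).code ++ l, () :: p, t :: o)
      = (C.code ++ l, () :: p, ((3, r, 0, 0) :: t) :: o) := rfl
    rw [SimplePL.toks, List.length_cons, Function.iterate_succ_apply, this, ih]
    simp
  | inter C D ihC ihD =>
    intro l p t o
    have : parseStep ((SimplePL.inter C D).code ++ l, () :: p, t :: o)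
      = (C.code ++ (D.code ++ l), () :: () :: p, ((4, 0, 0, 0) :: t) :: o) := by
      rw [← List.append_assoc]; rfl
    rw [SimplePL.toks, List.length_cons, Function.iterate_succ_apply, this, List.length_append,
      Nat.add_comm, Function.iterate_add_apply, ihC, ihD]
    simp

/-- The number of passes is the length of the whole input, which is more than required. The surplus
is harmless, since a state that expects no concept and sees the end mark `0` is fixed by the parser
step. -/
theorem parseConcepts_listCode (Cs : List SimplePL) (r : List ℕ) :
    parseConcepts (listCode SimplePL.code Cs ++ r)
      = (r, (Cs.map fun C => C.toks.reverse).reverse) := by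
  have key : ∀ (Cs : List SimplePL) (o : List (List Tok)),
      ∃ k ≤ (listCode SimplePL.code Cs).length,
        parseStep^[k] (listCode SimplePL.code Cs ++ r, [], o)
          = (0 :: r, [], (Cs.map fun C => C.toks.reverse).reverse ++ o) := by
    intro Cs
    induction Cs with
    | nil => intro o; exact ⟨0, by simp, rfl⟩
    | cons C Cs ih =>
      intro o
      obtain ⟨k, hk, h⟩ := ih (C.toks.reverse :: o)
      have e : listCode SimplePL.code (C :: Cs) ++ r
          = 1 :: (C.code ++ (listCode SimplePL.code Cs ++ r)) := by simp [listCode]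
      have e' : (listCode SimplePL.code (C :: Cs)).length
          = C.code.length + (listCode SimplePL.code Cs).length + 1 := by simp [listCode]
      refine ⟨k + (C.toks.length + 1), ?_, ?_⟩
      · have := C.length_toks_le; omega
      · have h1 : parseStep (1 :: (C.code ++ (listCode SimplePL.code Cs ++ r)), [], o)
            = (C.code ++ (listCode SimplePL.code Cs ++ r), [()], [] :: o) := rfl
        rw [Function.iterate_add_apply, Function.iterate_succ_apply, e, h1,
          parseStep_iterate_concept, List.append_nil, h]
        simp
  obtain ⟨k, hk, h⟩ := key Cs []
  obtain ⟨j, hj⟩ := Nat.exists_eq_add_of_le (show k ≤ (listCode SimplePL.code Cs ++ r).length by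
    rw [List.length_append]; omega)
  have hfix : ∀ o : List (List Tok), parseStep^[j] (0 :: r, [], o) = (0 :: r, [], o) :=
    fun o => Function.iterate_fixed rfl j
  rw [parseConcepts, List.foldl_const, hj, Nat.add_comm, Function.iterate_add_apply, h, hfix]
  simp

theorem parseAxioms_listCode (K : List PLAxiom) (r : List ℕ) :
    parseAxioms (listCode PLAxiom.code K ++ r) = (r, (K.filterMap PLAxiom.tok).reverse) := by
  have key : ∀ (K : List PLAxiom) (o : List Tok),
      ∃ k ≤ (listCode PLAxiom.code K).length,
        parseAxStep^[k] (listCode PLAxiom.code K ++ r, o)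
          = (0 :: r, (K.filterMap PLAxiom.tok).reverse ++ o) := by
    intro K
    induction K with
    | nil => intro o; exact ⟨0, by simp, rfl⟩
    | cons α K ih =>
      intro o
      obtain ⟨k, hk, h⟩ := ih (α.tok.toList ++ o)
      have e : listCode PLAxiom.code (α :: K) ++ r
          = 1 :: (α.code ++ (listCode PLAxiom.code K ++ r)) := by simp [listCode]
      have e' : (listCode PLAxiom.code (α :: K)).length
          = α.code.length + (listCode PLAxiom.code K).length + 1 := by simp [listCode]
      have h1 : ∀ l, parseAxStep (1 :: (α.code ++ l), o) = (l, α.tok.toList ++ o) := by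
        intro l
        rcases α with _ | _ | ⟨_ | _, _⟩ | _ | _ <;> rfl
      refine ⟨k + 1, by omega, ?_⟩
      rw [Function.iterate_succ_apply, e, h1, h]
      cases ht : α.tok <;> simp [ht]
  obtain ⟨k, hk, h⟩ := key K []
  obtain ⟨j, hj⟩ := Nat.exists_eq_add_of_le (show k ≤ (listCode PLAxiom.code K ++ r).length by
    rw [List.length_append]; omega)
  have hfix : ∀ o : List Tok, parseAxStep^[j] (0 :: r, o) = (0 :: r, o) :=
    fun o => Function.iterate_fixed rfl j
  rw [parseAxioms, List.foldl_const, hj, Nat.add_comm, Function.iterate_add_apply, h, hfix]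
  simp

/-- The input of an instance, as a list of numbers. -/
def Triple.nats (π : Triple) : List ℕ :=
  listCode PLAxiom.code π.K ++ listCode SimplePL.code π.lhs.disjuncts ++
    listCode SimplePL.code π.rhs.disjuncts

/-- The tokens of the functionality and range axioms. -/
def Triple.toks (π : Triple) : List Tok := (π.K.filterMap PLAxiom.tok).reverse

/-- The token lists of a union of concepts. -/
def FullPL.toks (C : FullPL) : List (List Tok) := (C.disjuncts.map fun C => C.toks.reverse).reverse

theorem decideNats_nats (c : ℕ) (X : Orc) (π : Triple) :
    decideNats c X π.nats = decideToks c X π.toks π.lhs.toks π.rhs.toks := by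
  have h := parseConcepts_listCode π.rhs.disjuncts []
  rw [List.append_nil] at h
  rw [decideNats, Triple.nats, List.append_assoc, parseAxioms_listCode, parseConcepts_listCode, h]
  rfl

/-! ## Encodings of oracle queries -/

theorem encodeNat_injective : Function.Injective Computability.encodeNat := fun n m h => by
  rw [← Computability.decode_encodeNat n, h, Computability.decode_encodeNat]

theorem encodeNats_injective : Function.Injective encodeNats := by
  intro l l' h
  rw [← symbols_natsCode, ← symbols_natsCode] at h
  have h1 : natsCode l = natsCode l' := by
    refine List.map_injective_iff.2 ?_ h
    intro x y hxy
    simpa using leafSym_injective hxy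
  have h2 := congrArg splitNats h1
  rw [splitNats_natsCode, splitNats_natsCode] at h2
  exact List.map_injective_iff.2 encodeNat_injective h2

theorem listCode_append_injective : ∀ (l l' r r' : List ℕ),
    listCode (fun A => [A]) l ++ r = listCode (fun A => [A]) l' ++ r' → l = l' ∧ r = r' := by
  intro l
  induction l with
  | nil =>
    rintro (_ | ⟨B, l'⟩) r r' h
    · simpa [listCode] using h
    · simp [listCode] at h
  | cons A l ih =>
    rintro (_ | ⟨B, l'⟩) r r' h
    · simp [listCode] at h
    · have e : ∀ (A : ℕ) (l r : List ℕ), listCode (fun A => [A]) (A :: l) ++ r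
          = 1 :: A :: (listCode (fun A => [A]) l ++ r) := by simp [listCode]
      rw [e, e] at h
      simp only [List.cons.injEq, true_and] at h
      obtain ⟨h1, h2⟩ := ih l' r r' h.2
      exact ⟨by rw [h.1, h1], h2⟩

theorem OracleQuery.encode_injective : Function.Injective OracleQuery.encode := by
  rintro ⟨l, r⟩ ⟨l', r'⟩ h
  obtain ⟨h1, h2⟩ := listCode_append_injective _ _ _ _ (encodeNats_injective h)
  have h3 := listCode_append_injective r r' [] [] (by simpa using h2)
  simp only at h1
  rw [h1, h3.1]

/-- The list marks `1` and `0` have the binary codes `[true]` and `[]`, so the former is written as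
a bit with a comma and the latter as a comma alone. -/
theorem sideCode_eq (l : List ℕ) : sideCode l = natsCode (listCode (fun A => [A]) l) := by
  have e1 : Computability.encodeNat 1 = [true] := rfl
  have e0 : Computability.encodeNat 0 = [] := rfl
  rw [sideCode, listCode, natsCode, List.flatMap_append, List.flatMap_assoc]
  simp [e1, e0]

open Classical in
theorem askQuery_iff (O : KB) (l r : List ℕ) :
    askQuery (OracleQuery.encode '' pos O) l r = true ↔
      (∀ A ∈ l ++ r, Symb.concept A ∈ sig O) ∧ Entails O (OracleQuery.toAxm ⟨l, r⟩) := by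
  have e : symbols (sideCode l ++ sideCode r) = OracleQuery.encode ⟨l, r⟩ := by
    rw [sideCode_eq, sideCode_eq, OracleQuery.encode, ← symbols_natsCode]
    simp [natsCode]
  rw [askQuery, decide_eq_true_iff, e, OracleQuery.encode_injective.mem_set_image]
  exact Iff.rfl

/-! ## Interpretation of queries -/

variable {Δ : Type}

theorem mem_ext_interList (I : Interp Δ) (l : List Concept) (x : Δ) :
    x ∈ I.ext (interList l) ↔ ∀ C ∈ l, x ∈ I.ext C := by
  induction l with
  | nil => simp [interList, Interp.ext]
  | cons C l ih =>
    have : I.ext (interList (C :: l)) = I.ext C ∩ I.ext (interList l) := rfl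
    rw [this, Set.mem_inter_iff, ih, List.forall_mem_cons]

theorem mem_ext_unionList (I : Interp Δ) (l : List Concept) (x : Δ) :
    x ∈ I.ext (unionList l) ↔ ∃ C ∈ l, x ∈ I.ext C := by
  induction l with
  | nil => simp [unionList, Interp.ext]
  | cons C l ih =>
    have : I.ext (unionList (C :: l)) = I.ext C ∪ I.ext (unionList l) := rfl
    rw [this, Set.mem_union, ih]
    simp

theorem sat_toAxm_iff (I : Interp Δ) (l r : List ℕ) :
    I.Sat (OracleQuery.toAxm ⟨l, r⟩) ↔
      ∀ x, (∀ A ∈ l, x ∈ I.conc A) → ∃ A ∈ r, x ∈ I.conc A := by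
  have h1 : ∀ x, x ∈ I.ext (interList (l.map Concept.atom)) ↔ ∀ A ∈ l, x ∈ I.conc A := by
    intro x
    rw [mem_ext_interList]
    simp [Interp.ext]
  have h2 : ∀ x, x ∈ I.ext (unionList (r.map Concept.atom)) ↔ ∃ A ∈ r, x ∈ I.conc A := by
    intro x
    rw [mem_ext_unionList]
    simp [Interp.ext]
  exact forall_congr' fun x => by rw [h1, h2]

theorem mem_tuples (P : List ℕ) (c : ℕ) (l : List ℕ) :
    l ∈ tuples P c ↔ l.length = c ∧ ∀ p ∈ l, p ∈ P := by
  induction c generalizing l with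
  | zero => cases l <;> simp [tuples]
  | succ c ih =>
    simp only [tuples, List.mem_flatMap, List.mem_map]
    constructor
    · rintro ⟨p, hp, l', hl', rfl⟩
      rw [ih] at hl'
      simpa [hl'.1, hp] using hl'.2
    · rintro ⟨h1, h2⟩
      cases l with
      | nil => simp at h1
      | cons p l =>
        refine ⟨p, h2 p List.mem_cons_self, l, (ih l).2 ⟨by simpa using h1, fun q hq =>
          h2 q (List.mem_cons_of_mem _ hq)⟩, rfl⟩

-- Functionality and range axioms as tokens

theorem hasAx_iff (K : List PLAxiom) (t r : ℕ) :
    hasAx (K.filterMap PLAxiom.tok).reverse t r = true ↔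
      ∃ α ∈ K, ∃ x, α.tok = some (t, r, x) := by
  simp only [hasAx, List.any_reverse, List.any_eq_true, List.mem_filterMap, Bool.and_eq_true,
    decide_eq_true_iff]
  constructor
  · rintro ⟨⟨a, b, x⟩, ⟨α, hα, h⟩, rfl, rfl⟩
    exact ⟨α, hα, x, h⟩
  · rintro ⟨α, hα, x, h⟩
    exact ⟨_, ⟨α, hα, h⟩, rfl, rfl⟩

theorem hasAx_zero (K : List PLAxiom) (r : ℕ) :
    hasAx (K.filterMap PLAxiom.tok).reverse 0 r = true ↔ PLAxiom.funcRole r ∈ K := by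
  rw [hasAx_iff]
  constructor
  · rintro ⟨_ | _ | ⟨_ | _, _⟩ | _ | _, hα, x, h⟩ <;> simp [PLAxiom.tok] at h
    rw [← h.1]; exact hα
  · intro h; exact ⟨_, h, _, rfl⟩

theorem hasAx_one (K : List PLAxiom) (f : ℕ) :
    hasAx (K.filterMap PLAxiom.tok).reverse 1 f = true ↔ PLAxiom.funcProp f ∈ K := by
  rw [hasAx_iff]
  constructor
  · rintro ⟨_ | _ | ⟨_ | _, _⟩ | _ | _, hα, x, h⟩ <;> simp [PLAxiom.tok] at h
    rw [← h.1]; exact hα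
  · intro h; exact ⟨_, h, _, rfl⟩

theorem mem_lab_iff (K : List PLAxiom) (F : Facts) (n : Node) (A : ℕ) :
    A ∈ lab (K.filterMap PLAxiom.tok).reverse F n ↔ (n, A) ∈ F.2.1 ∨
      (∃ r m, PLAxiom.range (.name r) A ∈ K ∧ (m, r, n) ∈ F.1) ∨
      ∃ r m, PLAxiom.range (.inv r) A ∈ K ∧ (n, r, m) ∈ F.1 := by
  simp only [lab, List.mem_append, List.mem_map, List.mem_filter, List.mem_reverse,
    List.mem_filterMap, List.any_eq_true, Bool.and_eq_true, decide_eq_true_iff]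
  refine or_congr ?_ ?_
  · constructor
    · rintro ⟨⟨m, B⟩, ⟨h, rfl⟩, rfl⟩; exact h
    · intro h; exact ⟨_, ⟨h, rfl⟩, rfl⟩
  · constructor
    · rintro ⟨⟨a, b, r, B⟩, ⟨⟨α, hα, ht⟩, rfl, ⟨m, s, m'⟩, he, rfl, hc⟩, rfl⟩
      rcases α with _ | _ | ⟨_ | _, _⟩ | _ | _ <;> simp [PLAxiom.tok] at ht
      · obtain ⟨rfl, rfl, rfl⟩ := ht
        simp only [decide_true, cond_true, decide_eq_true_iff] at hc
        subst hc
        exact .inl ⟨_, m, hα, he⟩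
      · obtain ⟨rfl, rfl, rfl⟩ := ht
        simp at hc
        subst hc
        exact .inr ⟨_, m', hα, he⟩
    · rintro (⟨r, m, hα, he⟩ | ⟨r, m, hα, he⟩)
      · exact ⟨(2, 0, r, A), ⟨⟨_, hα, rfl⟩, rfl, _, he, rfl, by simp⟩, rfl⟩
      · exact ⟨(2, 1, r, A), ⟨⟨_, hα, rfl⟩, rfl, _, he, rfl, by simp⟩, rfl⟩

/-! ## Products of models of Horn knowledge bases -/

section product

variable {ι : Type} {Δ : ι → Type} (I : ∀ i, Interp (Δ i))

/-- The direct product of interpretations. -/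
def Interp.pi : Interp (∀ i, Δ i) where
  conc A := {x | ∀ i, x i ∈ (I i).conc A}
  role r x y := ∀ i, (I i).role r (x i) (y i)
  ind a i := (I i).ind a
  prop _ _ _ := False

theorem Interp.pi_roleExt (R : Role) (x y : ∀ i, Δ i) :
    (Interp.pi I).roleExt R x y ↔ ∀ i, (I i).roleExt R (x i) (y i) := by
  cases R <;> exact Iff.rfl

theorem Interp.pi_chainExt (w : List Role) : ∀ (x y : ∀ i, Δ i),
    (Interp.pi I).chainExt w x y → ∀ i, (I i).chainExt w (x i) (y i) := by
  induction w with
  | nil => rintro x _ rfl i; rfl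
  | cons R w ih =>
    rintro x y ⟨z, h1, h2⟩ i
    exact ⟨z i, (Interp.pi_roleExt I R x z).1 h1 i, ih z y h2 i⟩

theorem encard_pos_iff_exists {α : Type} {p : α → Prop} :
    ((1 : ℕ) : ℕ∞) ≤ {y | p y}.encard ↔ ∃ y, p y := by
  rw [Nat.cast_one, Set.one_le_encard_iff_nonempty]
  exact Iff.rfl

/-- Concepts without negative literals hold in all factors, and concepts without positive literals
hold in the product if they hold in some factor. -/
theorem Interp.pi_body_neg (C : Concept) :
    (C.IsBody → ∀ x, x ∈ (Interp.pi I).ext C → ∀ i, x i ∈ (I i).ext C) ∧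
    (C.IsNeg → ∀ x i, x i ∈ (I i).ext C → x ∈ (Interp.pi I).ext C) := by
  induction C with
  | top => exact ⟨fun _ _ _ _ => trivial, fun _ _ _ _ => trivial⟩
  | bot => exact ⟨fun _ _ h => h.elim, fun _ _ _ h => h.elim⟩
  | atom A => exact ⟨fun _ _ h i => h i, fun h => h.elim⟩
  | inter C D ihC ihD =>
    exact ⟨fun h x hx i => ⟨ihC.1 h.1 x hx.1 i, ihD.1 h.2 x hx.2 i⟩,
      fun h x i hx => ⟨ihC.2 h.1 x i hx.1, ihD.2 h.2 x i hx.2⟩⟩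
  | union C D ihC ihD =>
    exact ⟨fun h x hx i => hx.imp (fun hx => ihC.1 h.1 x hx i) (fun hx => ihD.1 h.2 x hx i),
      fun h x i hx => hx.imp (fun hx => ihC.2 h.1 x i hx) (fun hx => ihD.2 h.2 x i hx)⟩
  | compl C ih =>
    exact ⟨fun h x hx i hi => hx (ih.2 h x i hi), fun h x i hi hx => hi (ih.1 h x hx i)⟩
  | ex R C ih =>
    refine ⟨?_, fun h => h.elim⟩
    rintro h x ⟨y, hy, hC⟩ i
    exact ⟨y i, (Interp.pi_roleExt I R x y).1 hy i, ih.1 h y hC i⟩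
  | all R C ih =>
    refine ⟨fun h => h.elim, fun h x i hx y hy => ?_⟩
    exact ih.2 h y i (hx (y i) ((Interp.pi_roleExt I R x y).1 hy i))
  | atLeast n S C ih =>
    refine ⟨?_, fun h => h.elim⟩
    rintro ⟨hn, h⟩ x hx i
    interval_cases n
    · simp [Interp.ext]
    · simp only [Interp.ext, Set.mem_ofPred_eq, encard_pos_iff_exists] at hx ⊢
      obtain ⟨y, hy, hC⟩ := hx
      exact ⟨y i, (Interp.pi_roleExt I S x y).1 hy i, ih.1 h y hC i⟩
  | atMost n S C ih =>
    refine ⟨fun h => h.elim, ?_⟩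
    rintro ⟨rfl, h⟩ x i hx
    simp only [Interp.ext, Set.mem_ofPred_eq, Nat.cast_zero, nonpos_iff_eq_zero,
      Set.encard_eq_zero, Set.eq_empty_iff_forall_notMem] at hx ⊢
    rintro y ⟨hy, hC⟩
    exact hx (y i) ⟨(Interp.pi_roleExt I S x y).1 hy i, ih.1 h y hC i⟩
  | self S => exact ⟨fun _ x hx => (Interp.pi_roleExt I S x x).1 hx, fun h => h.elim⟩
  | interval f l u => exact ⟨fun h => h.elim, fun h => h.elim⟩

/-- In a Horn union, one disjunct has no positive literals. If it holds in some factor, it holds in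
the product; otherwise the other disjunct holds in all factors and the induction applies. Witnesses
for `∃` and for lower bounds are chosen in every factor and combined into tuples. An upper bound of
one makes all coordinates agree, and an upper bound of zero is needed in one factor only. -/
theorem Interp.pi_head [Nonempty ι] (C : Concept) :
    C.IsHead → ∀ x, (∀ i, x i ∈ (I i).ext C) → x ∈ (Interp.pi I).ext C := by
  have i₀ : ι := Classical.arbitrary ι
  induction C with
  | top => exact fun _ _ _ => trivial
  | bot => exact fun _ _ h => (h i₀).elim
  | atom A => exact fun _ _ h => h
  | inter C D ihC ihD =>
    exact fun h x hx => ⟨ihC h.1 x fun i => (hx i).1, ihD h.2 x fun i => (hx i).2⟩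
  | union C D ihC ihD =>
    rintro (⟨hC, hD⟩ | ⟨hC, hD⟩) x hx
    · by_cases hi : ∃ i, x i ∈ (I i).ext C
      · obtain ⟨i, hi⟩ := hi
        exact .inl ((Interp.pi_body_neg I C).2 hC x i hi)
      · exact .inr (ihD hD x fun i => (hx i).resolve_left fun h => hi ⟨i, h⟩)
    · by_cases hi : ∃ i, x i ∈ (I i).ext D
      · obtain ⟨i, hi⟩ := hi
        exact .inr ((Interp.pi_body_neg I D).2 hD x i hi)
      · exact .inl (ihC hC x fun i => (hx i).resolve_right fun h => hi ⟨i, h⟩)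
  | compl C ih => exact fun h x hx hC => hx i₀ ((Interp.pi_body_neg I C).1 h x hC i₀)
  | ex R C ih =>
    intro h x hx
    choose y hy hC using hx
    exact ⟨y, (Interp.pi_roleExt I R x y).2 hy, ih h y hC⟩
  | all R C ih =>
    intro h x hx y hy
    exact ih h y fun i => hx i (y i) ((Interp.pi_roleExt I R x y).1 hy i)
  | atLeast n S C ih =>
    intro h x hx
    have hf : ∀ i, ∃ f : Fin n → Δ i, Function.Injective f ∧
        ∀ k, (I i).roleExt S (x i) (f k) ∧ f k ∈ (I i).ext C := by
      intro i
      obtain ⟨t, ht, hc⟩ := Set.exists_subset_encard_eq (hx i)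
      have hfin : t.Finite := Set.finite_of_encard_eq_coe hc
      have hcard : hfin.toFinset.card = n := by
        rw [hfin.encard_eq_coe_toFinset_card] at hc
        exact_mod_cast hc
      refine ⟨fun k => (hfin.toFinset.equivFinOfCardEq hcard).symm k, fun k k' hk => ?_, fun k => ?_⟩
      · exact (hfin.toFinset.equivFinOfCardEq hcard).symm.injective (Subtype.ext hk)
      · exact ht (hfin.mem_toFinset.1 ((hfin.toFinset.equivFinOfCardEq hcard).symm k).2)
    choose f hf hy using hf
    -- A single coordinate already separates the `n` tuples.
    have hinj : Function.Injective fun (k : Fin n) i => f i k := fun k k' hk =>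
      hf i₀ (congrFun hk i₀)
    have hsub : Set.range (fun (k : Fin n) i => f i k) ⊆
        {y | (Interp.pi I).roleExt S x y ∧ y ∈ (Interp.pi I).ext C} := by
      rintro _ ⟨k, rfl⟩
      exact ⟨(Interp.pi_roleExt I S x _).2 fun i => (hy i k).1, ih h _ fun i => (hy i k).2⟩
    refine le_trans (le_of_eq ?_) (Set.encard_le_encard hsub)
    rw [← Set.image_univ, hinj.encard_image, Set.encard_univ]
    simp
  | atMost n S C ih =>
    rintro ⟨hn, h⟩ x hx
    interval_cases n
    · simp only [Interp.ext, Set.mem_ofPred_eq, Nat.cast_zero, nonpos_iff_eq_zero,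
        Set.encard_eq_zero, Set.eq_empty_iff_forall_notMem] at hx ⊢
      rintro y ⟨hy, hC⟩
      exact hx i₀ (y i₀)
        ⟨(Interp.pi_roleExt I S x y).1 hy i₀, (Interp.pi_body_neg I C).1 h y hC i₀⟩
    · simp only [Interp.ext, Set.mem_ofPred_eq, Nat.cast_one, Set.encard_le_one_iff] at hx ⊢
      rintro y z ⟨hy, hyC⟩ ⟨hz, hzC⟩
      funext i
      exact hx i (y i) (z i)
        ⟨(Interp.pi_roleExt I S x y).1 hy i, (Interp.pi_body_neg I C).1 h y hyC i⟩
        ⟨(Interp.pi_roleExt I S x z).1 hz i, (Interp.pi_body_neg I C).1 h z hzC i⟩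
  | self S => exact fun _ x hx => (Interp.pi_roleExt I S x x).2 hx
  | interval f l u => exact fun h => h.elim

/-- The terminological axioms of Horn knowledge bases, and disjointness axioms for names. -/
def Axm.IsHornTBox : Axm → Prop
  | .gci C D => C.IsBody ∧ D.IsHead
  | .roleDisj _ _ => True
  | .ria _ _ => True
  | .conceptDisj C D => C.IsBody ∧ D.IsBody
  | _ => False

theorem Interp.pi_sat [Nonempty ι] {α : Axm} (hα : α.IsHornTBox) (h : ∀ i, (I i).Sat α) :
    (Interp.pi I).Sat α := by
  have i₀ : ι := Classical.arbitrary ι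
  cases α with
  | gci C D =>
    exact fun x hx => Interp.pi_head I D hα.2 x fun i =>
      h i ((Interp.pi_body_neg I C).1 hα.1 x hx i)
  | roleDisj S T =>
    rintro x y ⟨h1, h2⟩
    exact h i₀ (x i₀) (y i₀)
      ⟨(Interp.pi_roleExt I S x y).1 h1 i₀, (Interp.pi_roleExt I T x y).1 h2 i₀⟩
  | ria w R =>
    exact fun x y hxy => (Interp.pi_roleExt I R x y).2 fun i =>
      h i _ _ (Interp.pi_chainExt I w x y hxy i)
  | conceptDisj C D =>
    refine Set.eq_empty_iff_forall_notMem.2 fun x hx => ?_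
    exact Set.eq_empty_iff_forall_notMem.1 (h i₀) (x i₀)
      ⟨(Interp.pi_body_neg I C).1 hα.1 x hx.1 i₀, (Interp.pi_body_neg I D).1 hα.2 x hx.2 i₀⟩
  | _ => exact hα.elim

end product

/-- In a model of the terminological part of a Horn knowledge base, some element that belongs to the
given concept names belongs to no other concept names than those entailed. -/
theorem exists_exact_type {O : KB} {L : List ℕ} (hL : ¬ Entails O (OracleQuery.toAxm ⟨L, []⟩)) :
    ∃ (Δ : Type) (I : Interp Δ) (e : Δ), (∀ α ∈ O, α.IsHornTBox → I.Sat α) ∧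
      (∀ A ∈ L, e ∈ I.conc A) ∧
      ∀ A, e ∈ I.conc A → Entails O (OracleQuery.toAxm ⟨L, [A]⟩) := by
  have key : ∀ r, ¬ Entails O (OracleQuery.toAxm ⟨L, r⟩) → ∃ (Δ : Type) (I : Interp Δ) (e : Δ),
      (∀ α ∈ O, I.Sat α) ∧ (∀ A ∈ L, e ∈ I.conc A) ∧ ∀ A ∈ r, e ∉ I.conc A := by
    intro r h
    simp only [Entails, sat_toAxm_iff] at h
    push Not at h
    obtain ⟨Δ, _, I, hI, e, h1, h2⟩ := h
    exact ⟨Δ, I, e, hI, h1, h2⟩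
  -- There is one factor for each name that is not entailed. The factor `none` keeps the index set
  -- nonempty if every name is entailed.
  let ι := Option {A // ¬ Entails O (OracleQuery.toAxm ⟨L, [A]⟩)}
  have h : ∀ i : ι, ∃ (Δ : Type) (I : Interp Δ) (e : Δ), (∀ α ∈ O, I.Sat α) ∧
      (∀ A ∈ L, e ∈ I.conc A) ∧ ∀ A, i.map Subtype.val = some A → e ∉ I.conc A := by
    rintro (_ | ⟨A, hA⟩)
    · obtain ⟨Δ, I, e, h1, h2, -⟩ := key [] hL
      exact ⟨Δ, I, e, h1, h2, by simp⟩
    · obtain ⟨Δ, I, e, h1, h2, h3⟩ := key [A] hA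
      exact ⟨Δ, I, e, h1, h2, by simpa using h3⟩
  choose Δ I e h1 h2 h3 using h
  refine ⟨∀ i, Δ i, Interp.pi I, e, fun α hα hT => Interp.pi_sat I hT fun i => h1 i α hα,
    fun A hA i => h2 i A hA, fun A hA => ?_⟩
  -- The coordinate of `e` in the factor that refutes `A` avoids `A`, whereas membership in the
  -- product requires `A` in all factors.
  by_contra hn
  exact h3 (some ⟨A, hn⟩) A rfl (hA _)

/-! ## Disjoint unions -/

section union

variable {ι : Type} {Δ : ι → Type}

/-- On the symbols of a signature, `J` is the disjoint union of the interpretations `I i`. -/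
structure Interp.IsUnion (I : ∀ i, Interp (Δ i)) (J : Interp (Σ i, Δ i)) (S : Set Symb) : Prop where
  conc : ∀ A, Symb.concept A ∈ S → ∀ i d, (⟨i, d⟩ : Σ i, Δ i) ∈ J.conc A ↔ d ∈ (I i).conc A
  role : ∀ r, Symb.role r ∈ S → ∀ x y, J.role r x y ↔
    ∃ i d d', x = ⟨i, d⟩ ∧ y = ⟨i, d'⟩ ∧ (I i).role r d d'

namespace Interp.IsUnion

variable {I : ∀ i, Interp (Δ i)} {J : Interp (Σ i, Δ i)} {S : Set Symb}

theorem roleExt (h : IsUnion I J S) {R : Role} (hR : R.sig ⊆ S) (x y : Σ i, Δ i) :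
    J.roleExt R x y ↔ ∃ i d d', x = ⟨i, d⟩ ∧ y = ⟨i, d'⟩ ∧ (I i).roleExt R d d' := by
  cases R with
  | name r => exact h.role r (hR rfl) x y
  | inv r =>
    refine (h.role r (hR rfl) y x).trans ?_
    constructor
    · rintro ⟨i, d, d', h1, h2, h3⟩; exact ⟨i, d', d, h2, h1, h3⟩
    · rintro ⟨i, d, d', h1, h2, h3⟩; exact ⟨i, d', d, h2, h1, h3⟩

theorem roleExt_mk (h : IsUnion I J S) {R : Role} (hR : R.sig ⊆ S) (i : ι) (d d' : Δ i) :
    J.roleExt R ⟨i, d⟩ ⟨i, d'⟩ ↔ (I i).roleExt R d d' := by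
  rw [h.roleExt hR]
  constructor
  · rintro ⟨j, a, b, h1, h2, h3⟩
    cases h1
    cases h2
    exact h3
  · exact fun h => ⟨i, d, d', rfl, rfl, h⟩

theorem exists_chainExt (h : IsUnion I J S) (w : List Role) (hw : ∀ R ∈ w, R.sig ⊆ S) :
    ∀ x y : Σ i, Δ i, J.chainExt w x y →
      ∃ i d d', x = ⟨i, d⟩ ∧ y = ⟨i, d'⟩ ∧ (I i).chainExt w d d' := by
  induction w with
  | nil => rintro ⟨i, d⟩ _ rfl; exact ⟨i, d, d, rfl, rfl, rfl⟩
  | cons R w ih =>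
    rintro x y ⟨z, h1, h2⟩
    obtain ⟨i, d, d', rfl, rfl, h3⟩ := (h.roleExt (hw R List.mem_cons_self) x z).1 h1
    obtain ⟨j, a, b, h4, rfl, h5⟩ := ih (fun R hR => hw R (List.mem_cons_of_mem _ hR)) _ y h2
    cases h4
    exact ⟨i, d, b, rfl, rfl, d', h3, h5⟩

/-- No role leads out of a component, so sets of successors correspond bijectively. This makes
number restrictions invariant. -/
theorem successors (h : IsUnion I J S) {R : Role} (hR : R.sig ⊆ S) {X : Set (Σ i, Δ i)}
    {Y : ∀ i, Set (Δ i)} (hX : ∀ i d, (⟨i, d⟩ : Σ i, Δ i) ∈ X ↔ d ∈ Y i) (i : ι) (d : Δ i) :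
    {y | J.roleExt R ⟨i, d⟩ y ∧ y ∈ X} =
      (fun d' => (⟨i, d'⟩ : Σ i, Δ i)) '' {y | (I i).roleExt R d y ∧ y ∈ Y i} := by
  ext y
  constructor
  · rintro ⟨h1, h2⟩
    obtain ⟨j, a, b, h3, rfl, h4⟩ := (h.roleExt hR _ y).1 h1
    cases h3
    exact ⟨b, ⟨h4, (hX i b).1 h2⟩, rfl⟩
  · rintro ⟨b, ⟨h1, h2⟩, rfl⟩
    exact ⟨(h.roleExt_mk hR i d b).2 h1, (hX i b).2 h2⟩

/-- There are neither nominals nor a universal role, so a concept cannot see other components.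
Interval constraints have to be excluded, as `IsUnion` leaves concrete properties open. -/
theorem mem_ext {O : KB} (h : IsUnion I J S) (C : Concept) : C.sig ⊆ S → C.IsSRIQ O →
    ∀ i d, (⟨i, d⟩ : Σ i, Δ i) ∈ J.ext C ↔ d ∈ (I i).ext C := by
  have inj : ∀ i, Function.Injective fun d' : Δ i => (⟨i, d'⟩ : Σ i, Δ i) := fun i =>
    sigma_mk_injective
  induction C with
  | top => exact fun _ _ _ _ => Iff.rfl
  | bot => exact fun _ _ _ _ => Iff.rfl
  | atom A => exact fun hs _ => h.conc A (hs rfl)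
  | inter C D ihC ihD =>
    intro hs hO i d
    exact and_congr (ihC (Set.subset_union_left.trans hs) hO.1 i d)
      (ihD (Set.subset_union_right.trans hs) hO.2 i d)
  | union C D ihC ihD =>
    intro hs hO i d
    exact or_congr (ihC (Set.subset_union_left.trans hs) hO.1 i d)
      (ihD (Set.subset_union_right.trans hs) hO.2 i d)
  | compl C ih => exact fun hs hO i d => not_congr (ih hs hO i d)
  | ex R C ih =>
    intro hs hO i d
    have e := h.successors (Set.subset_union_left.trans hs)
      (ih (Set.subset_union_right.trans hs) hO) i d
    change Set.Nonempty {y | J.roleExt R ⟨i, d⟩ y ∧ y ∈ J.ext C} ↔ _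
    rw [e, Set.image_nonempty]
    exact Iff.rfl
  | all R C ih =>
    intro hs hO i d
    have ih := ih (Set.subset_union_right.trans hs) hO
    have hR := h.roleExt (Set.subset_union_left.trans hs)
    constructor
    · exact fun hd d' hd' => (ih i d').1 (hd _ ((hR _ _).2 ⟨i, d, d', rfl, rfl, hd'⟩))
    · intro hd y hy
      obtain ⟨j, a, b, h3, rfl, h4⟩ := (hR _ y).1 hy
      cases h3
      exact (ih i b).2 (hd b h4)
  | atLeast n R C ih =>
    intro hs hO i d
    have e := h.successors (Set.subset_union_left.trans hs)
      (ih (Set.subset_union_right.trans hs) hO.2) i d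
    simp only [Interp.ext, Set.mem_ofPred_eq]
    rw [e, (inj i).encard_image]
  | atMost n R C ih =>
    intro hs hO i d
    have e := h.successors (Set.subset_union_left.trans hs)
      (ih (Set.subset_union_right.trans hs) hO.2) i d
    simp only [Interp.ext, Set.mem_ofPred_eq]
    rw [e, (inj i).encard_image]
  | self R => exact fun hs hO i d => h.roleExt_mk hs i d d
  | interval f l u => exact fun _ hO => hO.elim

/-- A disjoint union of models of the terminological part of a Horn knowledge base, one of which is
a model of the assertions too, is a model of the knowledge base. -/
theorem sat {O : KB} (h : IsUnion I J (PLSO.sig O)) (hO : IsHornSRIQ O)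
    (hT : ∀ i, ∀ α ∈ O, α.IsHornTBox → (I i).Sat α) {i₀ : ι} (h₀ : ∀ α ∈ O, (I i₀).Sat α)
    (hind : ∀ a, J.ind a = ⟨i₀, (I i₀).ind a⟩) {α : Axm} (hα : α ∈ O) : J.Sat α := by
  have hsig : α.sig ⊆ PLSO.sig O := Set.subset_biUnion_of_mem (u := fun α : Axm => α.sig) hα
  have hH := hO.2 α hα
  cases α with
  | gci C D =>
    rintro ⟨i, d⟩ hx
    exact (h.mem_ext D (Set.subset_union_right.trans hsig) hH.2.1 i d).2
      (hT i _ hα ⟨hH.2.2.1, hH.2.2.2⟩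
        ((h.mem_ext C (Set.subset_union_left.trans hsig) hH.1 i d).1 hx))
  | roleDisj R T =>
    rintro x y ⟨h1, h2⟩
    obtain ⟨i, d, d', rfl, rfl, h3⟩ := (h.roleExt (Set.subset_union_left.trans hsig) x y).1 h1
    exact hT i _ hα trivial d d'
      ⟨h3, (h.roleExt_mk (Set.subset_union_right.trans hsig) i d d').1 h2⟩
  | ria w R =>
    intro x y hxy
    obtain ⟨i, d, d', rfl, rfl, h3⟩ := h.exists_chainExt w (fun S hS =>
      (Set.subset_biUnion_of_mem (u := fun S : Role => S.sig) hS).trans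
        (Set.subset_union_left.trans hsig)) x y hxy
    exact (h.roleExt_mk (Set.subset_union_right.trans hsig) i d d').2 (hT i _ hα trivial d d' h3)
  -- Asserted concepts need not be Horn, so assertions are required only in the component `i₀`,
  -- where all individuals live.
  | conceptAssertion C a =>
    have := h₀ _ hα
    simp only [Interp.Sat] at this ⊢
    rw [hind]
    exact (h.mem_ext C (Set.subset_union_left.trans hsig) hH i₀ _).2 this
  | roleAssertion R a b =>
    have := h₀ _ hα
    simp only [Interp.Sat] at this ⊢
    rw [hind, hind]
    exact (h.roleExt_mk (Set.subset_union_left.trans hsig) i₀ _ _).2 this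
  | _ => exact hH.elim

end Interp.IsUnion

end union

/-! ## Evaluation of concepts in trees -/

/-- The concept holds at the node, where `L` tells which concept names hold at which nodes. -/
def SimplePL.HoldsAt (F : Facts) (L : Node → ℕ → Prop) : SimplePL → Node → Prop
  | .atom A => fun n => L n A
  | .bot => fun _ => False
  | .interval f l u => fun n => ∃ v, (n, f, v) ∈ F.2.2 ∧ l ≤ v ∧ v ≤ u
  | .ex r C => fun n => ∃ m, (n, r, m) ∈ F.1 ∧ C.HoldsAt F L m
  | .inter C D => fun n => C.HoldsAt F L n ∧ D.HoldsAt F L n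

theorem SimplePL.HoldsAt.mono {F F' : Facts} {L L' : Node → ℕ → Prop} (h1 : F.1 ⊆ F'.1)
    (h2 : F.2.2 ⊆ F'.2.2) (hL : ∀ n A, L n A → L' n A) (C : SimplePL) :
    ∀ n, C.HoldsAt F L n → C.HoldsAt F' L' n := by
  induction C with
  | atom A => exact fun n => hL n A
  | bot => exact fun _ h => h
  | interval f l u => exact fun n ⟨v, hv, h⟩ => ⟨v, h2 hv, h⟩
  | ex r C ih => exact fun n ⟨m, hm, h⟩ => ⟨m, h1 hm, ih m h⟩
  | inter C D ihC ihD => exact fun n h => ⟨ihC n h.1, ihD n h.2⟩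

/-- Prefix order read backwards is a postfix order: when an operator arrives, the extensions of its
arguments are on top of the stack, with the left conjunct above the right one. -/
theorem exists_foldl_evalStep (X : Orc) (K : List Tok) (F : Facts) (C : SimplePL) :
    ∀ s, ∃ L, C.toks.reverse.foldl (evalStep X K F) s = L :: s ∧
      ∀ n, n ∈ L ↔ C.HoldsAt F (fun n A => n ∈ nodes F ∧ holds X K F n A = true) n := by
  induction C with
  | atom A => exact fun s => ⟨_, rfl, fun n => List.mem_filter⟩
  | bot => exact fun s => ⟨_, rfl, fun n => List.mem_nil_iff _⟩
  | interval f l u =>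
    refine fun s => ⟨_, rfl, fun n => ?_⟩
    simp only [List.mem_map, List.mem_filter, Bool.and_eq_true, decide_eq_true_iff,
      SimplePL.HoldsAt]
    constructor
    · rintro ⟨⟨m, g, v⟩, ⟨h, rfl, h1, h2⟩, rfl⟩
      exact ⟨v, h, h1, h2⟩
    · rintro ⟨v, h, h1, h2⟩
      exact ⟨_, ⟨h, rfl, h1, h2⟩, rfl⟩
  | ex r C ih =>
    intro s
    obtain ⟨L, h1, h2⟩ := ih s
    have e : (SimplePL.ex r C).toks.reverse.foldl (evalStep X K F) s
        = evalStep X K F (L :: s) (3, r, 0, 0) := by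
      simp [SimplePL.toks, List.foldl_append, h1]
    refine ⟨_, e, fun n => ?_⟩
    simp only [List.headI, List.mem_map, List.mem_filter, Bool.and_eq_true, decide_eq_true_iff,
      List.any_eq_true, SimplePL.HoldsAt, ← h2]
    constructor
    · rintro ⟨⟨m, g, v⟩, ⟨h, rfl, x, h3, rfl⟩, rfl⟩
      exact ⟨_, h, h3⟩
    · rintro ⟨m, h, h3⟩
      exact ⟨_, ⟨h, rfl, m, h3, rfl⟩, rfl⟩
  | inter C D ihC ihD =>
    intro s
    obtain ⟨LD, h1, h2⟩ := ihD s
    obtain ⟨LC, h3, h4⟩ := ihC (LD :: s)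
    have e : (SimplePL.inter C D).toks.reverse.foldl (evalStep X K F) s
        = evalStep X K F (LC :: LD :: s) (4, 0, 0, 0) := by
      simp [SimplePL.toks, List.foldl_append, h1, h3]
    refine ⟨_, e, fun n => ?_⟩
    simp only [List.headI, List.tail, List.mem_filter, decide_eq_true_iff, List.any_eq_true,
      SimplePL.HoldsAt, ← h2, ← h4, exists_eq_right]

theorem satisfied_iff (X : Orc) (K : List Tok) (F : Facts) (C : SimplePL) :
    satisfied X K F C.toks.reverse = true ↔
      C.HoldsAt F (fun n A => n ∈ nodes F ∧ holds X K F n A = true) [] := by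
  obtain ⟨L, h1, h2⟩ := exists_foldl_evalStep X K F C []
  rw [satisfied, h1, ← h2]
  simp

/-! ## Trees that are obtained from models -/

section soundness

variable {Δ : Type} {I : Interp Δ} {rd : ℕ → ℕ} {K : List Tok}

/-- `h` maps the tree to the interpretation, where the values of concrete properties are
rounded. -/
structure Facts.IsHom (I : Interp Δ) (rd : ℕ → ℕ) (F : Facts) (h : Node → Δ) : Prop where
  edge : ∀ n r m, (n, r, m) ∈ F.1 → I.role r (h n) (h m)
  label : ∀ n A, (n, A) ∈ F.2.1 → h n ∈ I.conc A
  value : ∀ n f v, (n, f, v) ∈ F.2.2 → ∃ i, I.prop f (h n) i ∧ rd i = v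

/-- The nodes that occur in the facts differ from the next fresh node. -/
structure Facts.IsBounded (F : Facts) : Prop where
  edge : ∀ n r m, (n, r, m) ∈ F.1 → n.length ≤ F.1.length ∧ m.length ≤ F.1.length
  label : ∀ n A, (n, A) ∈ F.2.1 → n.length ≤ F.1.length
  value : ∀ n f v, (n, f, v) ∈ F.2.2 → n.length ≤ F.1.length

theorem Facts.IsHom.addLabel {F : Facts} {h : Node → Δ} (hF : F.IsHom I rd h) {n : Node} {A : ℕ}
    (hn : h n ∈ I.conc A) : Facts.IsHom I rd (F.1, (n, A) :: F.2.1, F.2.2) h := by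
  refine ⟨hF.edge, fun m B hm => ?_, hF.value⟩
  rcases List.mem_cons.1 hm with hm | hm
  · cases hm; exact hn
  · exact hF.label m B hm

theorem Facts.IsHom.addValue {F : Facts} {h : Node → Δ} (hF : F.IsHom I rd h) {n : Node} {f i : ℕ}
    (hn : I.prop f (h n) i) : Facts.IsHom I rd (F.1, F.2.1, (n, f, rd i) :: F.2.2) h := by
  refine ⟨hF.edge, hF.label, fun m g v hm => ?_⟩
  rcases List.mem_cons.1 hm with hm | hm
  · cases hm; exact ⟨i, hn, rfl⟩
  · exact hF.value m g v hm

theorem Facts.IsBounded.addLabel {F : Facts} (hF : F.IsBounded) {n : Node} {A : ℕ}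
    (hn : n.length ≤ F.1.length) : Facts.IsBounded (F.1, (n, A) :: F.2.1, F.2.2) := by
  refine ⟨hF.edge, fun m B hm => ?_, hF.value⟩
  rcases List.mem_cons.1 hm with hm | hm
  · cases hm; exact hn
  · exact hF.label m B hm

theorem Facts.IsBounded.addValue {F : Facts} (hF : F.IsBounded) {n : Node} {f v : ℕ}
    (hn : n.length ≤ F.1.length) : Facts.IsBounded (F.1, F.2.1, (n, f, v) :: F.2.2) := by
  refine ⟨hF.edge, hF.label, fun m g v hm => ?_⟩
  rcases List.mem_cons.1 hm with hm | hm
  · cases hm; exact hn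
  · exact hF.value m g v hm

theorem length_fresh (E : List (Node × ℕ × Node)) : (fresh E).length = E.length + 1 := by
  simp [fresh]

theorem Facts.IsBounded.addEdge {F : Facts} (hF : F.IsBounded) {n : Node} {r : ℕ}
    (hn : n.length ≤ F.1.length) :
    Facts.IsBounded ((n, r, fresh F.1) :: F.1, F.2.1, F.2.2) := by
  refine ⟨fun a s b hm => ?_, fun m B hm => (hF.label m B hm).trans (Nat.le_succ _),
    fun m g v hm => (hF.value m g v hm).trans (Nat.le_succ _)⟩
  rcases List.mem_cons.1 hm with hm | hm
  · cases hm
    exact ⟨hn.trans (Nat.le_succ _), (length_fresh F.1).le⟩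
  · exact ⟨(hF.edge a s b hm).1.trans (Nat.le_succ _), (hF.edge a s b hm).2.trans (Nat.le_succ _)⟩

open Classical in
-- The fresh node is longer than every node in the facts, so redefining `h` there affects no fact.
theorem Facts.IsHom.addEdge {F : Facts} {h : Node → Δ} (hF : F.IsHom I rd h) (hb : F.IsBounded)
    {n : Node} {r : ℕ} {y : Δ} (hn : n.length ≤ F.1.length) (hy : I.role r (h n) y) :
    ∃ h', Facts.IsHom I rd ((n, r, fresh F.1) :: F.1, F.2.1, F.2.2) h' ∧ h' (fresh F.1) = y ∧
      ∀ m, m.length ≤ F.1.length → h' m = h m := by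
  have hne : ∀ m : Node, m.length ≤ F.1.length → Function.update h (fresh F.1) y m = h m := by
    intro m hm
    refine Function.update_of_ne ?_ _ _
    rintro rfl
    rw [length_fresh] at hm
    omega
  have hy' : Function.update h (fresh F.1) y (fresh F.1) = y := Function.update_self _ _ _
  refine ⟨Function.update h (fresh F.1) y, ⟨fun a s b hm => ?_, fun m B hm => ?_,
    fun m g v hm => ?_⟩, hy', hne⟩
  · rcases List.mem_cons.1 hm with hm | hm
    · cases hm
      rw [hne n hn, hy']
      exact hy
    · rw [hne a (hb.edge a s b hm).1, hne b (hb.edge a s b hm).2]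
      exact hF.edge a s b hm
  · rw [hne m (hb.label m B hm)]
    exact hF.label m B hm
  · rw [hne m (hb.value m g v hm)]
    exact hF.value m g v hm

/-- If a concept holds at an element of a model of the functionality axioms, then the construction
succeeds for suitable values, and the tree maps to the model. -/
theorem exists_foldl_buildStep {P : List ℕ}
    (hK0 : ∀ r, hasAx K 0 r = true → I.Sat (.funcRole (.name r)))
    (hK1 : ∀ f, hasAx K 1 f = true → I.Sat (.funcProp f))
    (hP : ∀ i, rd i ∈ P) (hle : ∀ i, rd i ≤ i) (hrd : ∀ l ∈ P, ∀ i, l ≤ i → l ≤ rd i)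
    (C : SimplePL) :
    (∀ t ∈ C.toks, t.1 = 2 → t.2.2.1 ∈ P) → ∀ (F : Facts) (h : Node → Δ) (n : Node),
      F.IsHom I rd h → F.IsBounded → n.length ≤ F.1.length → h n ∈ I.ext C.toConcept →
      ∃ (ws : List ℕ) (F' : Facts) (h' : Node → Δ), ws.length = C.numIntervals ∧
        (∀ w ∈ ws, w ∈ P) ∧ F'.IsHom I rd h' ∧ F'.IsBounded ∧ F.1.length ≤ F'.1.length ∧
        (∀ m, m.length ≤ F.1.length → h' m = h m) ∧
        ∀ p t, C.toks.foldl (buildStep K) (n :: p, ws ++ t, true, F) = (p, t, true, F') := by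
  induction C with
  | atom A =>
    intro _ F h n hF hb hn hC
    exact ⟨[], (F.1, (n, A) :: F.2.1, F.2.2), h, rfl, by simp, hF.addLabel hC, hb.addLabel hn,
      le_rfl, fun _ _ => rfl, fun _ _ => rfl⟩
  | bot => exact fun _ F h n _ _ _ hC => hC.elim
  | interval f l u =>
    rintro hC F h n hF hb hn ⟨i, hl, hu, hi⟩
    refine ⟨[rd i], (F.1, F.2.1, (n, f, rd i) :: F.2.2), h, rfl, by simpa using hP i,
      hF.addValue hi, hb.addValue hn, le_rfl, fun _ _ => rfl, fun p t => ?_⟩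
    -- The value chosen is the rounding of the value `i` in the model. It stays at least `l`, since
    -- `l` is one of the points, and at most `u`, since rounding only decreases. For a functional
    -- property, an earlier value at this node is the rounding of the same `i`.
    have hok : valueOK K F.2.2 n (2, f, l, u) (rd i) = true := by
      have h1 : l ≤ rd i := hrd l (hC (2, f, l, u) (by simp [SimplePL.toks]) rfl) i hl
      have h2 : rd i ≤ u := (hle i).trans hu
      simp only [valueOK, h1, h2, decide_true, Bool.true_and, Bool.or_eq_true, List.all_eq_true,
        Bool.not_eq_true', Bool.and_eq_false_iff, decide_eq_false_iff_not, decide_eq_true_iff]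
      rcases hf : hasAx K 1 f with _ | _
      · exact .inl rfl
      · refine .inr ?_
        rintro ⟨m, g, v⟩ hm
        by_cases hmn : m = n
        · by_cases hgf : g = f
          · obtain ⟨j, hj, rfl⟩ := hF.value m g v hm
            subst hmn hgf
            rw [hK1 g hf _ i j hi hj]
            exact .inr rfl
          · exact .inl (.inr hgf)
        · exact .inl (.inl hmn)
    change (p, t, true && valueOK K F.2.2 n (2, f, l, u) (rd i), F.1, F.2.1,
      (n, f, rd i) :: F.2.2) = _
    rw [hok, Bool.and_self]
  | ex r C ih =>
    rintro hC F h n hF hb hn ⟨y, hy, hyC⟩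
    have hC' : ∀ t ∈ C.toks, t.1 = 2 → t.2.2.1 ∈ P := fun t ht => hC t (List.mem_cons_of_mem _ ht)
    by_cases hc : (hasAx K 0 r && !(edgesFrom F.1 n r).isEmpty) = true
    · have hne : edgesFrom F.1 n r ≠ [] := by
        intro h0; rw [h0] at hc; simp at hc
      rw [Bool.and_eq_true] at hc
      obtain ⟨⟨a, s, m⟩, E, hE⟩ := List.exists_cons_of_ne_nil hne
      have hm : (a, s, m) ∈ edgesFrom F.1 n r := hE ▸ List.mem_cons_self
      simp only [edgesFrom, List.mem_filter, Bool.and_eq_true, decide_eq_true_iff] at hm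
      obtain ⟨hm, rfl, rfl⟩ := hm
      -- By functionality in the model, the reused successor is mapped to the given witness `y`.
      have hmy : h m = y := hK0 s hc.1 (h a) _ _ (hF.edge a s m hm) hy
      obtain ⟨ws, F', h', h1, h2, h3, h4, h5, h6, h7⟩ :=
        ih hC' F h m hF hb (hb.edge a s m hm).2 (hmy ▸ hyC)
      refine ⟨ws, F', h', h1, h2, h3, h4, h5, h6, fun p t => ?_⟩
      rw [← h7 p t, SimplePL.toks, List.foldl_cons]
      congr 1
      simp [buildStep, hc.1, hE]
    · obtain ⟨h₁, hh, hfy, hag⟩ := hF.addEdge hb hn hy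
      obtain ⟨ws, F', h', h1, h2, h3, h4, h5, h6, h7⟩ :=
        ih hC' _ h₁ (fresh F.1) hh (hb.addEdge hn) (length_fresh F.1).le (hfy ▸ hyC)
      have h8 : F.1.length + 1 ≤ F'.1.length := h5
      refine ⟨ws, F', h', h1, h2, h3, h4, by omega, fun m hm => ?_, fun p t => ?_⟩
      · rw [h6 m (hm.trans (Nat.le_succ _)), hag m hm]
      · rw [← h7 p t, SimplePL.toks, List.foldl_cons]
        congr 1
        simp [buildStep, hc]
  | inter C D ihC ihD =>
    rintro hCD F h n hF hb hn ⟨hC, hD⟩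
    obtain ⟨ws, F', h', h1, h2, h3, h4, h5, h6, h7⟩ := ihC
      (fun t ht => hCD t (List.mem_cons_of_mem _ (List.mem_append_left _ ht))) F h n hF hb hn hC
    obtain ⟨ws', F'', h'', h1', h2', h3', h4', h5', h6', h7'⟩ := ihD
      (fun t ht => hCD t (List.mem_cons_of_mem _ (List.mem_append_right _ ht))) F' h' n h3 h4
      (hn.trans h5) (by rw [h6 n hn]; exact hD)
    refine ⟨ws ++ ws', F'', h'', by rw [List.length_append, h1, h1']; rfl, ?_, h3', h4',
      h5.trans h5', fun m hm => ?_, fun p t => ?_⟩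
    · intro w hw
      rcases List.mem_append.1 hw with hw | hw
      exacts [h2 w hw, h2' w hw]
    · rw [h6' m (hm.trans h5), h6 m hm]
    · rw [SimplePL.toks, List.foldl_cons, List.foldl_append, List.append_assoc]
      have e : buildStep K (n :: p, ws ++ (ws' ++ t), true, F) (4, 0, 0, 0)
          = (n :: n :: p, ws ++ (ws' ++ t), true, F) := rfl
      rw [e, h7, h7']

/-- Constraints of the right side pass from the rounded value to the original `i`: the lower bound
because rounding decreases, and the upper bound because `i > u` would give `rd i ≥ u + 1`, as `u +
1` is one of the points. -/
theorem SimplePL.HoldsAt.mem_ext {P : List ℕ} {F : Facts} {h : Node → Δ} {L : Node → ℕ → Prop}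
    (hF : F.IsHom I rd h) (hL : ∀ n A, L n A → h n ∈ I.conc A) (hle : ∀ i, rd i ≤ i)
    (hrd : ∀ l ∈ P, ∀ i, l ≤ i → l ≤ rd i) (D : SimplePL) :
    (∀ t ∈ D.toks, t.1 = 2 → t.2.2.2 + 1 ∈ P) → ∀ n, D.HoldsAt F L n → h n ∈ I.ext D.toConcept := by
  induction D with
  | atom A => exact fun _ n hn => hL n A hn
  | bot => exact fun _ n hn => hn
  | interval f l u =>
    rintro hD n ⟨v, hv, h1, h2⟩
    obtain ⟨i, hi, rfl⟩ := hF.value n f v hv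
    refine ⟨i, h1.trans (hle i), ?_, hi⟩
    by_contra hn
    have := hrd (u + 1) (hD (2, f, l, u) (by simp [SimplePL.toks]) rfl) i (by omega)
    omega
  | ex r C ih =>
    rintro hD n ⟨m, hm, hC⟩
    exact ⟨h m, hF.edge n r m hm, ih (fun t ht => hD t (List.mem_cons_of_mem _ ht)) m hC⟩
  | inter C D ihC ihD =>
    rintro hCD n ⟨hC, hD⟩
    exact ⟨ihC (fun t ht => hCD t (List.mem_cons_of_mem _ (List.mem_append_left _ ht))) n hC,
      ihD (fun t ht => hCD t (List.mem_cons_of_mem _ (List.mem_append_right _ ht))) n hD⟩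

end soundness

/-- Every number can be rounded to a smaller element of a list that contains zero. -/
theorem exists_round {P : List ℕ} (h0 : 0 ∈ P) : ∃ rd : ℕ → ℕ, (∀ i, rd i ∈ P) ∧
    (∀ i, rd i ≤ i) ∧ ∀ l ∈ P, ∀ i, l ≤ i → l ≤ rd i :=
  ⟨fun i => Nat.findGreatest (· ∈ P) i, fun i => Nat.findGreatest_spec (Nat.zero_le i) h0,
    fun i => Nat.findGreatest_le i, fun _ hl _ hi => Nat.le_findGreatest hi hl⟩

theorem subset_sig {O : KB} {α : Axm} (h : α ∈ O) : α.sig ⊆ sig O :=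
  Set.subset_biUnion_of_mem (u := fun α : Axm => α.sig) h

theorem mem_oPlus_iff {π : Triple} {α : Axm} : α ∈ π.oPlus ↔
    α ∈ π.O ∨ ∃ β ∈ π.K, β.isShifted = true ∧ β.toAxm = α := by
  simp [Triple.oPlus, and_assoc]

/-- `A ⊑ A` is a tautology, so the oracle's answer to it reveals precisely whether `A` belongs to
the signature. -/
theorem mem_known_iff {O : KB} {K : List Tok} {F : Facts} {n : Node} {A : ℕ} :
    A ∈ known (OracleQuery.encode '' pos O) K F n ↔ A ∈ lab K F n ∧ Symb.concept A ∈ sig O := by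
  rw [known, List.mem_filter, askQuery_iff]
  refine and_congr_right fun _ => ⟨fun h => h.1 A (by simp), fun h => ⟨by simpa using h, ?_⟩⟩
  intro Δ _ I _
  rw [sat_toAxm_iff]
  exact fun x hx => ⟨A, by simp, hx A (by simp)⟩

/-! ## Soundness -/

theorem mem_points_lhs {lhs rhs : List (List Tok)} {C : List Tok} (hC : C ∈ lhs) {t : Tok}
    (ht : t ∈ C) (h : t.1 = 2) : t.2.2.1 ∈ points lhs rhs := by
  refine List.mem_append_left _ (List.mem_cons_of_mem _ (List.mem_flatMap.2 ⟨C, hC,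
    List.mem_flatMap.2 ⟨t, ht, ?_⟩⟩))
  simp [h]

theorem mem_points_rhs {lhs rhs : List (List Tok)} {D : List Tok} (hD : D ∈ rhs) {t : Tok}
    (ht : t ∈ D) (h : t.1 = 2) : t.2.2.2 + 1 ∈ points lhs rhs := by
  refine List.mem_append_right _ (List.mem_flatMap.2 ⟨D, hD, List.mem_flatMap.2 ⟨t, ht, ?_⟩⟩)
  simp [h]

theorem FullPL.mem_toks {C : FullPL} {l : List Tok} :
    l ∈ C.toks ↔ ∃ D ∈ C.disjuncts, D.toks.reverse = l := by
  simp [FullPL.toks]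

theorem FullPL.mem_ext {Δ : Type} {I : Interp Δ} {C : FullPL} {x : Δ} :
    x ∈ I.ext C.toConcept ↔ ∃ D ∈ C.disjuncts, x ∈ I.ext D.toConcept := by
  simp [FullPL.toConcept, mem_ext_unionList]

/-- Given a model and an instance `x` of the left side, the tree is read off the model with rounded
values. It is among the trees that the procedure inspects, and it passes the tests because it maps
to a model. Hence some disjunct of the right side holds at its root, and the homomorphism carries
this disjunct to `x`. -/
theorem entails_of_decideToks {c : ℕ} {π : Triple} (hc : ∀ C ∈ π.lhs.disjuncts, C.numIntervals ≤ c)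
    (h : decideToks c (OracleQuery.encode '' pos π.oPlus) π.toks π.lhs.toks π.rhs.toks = true) :
    Entails (π.mainKB ++ π.O) π.query := by
  intro Δ _ I hI x hx
  have hK : ∀ α ∈ π.K, I.Sat α.toAxm := fun α hα =>
    hI _ (List.mem_append_left _ (List.mem_map_of_mem hα))
  have hO : ∀ α ∈ π.oPlus, I.Sat α := by
    intro α hα
    rcases mem_oPlus_iff.1 hα with hα | ⟨β, hβ, -, rfl⟩
    exacts [hI α (List.mem_append_right _ hα), hK β hβ]
  obtain ⟨C, hC, hxC⟩ := FullPL.mem_ext.1 hx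
  have hCt : C.toks.reverse ∈ π.lhs.toks := FullPL.mem_toks.2 ⟨C, hC, rfl⟩
  have h0 : 0 ∈ points π.lhs.toks π.rhs.toks := List.mem_append_left _ List.mem_cons_self
  obtain ⟨rd, hP, hle, hrd⟩ := exists_round h0
  obtain ⟨ws, F, g, h1, h2, h3, -, -, h6, h7⟩ := exists_foldl_buildStep (K := π.toks) (I := I)
    (fun r hr => hK _ ((hasAx_zero π.K r).1 hr)) (fun f hf => hK _ ((hasAx_one π.K f).1 hf))
    hP hle hrd C (fun t ht => mem_points_lhs hCt (List.mem_reverse.2 ht)) ([], [], [])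
    (fun _ => x) [] ⟨by simp, by simp, by simp⟩ ⟨by simp, by simp, by simp⟩ le_rfl hxC
  have hroot : g [] = x := h6 [] le_rfl
  have hlab : ∀ n A, A ∈ lab π.toks F n → g n ∈ I.conc A := by
    intro n A hA
    rcases (mem_lab_iff π.K F n A).1 hA with hA | ⟨r, m, hr, he⟩ | ⟨r, m, hr, he⟩
    · exact h3.label n A hA
    · exact hK _ hr (g m) (g n) (h3.edge m r n he)
    · exact hK _ hr (g m) (g n) (h3.edge n r m he)
  have hask : ∀ n r, askQuery (OracleQuery.encode '' pos π.oPlus)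
      (known (OracleQuery.encode '' pos π.oPlus) π.toks F n) r = true → ∃ A ∈ r, g n ∈ I.conc A := by
    intro n r hr
    exact (sat_toAxm_iff I _ _).1 (((askQuery_iff _ _ _).1 hr).2 Δ I hO) (g n) fun A hA =>
      hlab n A (mem_known_iff.1 hA).1
  have hb : build π.toks C.toks (ws ++ List.replicate (c - ws.length) 0)
      = ([], List.replicate (c - ws.length) 0, true, F) := h7 [] _
  -- The construction consumes only `ws`; zeros, which are points, fill the tuple up to length `c`.
  have hvs : ws ++ List.replicate (c - ws.length) 0 ∈
      tuples (points π.lhs.toks π.rhs.toks) c := by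
    rw [mem_tuples]
    constructor
    · have := hc C hC
      rw [List.length_append, List.length_replicate]
      omega
    · intro p hp
      rcases List.mem_append.1 hp with hp | hp
      · exact h2 p hp
      · rw [List.eq_of_mem_replicate hp]; exact h0
  have hC' := List.all_eq_true.1 (List.all_eq_true.1 h _ hCt) _ hvs
  rw [List.reverse_reverse, hb, Bool.or_eq_true] at hC'
  rcases hC' with hC' | hC'
  · exfalso
    -- The names at a node hold together at its image in the model, so the oracle cannot refute
    -- them.
    have hv : valid (OracleQuery.encode '' pos π.oPlus) π.toks
        ([], List.replicate (c - ws.length) 0, true, F) = true := by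
      rw [valid, Bool.true_and, List.all_eq_true]
      intro n _
      by_contra hn
      obtain ⟨A, hA, -⟩ := hask n [] (by simpa using hn)
      simp at hA
    simp [hv] at hC'
  · obtain ⟨Dt, hDt, hsat⟩ := List.any_eq_true.1 hC'
    obtain ⟨D, hD, rfl⟩ := FullPL.mem_toks.1 hDt
    refine FullPL.mem_ext.2 ⟨D, hD, ?_⟩
    rw [← hroot]
    refine SimplePL.HoldsAt.mem_ext h3 ?_ hle hrd D
      (fun t ht => mem_points_rhs hDt (List.mem_reverse.2 ht)) [] ((satisfied_iff _ _ _ _).1 hsat)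
    rintro n A ⟨-, hA⟩
    rw [holds, Bool.or_eq_true] at hA
    rcases hA with hA | hA
    · obtain ⟨B, hB, hBA⟩ := List.any_eq_true.1 hA
      rw [decide_eq_true_iff] at hBA
      exact hlab n A (hBA ▸ hB)
    · obtain ⟨B, hB, hn⟩ := hask n [A] hA
      rwa [List.mem_singleton.1 hB] at hn

/-! ## Completeness -/

/-- The facts respect the functionality axioms, unless there was a clash. -/
structure Facts.IsFunctional (K : List Tok) (ok : Bool) (F : Facts) : Prop where
  edge : ∀ n r m m', hasAx K 0 r = true → (n, r, m) ∈ F.1 → (n, r, m') ∈ F.1 → m = m'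
  value : ok = true → ∀ n f v v', hasAx K 1 f = true → (n, f, v) ∈ F.2.2 → (n, f, v') ∈ F.2.2 →
    v = v'

/-- Facts are only ever added, so what has been achieved for one conjunct survives the construction
for the other. A clash does not stop the construction, and therefore the statements about values
depend on the flag. -/
theorem foldl_buildStep_spec (K : List Tok) (C : SimplePL) :
    ∀ (n : Node) (p : List Node) (ws : List ℕ) (ok : Bool) (F : Facts), F.IsFunctional K ok →
      ∃ (ws' : List ℕ) (ok' : Bool) (F' : Facts),
        C.toks.foldl (buildStep K) (n :: p, ws, ok, F) = (p, ws', ok', F') ∧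
        (ok' = true → ok = true) ∧ F.1 ⊆ F'.1 ∧ F.2.1 ⊆ F'.2.1 ∧ F.2.2 ⊆ F'.2.2 ∧
        F'.IsFunctional K ok' ∧ (ok' = true → C.HoldsAt F' (fun n A => (n, A) ∈ F'.2.1) n) := by
  induction C with
  | atom A =>
    exact fun n p ws ok F hF => ⟨ws, ok, (F.1, (n, A) :: F.2.1, F.2.2), rfl, id, List.Subset.refl _,
      List.subset_cons_self _ _, List.Subset.refl _, ⟨hF.edge, hF.value⟩,
      fun _ => List.mem_cons_self⟩
  | bot =>
    exact fun n p ws ok F hF => ⟨ws, false, F, rfl, by simp, List.Subset.refl _,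
      List.Subset.refl _, List.Subset.refl _, ⟨hF.edge, by simp⟩, by simp⟩
  | interval f l u =>
    intro n p ws ok F hF
    have hok : ∀ {v : ℕ}, valueOK K F.2.2 n (2, f, l, u) v = true → (l ≤ v ∧ v ≤ u) ∧
        (hasAx K 1 f = true → ∀ v', (n, f, v') ∈ F.2.2 → v' = v) := by
      intro v hv
      simp only [valueOK, Bool.and_eq_true, decide_eq_true_iff, Bool.or_eq_true, List.all_eq_true,
        Bool.not_eq_true', Bool.and_eq_false_iff, decide_eq_false_iff_not] at hv
      refine ⟨hv.1, fun hf v' hv' => ?_⟩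
      have := (hv.2.resolve_left (by simp [hf])) _ hv'
      simpa using this
    refine ⟨ws.tail, ok && valueOK K F.2.2 n (2, f, l, u) ws.headI,
      (F.1, F.2.1, (n, f, ws.headI) :: F.2.2), rfl, ?_, List.Subset.refl _, List.Subset.refl _,
      List.subset_cons_self _ _, ⟨hF.edge, ?_⟩, ?_⟩
    · intro h; exact (Bool.and_eq_true _ _ ▸ h).1
    · intro h m g v v' hg hv hv'
      rw [Bool.and_eq_true] at h
      have h2 := (hok h.2).2
      rcases List.mem_cons.1 hv with hv | hv <;> rcases List.mem_cons.1 hv' with hv' | hv'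
      · cases hv; cases hv'; rfl
      · cases hv; exact (h2 hg v' hv').symm
      · cases hv'; exact h2 hg v hv
      · exact hF.value h.1 m g v v' hg hv hv'
    · intro h
      rw [Bool.and_eq_true] at h
      exact ⟨ws.headI, List.mem_cons_self, (hok h.2).1⟩
  | ex r C ih =>
    intro n p ws ok F hF
    by_cases hc : (hasAx K 0 r && !(edgesFrom F.1 n r).isEmpty) = true
    · have hne : edgesFrom F.1 n r ≠ [] := by
        intro h0; rw [h0] at hc; simp at hc
      rw [Bool.and_eq_true] at hc
      obtain ⟨⟨a, s, m⟩, E, hE⟩ := List.exists_cons_of_ne_nil hne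
      have hm : (a, s, m) ∈ edgesFrom F.1 n r := hE ▸ List.mem_cons_self
      simp only [edgesFrom, List.mem_filter, Bool.and_eq_true, decide_eq_true_iff] at hm
      obtain ⟨hm, rfl, rfl⟩ := hm
      obtain ⟨ws', ok', F', h1, h2, h3, h4, h5, h6, h7⟩ := ih m p ws ok F hF
      refine ⟨ws', ok', F', ?_, h2, h3, h4, h5, h6, fun h => ⟨m, h3 hm, h7 h⟩⟩
      rw [← h1, SimplePL.toks, List.foldl_cons]
      congr 1
      simp [buildStep, hc.1, hE]
    · have hF1 : Facts.IsFunctional K ok ((n, r, fresh F.1) :: F.1, F.2.1, F.2.2) := by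
        refine ⟨fun a s m m' hs hm hm' => ?_, hF.value⟩
        -- In this case of the construction, a functional role has no edge from `n` yet.
        have key : ∀ m, hasAx K 0 r = true → (n, r, m) ∉ F.1 := by
          intro m hr hm
          have : (n, r, m) ∈ edgesFrom F.1 n r := by simp [edgesFrom, hm]
          refine hc ?_
          rw [hr, Bool.true_and]
          cases he : edgesFrom F.1 n r with
          | nil => simp [he] at this
          | cons => rfl
        rcases List.mem_cons.1 hm with hm | hm <;> rcases List.mem_cons.1 hm' with hm' | hm'
        · cases hm; cases hm'; rfl
        · cases hm; exact (key m' hs hm').elim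
        · cases hm'; exact (key m hs hm).elim
        · exact hF.edge a s m m' hs hm hm'
      obtain ⟨ws', ok', F', h1, h2, h3, h4, h5, h6, h7⟩ := ih (fresh F.1) p ws ok _ hF1
      refine ⟨ws', ok', F', ?_, h2, List.Subset.trans (List.subset_cons_self _ _) h3, h4, h5, h6,
        fun h => ⟨fresh F.1, h3 List.mem_cons_self, h7 h⟩⟩
      rw [← h1, SimplePL.toks, List.foldl_cons]
      congr 1
      simp [buildStep, hc]
  | inter C D ihC ihD =>
    intro n p ws ok F hF
    obtain ⟨ws', ok', F', h1, h2, h3, h4, h5, h6, h7⟩ := ihC n (n :: p) ws ok F hF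
    obtain ⟨ws'', ok'', F'', g1, g2, g3, g4, g5, g6, g7⟩ := ihD n p ws' ok' F' h6
    refine ⟨ws'', ok'', F'', ?_, fun h => h2 (g2 h), List.Subset.trans h3 g3,
      List.Subset.trans h4 g4, List.Subset.trans h5 g5, g6,
      fun h => ⟨SimplePL.HoldsAt.mono g3 g5 (fun _ _ h => g4 h) C n (h7 (g2 h)), g7 h⟩⟩
    rw [← g1, ← h1, SimplePL.toks, List.foldl_cons, List.foldl_append]
    rfl

section tree

variable {F : Facts} {Δ : Option {n // n ∈ nodes F} → Type}

/-- The disjoint union of interpretations, with a tree on top of it whose nodes are among the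
elements. The interpretations determine the symbols in `S`, the tree determines the other
symbols. -/
def Facts.interp (F : Facts) {Δ : Option {n // n ∈ nodes F} → Type} (S : Set Symb)
    (L : Node → ℕ → Prop) (I : ∀ o, Interp (Δ o)) (e : ∀ n, Δ (some n)) : Interp (Σ o, Δ o) where
  conc A := {x | (Symb.concept A ∈ S ∧ x.2 ∈ (I x.1).conc A) ∨
    (Symb.concept A ∉ S ∧ ∃ n, x = ⟨some n, e n⟩ ∧ L n A)}
  role r x y := (Symb.role r ∈ S ∧ ∃ i d d', x = ⟨i, d⟩ ∧ y = ⟨i, d'⟩ ∧ (I i).role r d d') ∨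
    (Symb.role r ∉ S ∧ ∃ n m, x = ⟨some n, e n⟩ ∧ y = ⟨some m, e m⟩ ∧ (n.1, r, m.1) ∈ F.1)
  ind a := ⟨none, (I none).ind a⟩
  prop f x i := ∃ n, x = ⟨some n, e n⟩ ∧ (n.1, f, i) ∈ F.2.2

variable {S : Set Symb} {L : Node → ℕ → Prop} {I : ∀ o, Interp (Δ o)} {e : ∀ n, Δ (some n)}

theorem Facts.isUnion_interp : Interp.IsUnion I (F.interp S L I e) S where
  conc A hA i d := by
    constructor
    · rintro (h | h)
      exacts [h.2, (h.1 hA).elim]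
    · exact fun h => .inl ⟨hA, h⟩
  role r hr x y := by
    constructor
    · rintro (h | h)
      exacts [h.2, (h.1 hr).elim]
    · exact fun h => .inl ⟨hr, h⟩

theorem node_injective {n m : {n // n ∈ nodes F}}
    (h : (⟨some n, e n⟩ : Σ o, Δ o) = ⟨some m, e m⟩) : n = m :=
  Option.some_injective _ (congrArg Sigma.fst h)

theorem Facts.interp_role {r : ℕ} (hr : Symb.role r ∉ S) {x y : Σ o, Δ o} :
    (F.interp S L I e).role r x y ↔
      ∃ n m, x = ⟨some n, e n⟩ ∧ y = ⟨some m, e m⟩ ∧ (n.1, r, m.1) ∈ F.1 := by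
  constructor
  · rintro (h | h)
    exacts [(hr h.1).elim, h.2]
  · exact fun h => .inr ⟨hr, h⟩

theorem target_mem_nodes {n m : Node} {r : ℕ} (h : (n, r, m) ∈ F.1) : m ∈ nodes F :=
  List.mem_cons_of_mem _ (List.mem_map_of_mem (f := fun e : Node × ℕ × Node => e.2.2) h)

/-- Two labellings enclose the true extensions of names at the tree nodes: the lower one shows that
`C` holds, the upper one that the right side fails. Roles of the concept lie outside `S`, so edges
in the interpretation are precisely those of the tree. -/
theorem Facts.mem_ext_interp {L₁ L₂ : Node → ℕ → Prop}
    (h₁ : ∀ n A, L₁ n.1 A → (⟨some n, e n⟩ : Σ o, Δ o) ∈ (F.interp S L I e).conc A)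
    (h₂ : ∀ n A, (⟨some n, e n⟩ : Σ o, Δ o) ∈ (F.interp S L I e).conc A → L₂ n.1 A)
    (C : SimplePL) : (∀ r, Symb.role r ∈ C.toConcept.sig → Symb.role r ∉ S) →
      ∀ n, (C.HoldsAt F L₁ n.1 →
          (⟨some n, e n⟩ : Σ o, Δ o) ∈ (F.interp S L I e).ext C.toConcept) ∧
        ((⟨some n, e n⟩ : Σ o, Δ o) ∈ (F.interp S L I e).ext C.toConcept →
          C.HoldsAt F L₂ n.1) := by
  induction C with
  | atom A => exact fun _ n => ⟨h₁ n A, h₂ n A⟩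
  | bot => exact fun _ n => ⟨fun h => h.elim, fun h => h.elim⟩
  | interval f l u =>
    refine fun _ n => ⟨fun ⟨v, hv, hl, hu⟩ => ⟨v, hl, hu, n, rfl, hv⟩, ?_⟩
    rintro ⟨v, hl, hu, m, hm, hv⟩
    obtain rfl := node_injective hm
    exact ⟨v, hv, hl, hu⟩
  | ex r C ih =>
    intro hs n
    have hr : Symb.role r ∉ S := hs r (Or.inl rfl)
    have ih := ih fun s hs' => hs s (Or.inr hs')
    constructor
    · rintro ⟨m, hm, hC⟩
      have hmn := target_mem_nodes hm
      exact ⟨⟨some ⟨m, hmn⟩, e ⟨m, hmn⟩⟩,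
        (Facts.interp_role hr).2 ⟨n, ⟨m, hmn⟩, rfl, rfl, hm⟩, (ih ⟨m, hmn⟩).1 hC⟩
    · rintro ⟨y, hy, hC⟩
      obtain ⟨n', m, hn, rfl, hm⟩ := (Facts.interp_role hr).1 hy
      obtain rfl := node_injective hn
      exact ⟨m.1, hm, (ih m).2 hC⟩
  | inter C D ihC ihD =>
    intro hs n
    have ihC := ihC (fun s hs' => hs s (Or.inl hs')) n
    have ihD := ihD (fun s hs' => hs s (Or.inr hs')) n
    exact ⟨fun h => ⟨ihC.1 h.1, ihD.1 h.2⟩, fun h => ⟨ihC.2 h.1, ihD.2 h.2⟩⟩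

end tree

/-- `O` shares only concept names with the rest of the instance, and the axioms moved to it contain
no roles. -/
theorem role_notMem_sig_oPlus {π : Triple} (hπ : IsPLSO π) {r : ℕ}
    (hr : Symb.role r ∈ sig π.mainKB ∪ π.query.sig) : Symb.role r ∉ sig π.oPlus := by
  intro h
  obtain ⟨α, hα, h⟩ := Set.mem_iUnion₂.1 h
  rcases mem_oPlus_iff.1 hα with hα | ⟨β, -, hs, rfl⟩
  · obtain ⟨A, hA⟩ := hπ.2 ⟨hr, subset_sig hα h⟩
    cases hA
  · cases β <;> simp [PLAxiom.isShifted, PLAxiom.toAxm, Axm.sig, Concept.sig] at hs h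

theorem role_mem_sig_mainKB {π : Triple} {α : PLAxiom} (hα : α ∈ π.K) {r : ℕ}
    (hr : Symb.role r ∈ α.toAxm.sig) : Symb.role r ∈ sig π.mainKB ∪ π.query.sig :=
  .inl (subset_sig (List.mem_map_of_mem hα) hr)

theorem SimplePL.sig_subset {C : SimplePL} {D : FullPL} (hC : C ∈ D.disjuncts) :
    C.toConcept.sig ⊆ D.toConcept.sig := by
  have key : ∀ l : List SimplePL, C ∈ l →
      C.toConcept.sig ⊆ (unionList (l.map SimplePL.toConcept)).sig := by
    intro l
    induction l with
    | nil => simp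
    | cons B l ih =>
      intro h
      rcases List.mem_cons.1 h with rfl | h
      · exact Set.subset_union_left
      · exact (ih h).trans Set.subset_union_right
  exact key _ hC

/-- The countermodel is the disjoint union of one model for each node and one for the individuals.
In the model of a node, the node is identified with an element of exact type, and the edges and
values of the tree connect these elements. -/
theorem not_entails_of_valid {π : Triple} (hπ : IsPLSO π) {C : SimplePL}
    (hC : C ∈ π.lhs.disjuncts) {vs : List ℕ}
    (hv : valid (OracleQuery.encode '' pos π.oPlus) π.toks (build π.toks C.toks vs) = true)
    (hD : ∀ D ∈ π.rhs.disjuncts, satisfied (OracleQuery.encode '' pos π.oPlus) π.toks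
      (build π.toks C.toks vs).2.2.2 D.toks.reverse = false) :
    ¬ Entails (π.mainKB ++ π.O) π.query := by
  set X : Orc := OracleQuery.encode '' pos π.oPlus with hX
  obtain ⟨ws, ok, F, h1, -, -, -, -, hF, hF'⟩ := foldl_buildStep_spec π.toks C [] [] vs true
    ([], [], []) ⟨by simp, by simp⟩
  have hb : build π.toks C.toks vs = ([], ws, ok, F) := h1
  rw [hb] at hv hD
  rw [valid, Bool.and_eq_true, List.all_eq_true] at hv
  obtain ⟨rfl, hv⟩ := hv
  -- A negative answer could be due to a foreign name. The names in the query are known to the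
  -- oracle, so here it means that the inclusion is not entailed.
  have hne : ∀ n ∈ nodes F,
      ¬ Entails π.oPlus (OracleQuery.toAxm ⟨known X π.toks F n, []⟩) := by
    intro n hn he
    have h2 := hv n hn
    rw [Bool.not_eq_true'] at h2
    refine Bool.eq_false_iff.1 h2 ((askQuery_iff _ _ _).2 ⟨fun A hA => ?_, he⟩)
    exact (mem_known_iff.1 (by simpa using hA)).2
  have hroot : [] ∈ nodes F := List.mem_cons_self
  -- The component `none` satisfies all of `O⁺`, including assertions, and exists because
  -- consistency of the names at the root gives a model. The other components need only the
  -- terminological axioms, which products preserve.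
  have hI : ∀ o : Option {n // n ∈ nodes F}, ∃ (Δ : Type) (I : Interp Δ),
      (∀ α ∈ π.oPlus, α.IsHornTBox → I.Sat α) ∧ (o = none → ∀ α ∈ π.oPlus, I.Sat α) ∧
      ∀ n, o = some n → ∃ e, (∀ A ∈ known X π.toks F n.1, e ∈ I.conc A) ∧
        ∀ A, e ∈ I.conc A → Entails π.oPlus (OracleQuery.toAxm ⟨known X π.toks F n.1, [A]⟩) := by
    rintro (_ | n)
    · have h2 := hne [] hroot
      rw [Entails] at h2
      push Not at h2
      obtain ⟨Δ, _, I, hI, -⟩ := h2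
      exact ⟨Δ, I, fun α hα _ => hI α hα, fun _ => hI, by simp⟩
    · obtain ⟨Δ, I, e, h2, h3, h4⟩ := exists_exact_type (hne n.1 n.2)
      refine ⟨Δ, I, h2, by simp, ?_⟩
      rintro _ ⟨⟩
      exact ⟨e, h3, h4⟩
  choose Δ I hT h0 hn using hI
  choose e he₁ he₂ using fun n => hn (some n) n rfl
  let J := F.interp (sig π.oPlus) (fun n A => A ∈ lab π.toks F n) I e
  have hU : Interp.IsUnion I J (sig π.oPlus) := Facts.isUnion_interp
  have hsub : sig π.O ⊆ sig π.oPlus :=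
    Set.biUnion_subset_biUnion_left fun α hα => mem_oPlus_iff.2 (.inl hα)
  have hU' : Interp.IsUnion I J (sig π.O) :=
    ⟨fun A hA => hU.conc A (hsub hA), fun r hr => hU.role r (hsub hr)⟩
  have hlab : ∀ n A, A ∈ lab π.toks F n.1 → (⟨some n, e n⟩ : Σ o, Δ o) ∈ J.conc A := by
    intro n A hA
    by_cases hs : Symb.concept A ∈ sig π.oPlus
    · exact .inl ⟨hs, he₁ n A (mem_known_iff.2 ⟨hA, hs⟩)⟩
    · exact .inr ⟨hs, n, rfl, hA⟩
  -- Inside the signature of `O⁺`, exactness of the type makes the inclusion of `A` an entailed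
  -- query; outside, `A` can only come from the labels.
  have hholds : ∀ n A, (⟨some n, e n⟩ : Σ o, Δ o) ∈ J.conc A →
      n.1 ∈ nodes F ∧ holds X π.toks F n.1 A = true := by
    intro n A hA
    refine ⟨n.2, ?_⟩
    rw [holds, Bool.or_eq_true]
    rcases hA with ⟨hs, hA⟩ | ⟨-, m, hm, hA⟩
    · refine .inr ((askQuery_iff _ _ _).2 ⟨fun B hB => ?_, he₂ n A hA⟩)
      rcases List.mem_append.1 hB with hB | hB
      · exact (mem_known_iff.1 hB).2
      · rw [List.mem_singleton.1 hB]; exact hs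
    · obtain rfl := node_injective hm
      exact .inl (List.any_eq_true.2 ⟨A, hA, by simp⟩)
  have hO : ∀ α ∈ π.O, J.Sat α := fun α hα =>
    hU'.sat hπ.1 (fun i β hβ => hT i β (mem_oPlus_iff.2 (.inl hβ)))
      (fun β hβ => h0 none rfl β (mem_oPlus_iff.2 (.inl hβ))) (fun _ => rfl) hα
  have hK : ∀ α ∈ π.K, J.Sat α.toAxm := by
    intro α hα
    have hr : ∀ r, Symb.role r ∈ α.toAxm.sig → Symb.role r ∉ sig π.oPlus := fun r hr =>
      role_notMem_sig_oPlus hπ (role_mem_sig_mainKB hα hr)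
    cases α with
    | funcRole r =>
      intro x y z hy hz
      obtain ⟨n, m, rfl, rfl, h2⟩ := (Facts.interp_role (hr r rfl)).1 hy
      obtain ⟨n', m', h3, rfl, h4⟩ := (Facts.interp_role (hr r rfl)).1 hz
      obtain rfl := node_injective h3
      rw [Subtype.ext (hF.edge n.1 r m.1 m'.1 ((hasAx_zero π.K r).2 hα) h2 h4)]
    | funcProp f =>
      rintro x i j ⟨n, rfl, hi⟩ ⟨m, hm, hj⟩
      obtain rfl := node_injective hm
      exact hF.value rfl n.1 f i j ((hasAx_one π.K f).2 hα) hi hj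
    | range R A =>
      cases R with
      | name r =>
        intro x y hxy
        obtain ⟨n, m, rfl, rfl, h2⟩ := (Facts.interp_role (hr r (.inl rfl))).1 hxy
        exact hlab m A ((mem_lab_iff π.K F m.1 A).2 (.inr (.inl ⟨r, n.1, hα, h2⟩)))
      | inv r =>
        intro x y hxy
        obtain ⟨n, m, rfl, rfl, h2⟩ := (Facts.interp_role (hr r (.inl rfl))).1 hxy
        exact hlab n A ((mem_lab_iff π.K F n.1 A).2 (.inr (.inr ⟨r, m.1, hα, h2⟩)))
    -- Inclusions and disjointness axioms of `K` belong to `O⁺`, so they hold in every component,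
    -- and their names are interpreted componentwise.
    | incl A B =>
      have hmem : Axm.gci (.atom A) (.atom B) ∈ π.oPlus := mem_oPlus_iff.2 (.inr ⟨_, hα, rfl, rfl⟩)
      rintro ⟨i, d⟩ hd
      exact (hU.conc B (subset_sig hmem (.inr rfl)) i d).2
        (hT i _ hmem ⟨trivial, trivial⟩ ((hU.conc A (subset_sig hmem (.inl rfl)) i d).1 hd))
    | disj A B =>
      have hmem : Axm.conceptDisj (.atom A) (.atom B) ∈ π.oPlus :=
        mem_oPlus_iff.2 (.inr ⟨_, hα, rfl, rfl⟩)
      refine Set.eq_empty_iff_forall_notMem.2 ?_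
      rintro ⟨i, d⟩ ⟨hA, hB⟩
      exact Set.eq_empty_iff_forall_notMem.1 (hT i _ hmem ⟨trivial, trivial⟩) d
        ⟨(hU.conc A (subset_sig hmem (.inl rfl)) i d).1 hA,
          (hU.conc B (subset_sig hmem (.inr rfl)) i d).1 hB⟩
  have hq : ∀ B : SimplePL, B.toConcept.sig ⊆ π.query.sig →
      ∀ r, Symb.role r ∈ B.toConcept.sig → Symb.role r ∉ sig π.oPlus := fun B hB r hr =>
    role_notMem_sig_oPlus hπ (.inr (hB hr))
  -- The lower labelling consists of the facts alone, which suffice for `C`; the upper one is the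
  -- test that the procedure applies to names.
  have hext := fun (B : SimplePL) hB => Facts.mem_ext_interp (I := I)
    (L₁ := fun n A => (n, A) ∈ F.2.1)
    (L₂ := fun n A => n ∈ nodes F ∧ holds X π.toks F n A = true)
    (fun n A hA => hlab n A ((mem_lab_iff π.K F n.1 A).2 (.inl hA))) hholds B (hq B hB)
    ⟨[], hroot⟩
  intro hent
  have : Nonempty (Σ o, Δ o) := ⟨⟨some ⟨[], hroot⟩, e ⟨[], hroot⟩⟩⟩
  have hJ : ∀ β ∈ π.mainKB ++ π.O, J.Sat β := by
    intro β hβ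
    rcases List.mem_append.1 hβ with hβ | hβ
    · obtain ⟨α, hα, rfl⟩ := List.mem_map.1 hβ
      exact hK α hα
    · exact hO β hβ
  obtain ⟨D, hD', hx⟩ := FullPL.mem_ext.1 (hent _ J hJ (FullPL.mem_ext.2 ⟨C, hC,
    (hext C ((SimplePL.sig_subset hC).trans Set.subset_union_left)).1 (hF' rfl)⟩))
  have h2 := (satisfied_iff X π.toks F D).2
    ((hext D ((SimplePL.sig_subset hD').trans Set.subset_union_right)).2 hx)
  have h3 := hD D hD'
  rw [h2] at h3
  cases h3

theorem decideToks_iff {c : ℕ} {π : Triple} (hπ : π ∈ PLSOBounded c) :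
    decideToks c (OracleQuery.encode '' pos π.oPlus) π.toks π.lhs.toks π.rhs.toks = true ↔
      Entails (π.mainKB ++ π.O) π.query := by
  refine ⟨entails_of_decideToks hπ.2, fun h => ?_⟩
  rw [decideToks, List.all_eq_true]
  intro l hl
  obtain ⟨C, hC, rfl⟩ := FullPL.mem_toks.1 hl
  rw [List.all_eq_true]
  intro vs _
  rw [List.reverse_reverse]
  by_contra hn
  rw [Bool.not_eq_true, Bool.or_eq_false_iff, Bool.not_eq_false'] at hn
  refine not_entails_of_valid hπ.1 hC hn.1 (fun D hD => ?_) h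
  exact Bool.eq_false_iff.2 fun hs => Bool.eq_false_iff.1 hn.2
    (List.any_eq_true.2 ⟨_, FullPL.mem_toks.2 ⟨D, hD, rfl⟩, hs⟩)

end PLSO

theorem mainTheorem8 (c : ℕ) :
    ∃ (M : PLSO.OracleTM) (p : Polynomial ℕ),
      ∀ π ∈ PLSO.PLSOBounded c,
        M.DecidesInTime (PLSO.OracleQuery.encode '' PLSO.pos π.oPlus) π.input
          (p.eval π.input.length) (PLSO.Entails (π.mainKB ++ π.O) π.query) := by
  obtain ⟨M, p, h⟩ := PLSO.PT.exists_machine (PLSO.PT.decideNats c)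
  refine ⟨M, p, fun π hπ => h _ π.nats _ ?_⟩
  rw [PLSO.decideNats_nats]
  exact PLSO.decideToks_iff hπ
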